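/- **Conventions.** All algebras are complex, associative, not necessarily unital *-algebras. A *C\*-seminorm* on such an algebra $A$ is a submultiplicative seminorm $p$ with $p(a^*a)=p(a)^2$. An *l.m.c.-C\*-algebra* is a *-algebra with a Hausdorff vector space topology that is defined by a family of C\*-seminorms; $S(A)$ is the set of all its continuous C\*-seminorms, and morphisms are the continuous *-homomorphisms. Let $\nu$ be an ordinal of countable cofinality, $\operatorname{cof}\nu=\aleph_0$. A $\nu$-sequence $(x_\alpha)_{\alpha<\nu}$ in $A$ is *Cauchy* if for every neighbourhood $U$ of $0$ there is $\gamma<\nu$ with $x_\alpha-x_\beta\in U$ for all $\alpha,\beta\ge\gamma$, and $A$ is *$\nu$-complete* if every Cauchy $\nu$-sequence converges. $\mathbb A_\nu$ is the category of $\nu$-complete l.m.c.-C\*-algebras. The Hausdorff *$\nu$-completion* of a *-algebra with respect to a set of C\*-seminorms is the smallest *-subalgebra of its Hausdorff completion that contains the image of the algebra and the limits of its convergent $\nu$-sequences. For l.m.c.-C\*-algebras $A,B$, the tensor product $A\otimes B$ is the Hausdorff $\nu$-completion of the algebraic tensor product with respect to the C\*-seminorms $pq$, $p\in S(A)$, $q\in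 S(B)$, where $pq$ is the pull-back of the norm of the minimal C\*-tensor product $\overline{A_p}\otimes\overline{B_q}$ of the C\*-completions of $A$ and $B$ for $p$ and $q$. Let $\mathcal K$ be the C\*-algebra of compact operators on $\ell^2(\mathbb N)$ with matrix coefficients $k\mapsto k_{ij}$; these induce coefficients $w\mapsto w_{ij}$ for $w\in Z\otimes\mathcal K$ (with values in the completion of $Z$). For l.m.c.-C\*-algebras $A,B$ let $\mathrm{Hom}(A,B)$ be the set of continuous *-homomorphisms with the compact-open topology. Two elements $f,g$ are *homotopic* if there is a continuous *-homomorphism $H:A\to C([0,1],B)$ (compact-open topology on $C([0,1],B)$) with $H(a)(0)=f(a)$ and $H(a)(1)=g(a)$ for all $a$; $[A,B]$ is the quotient of $\mathrm{Hom}(A,B)$ by the equivalence relation generated by homotopy. **Construction.** Let $A\in\mathbb A_\nu$. Let $D$ be a set of representatives of all isomorphism classes of pairs $d=(Z_d,f_d)$ of an l.m.c.-C\*-algebra $Z_d$ and a continuous *-homomorphism $f_d:A\to Z_d\otimes\mathcal K$ such that all coefficients $f_d(a)_{ij}$ ($a\in A$, $i,j\in\mathbb N$) lie in $Z_d$ and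 generate $Z_d$ as a *-algebra. Put $d\ge e$ if there is a continuous *-homomorphism $\varphi^d_e:Z_d\to Z_e$ with $f_e=(\varphi^d_e\otimes\mathrm{id})\circ f_d$. Let $\lim_{d\in D}Z_d\subset\prod_d Z_d$ be the inverse limit along these maps, with projections $\mathrm{pr}_d$, and let $A\hat\otimes\mathcal K\in\mathbb A_\nu$ be its $\nu$-completion, with canonical map $\iota:\lim_d Z_d\to A\hat\otimes\mathcal K$. **Proposition.** The assignment $A\mapsto A\hat\otimes\mathcal K$ extends to a functor $\mathbb A_\nu\to\mathbb A_\nu$ that is left adjoint to the functor $-\otimes\mathcal K:\mathbb A_\nu\to\mathbb A_\nu$. The adjunction can be chosen such that the bijections, natural in $A,B\in\mathbb A_\nu$, $$\Phi_{A,B}:\ \mathrm{Hom}(A\hat\otimes\mathcal K,B)\longrightarrow\mathrm{Hom}(A,B\otimes\mathcal K)$$ have the following properties for all $A,B\in\mathbb A_\nu$: 1. $\Phi_{A,B}$ is continuous; 2. for every $d\in D$ and every continuous *-homomorphism $g:Z_d\to B$ there is $\varphi\in\mathrm{Hom}(A\hat\otimes\mathcal K,B)$ with $\varphi\circ\iota=g\circ\mathrm{pr}_d$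 and $\Phi_{A,B}(\varphi)=(g\otimes\mathrm{id}_{\mathcal K})\circ f_d$; 3. $\Phi_{A,B}$ induces a well-defined bijection $[A\hat\otimes\mathcal K,B]\to[A,B\otimes\mathcal K]$ of homotopy classes. -/

import Mathlib

open scoped TensorProduct Topology

set_option linter.unusedSectionVars false

universe u v w

noncomputable section

/-! ### C*-seminorms and l.m.c.-C*-algebras -/

/-- A C*-seminorm on a (not necessarily unital) complex *-algebra: a submultiplicative seminorm
with `p (a* a) = p a ^ 2`. -/
structure CStarSeminorm (A : Type u) [NonUnitalRing A] [StarRing A] [Module ℂ A]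
    extends Seminorm ℂ A where
  mul_le' : ∀ a b : A, toFun (a * b) ≤ toFun a * toFun b
  star_mul_self' : ∀ a : A, toFun (star a * a) = toFun a * toFun a

/-- An l.m.c.-C*-algebra: a complex *-algebra with a Hausdorff topology which is the vector space
topology defined by some family of C*-seminorms. -/
class LMCStarAlgebra (A : Type u) extends NonUnitalRing A, StarRing A, Module ℂ A,
    IsScalarTower ℂ A A, SMulCommClass ℂ A A, StarModule ℂ A, TopologicalSpace A, T2Space A where
  exists_seminorms : ∃ (ι : Type u) (p : ι → CStarSeminorm A),
    WithSeminorms (fun i => (p i).toSeminorm)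

namespace CStarSeminorm

section
variable {A : Type u} [NonUnitalRing A] [StarRing A] [Module ℂ A] (p : CStarSeminorm A)

lemma map_mul_le (a b : A) : p.toSeminorm (a * b) ≤ p.toSeminorm a * p.toSeminorm b :=
  p.mul_le' a b

lemma map_star_mul_self (a : A) :
    p.toSeminorm (star a * a) = p.toSeminorm a * p.toSeminorm a :=
  p.star_mul_self' a

lemma le_map_star (a : A) : p.toSeminorm a ≤ p.toSeminorm (star a) := by
  have h1 := p.map_star_mul_self a
  have h2 := p.map_mul_le (star a) a
  have h3 : 0 ≤ p.toSeminorm a := apply_nonneg _ _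
  have h4 : 0 ≤ p.toSeminorm (star a) := apply_nonneg _ _
  by_contra! h
  nlinarith

lemma map_star (a : A) : p.toSeminorm (star a) = p.toSeminorm a :=
  le_antisymm (by simpa using p.le_map_star (star a)) (p.le_map_star a)

/-- The pull back of a C*-seminorm along a *-homomorphism. -/
def comap {B : Type v} [NonUnitalRing B] [StarRing B] [Module ℂ B] (q : CStarSeminorm B)
    (f : A →⋆ₙₐ[ℂ] B) : CStarSeminorm A where
  toSeminorm := q.toSeminorm.comp ((f : A →ₙₐ[ℂ] B) : A →ₗ[ℂ] B)
  mul_le' a b := by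
    change q.toSeminorm (f (a * b)) ≤ q.toSeminorm (f a) * q.toSeminorm (f b)
    rw [map_mul]; exact q.map_mul_le _ _
  star_mul_self' a := by
    change q.toSeminorm (f (star a * a)) = q.toSeminorm (f a) * q.toSeminorm (f a)
    rw [map_mul, StarHomClass.map_star]; exact q.map_star_mul_self _

@[simp] lemma comap_apply {B : Type v} [NonUnitalRing B] [StarRing B] [Module ℂ B]
    (q : CStarSeminorm B) (f : A →⋆ₙₐ[ℂ] B) (a : A) :
    (q.comap f).toSeminorm a = q.toSeminorm (f a) := rfl

end

/-- The norm of a normed *-algebra satisfying the C*-identity, as a C*-seminorm. -/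
def ofNorm (A : Type u) [NonUnitalNormedRing A] [StarRing A] [NormedSpace ℂ A] [CStarRing A] :
    CStarSeminorm A where
  toSeminorm := normSeminorm ℂ A
  mul_le' a b := norm_mul_le a b
  star_mul_self' _ := CStarRing.norm_star_mul_self

end CStarSeminorm

/-- The set `S(A)` of all continuous C*-seminorms. -/
def contSeminorms (A : Type u) [LMCStarAlgebra A] : Set (CStarSeminorm A) :=
  {p | Continuous p.toSeminorm}

/-! ### Permanence: families of seminorms, embedded subalgebras, products -/

namespace LMCStarAlgebra

/-- A complex *-algebra which embeds topologically into an l.m.c.-C*-algebra is one. -/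
lemma exists_seminorms_of_inducing {A : Type u} {B : Type u} [NonUnitalRing A] [StarRing A]
    [Module ℂ A] [TopologicalSpace A] [LMCStarAlgebra B] (f : A →⋆ₙₐ[ℂ] B)
    (hf : Topology.IsInducing f) : ∃ (ι : Type u) (p : ι → CStarSeminorm A),
      WithSeminorms (fun i => (p i).toSeminorm) := by
  obtain ⟨ι, p, hp⟩ := exists_seminorms (A := B)
  refine ⟨ι, fun i => (p i).comap f, ?_⟩
  exact Topology.IsInducing.withSeminorms (f := ((f : A →ₙₐ[ℂ] B) : A →ₗ[ℂ] B)) hp hf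

/-- A *-subalgebra of an l.m.c.-C*-algebra, with the subspace topology. -/
instance ofSubalgebra {B : Type u} [LMCStarAlgebra B] (T : NonUnitalStarSubalgebra ℂ B) :
    LMCStarAlgebra T where
  exists_seminorms := exists_seminorms_of_inducing (NonUnitalStarSubalgebraClass.subtype T)
    Topology.IsInducing.subtypeVal

/-- The projection of a product of *-algebras to a factor, as a *-homomorphism. -/
def proj {I : Type u} (B : I → Type v) [∀ i, NonUnitalRing (B i)] [∀ i, StarRing (B i)]
    [∀ i, Module ℂ (B i)] (i : I) : (∀ i, B i) →⋆ₙₐ[ℂ] B i where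
  toFun x := x i
  map_smul' _ _ := rfl
  map_zero' := rfl
  map_add' _ _ := rfl
  map_mul' _ _ := rfl
  map_star' _ := rfl

/-- The product of a family of l.m.c.-C*-algebras, with the product topology. -/
instance pi {I : Type u} (B : I → Type u) [∀ i, LMCStarAlgebra (B i)] :
    LMCStarAlgebra (∀ i, B i) where
  exists_seminorms := by
    choose κ p hp using fun i => exists_seminorms (A := B i)
    exact ⟨(i : I) × κ i, fun x => (p x.1 x.2).comap (proj B x.1), withSeminorms_pi hp⟩

/-- A normed *-algebra satisfying the C*-identity is an l.m.c.-C*-algebra. -/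
abbrev ofNormed (A : Type u) [NonUnitalNormedRing A] [StarRing A] [NormedSpace ℂ A]
    [IsScalarTower ℂ A A] [SMulCommClass ℂ A A] [StarModule ℂ A] [CStarRing A] :
    LMCStarAlgebra A where
  exists_seminorms := by
    refine ⟨PUnit, fun _ => CStarSeminorm.ofNorm A, ?_⟩
    exact (norm_withSeminorms ℂ A).congr_equiv (Equiv.equivPUnit _).symm

end LMCStarAlgebra

/-! ### The C*-algebra completing a *-algebra with respect to one C*-seminorm -/

namespace CStarSeminorm

section
variable {E : Type u} [NonUnitalRing E] [StarRing E] [Module ℂ E] [IsScalarTower ℂ E E]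
  [SMulCommClass ℂ E E] [StarModule ℂ E] (p : CStarSeminorm E)

/-- A copy of the *-algebra `E`, with the topology of the single C*-seminorm `p`. -/
@[nolint unusedArguments]
def Pre (_p : CStarSeminorm E) : Type u := E

namespace Pre

instance : NonUnitalSeminormedRing p.Pre where
  __ := (inferInstanceAs (NonUnitalRing E) : NonUnitalRing E)
  __ := p.toSeminorm.toAddGroupSeminorm.toSeminormedAddCommGroup
  norm_mul_le a b := p.map_mul_le a b

instance : StarRing p.Pre := inferInstanceAs (StarRing E)
instance : Module ℂ p.Pre := inferInstanceAs (Module ℂ E)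
instance : IsScalarTower ℂ p.Pre p.Pre := inferInstanceAs (IsScalarTower ℂ E E)
instance : SMulCommClass ℂ p.Pre p.Pre := inferInstanceAs (SMulCommClass ℂ E E)
instance : StarModule ℂ p.Pre := inferInstanceAs (StarModule ℂ E)

instance : NormedSpace ℂ p.Pre where
  __ := (inferInstance : Module ℂ p.Pre)
  norm_smul_le c x := (map_smul_eq_mul p.toSeminorm c (show E from x)).le

lemma norm_star (x : p.Pre) : ‖star x‖ = ‖x‖ := p.map_star (show E from x)

instance : NormedStarGroup p.Pre where
  norm_star_le x := (norm_star p x).le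

end Pre

/-- The Hausdorff completion of `E` with respect to `p`, a C*-algebra. -/
abbrev Compl : Type u := UniformSpace.Completion p.Pre

namespace Compl

open UniformSpace UniformSpace.Completion

instance : Mul p.Compl :=
  ⟨Function.curry <| (isDenseInducing_coe.prodMap isDenseInducing_coe).extend
    ((↑) ∘ Function.uncurry (fun a b : p.Pre => a * b))⟩

lemma coe_mul (a b : p.Pre) : ((a * b : p.Pre) : p.Compl) = a * b :=
  ((isDenseInducing_coe.prodMap isDenseInducing_coe).extend_eq
    ((continuous_coe p.Pre).comp (continuous_mul (M := p.Pre))) (a, b)).symm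

instance : ContinuousMul p.Compl where
  continuous_mul := by
    let m := (AddMonoidHom.mul : p.Pre →+ p.Pre →+ p.Pre).compr₂ toCompl
    have : Continuous fun x : p.Pre × p.Pre => m x.1 x.2 :=
      (continuous_coe p.Pre).comp continuous_mul
    have di : IsDenseInducing (toCompl : p.Pre → p.Compl) := isDenseInducing_coe
    exact (di.extend_Z_bilin di this :)

instance : Star p.Compl := ⟨Completion.map star⟩

lemma uniformContinuous_star : UniformContinuous (star : p.Pre → p.Pre) :=
  (starₗᵢ ℂ : p.Pre ≃ₗᵢ⋆[ℂ] p.Pre).isometry.uniformContinuous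

lemma coe_star (a : p.Pre) : ((star a : p.Pre) : p.Compl) = star (a : p.Compl) :=
  (Completion.map_coe (uniformContinuous_star p) a).symm

instance : ContinuousStar p.Compl where
  continuous_star := Completion.continuous_map

instance : NonUnitalRing p.Compl where
  __ := (inferInstance : AddCommGroup p.Compl)
  zero_mul a := Completion.induction_on a (isClosed_eq (by fun_prop) continuous_const)
    fun a => by rw [← coe_zero, ← coe_mul, zero_mul]
  mul_zero a := Completion.induction_on a (isClosed_eq (by fun_prop) continuous_const)
    fun a => by rw [← coe_zero, ← coe_mul, mul_zero]
  mul_assoc a b c := Completion.induction_on₃ a b c (isClosed_eq (by fun_prop) (by fun_prop))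
    fun a b c => by rw [← coe_mul, ← coe_mul, ← coe_mul, ← coe_mul, mul_assoc]
  left_distrib a b c := Completion.induction_on₃ a b c (isClosed_eq (by fun_prop) (by fun_prop))
    fun a b c => by rw [← coe_add, ← coe_mul, ← coe_mul, ← coe_mul, ← coe_add, mul_add]
  right_distrib a b c := Completion.induction_on₃ a b c (isClosed_eq (by fun_prop) (by fun_prop))
    fun a b c => by rw [← coe_add, ← coe_mul, ← coe_mul, ← coe_mul, ← coe_add, add_mul]

instance : StarRing p.Compl where
  star_involutive a := Completion.induction_on a (isClosed_eq (by fun_prop) (by fun_prop))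
    fun a => by rw [← coe_star, ← coe_star, star_star]
  star_mul a b := Completion.induction_on₂ a b (isClosed_eq (by fun_prop) (by fun_prop))
    fun a b => by rw [← coe_mul, ← coe_star, ← coe_star, ← coe_star, ← coe_mul, star_mul]
  star_add a b := Completion.induction_on₂ a b (isClosed_eq (by fun_prop) (by fun_prop))
    fun a b => by rw [← coe_add, ← coe_star, ← coe_star, ← coe_star, ← coe_add, star_add]

instance : NonUnitalNormedRing p.Compl where
  __ := (inferInstance : NormedAddCommGroup p.Compl)
  __ := (inferInstance : NonUnitalRing p.Compl)
  norm_mul_le a b := Completion.induction_on₂ a b (isClosed_le (by fun_prop) (by fun_prop))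
    fun a b => by
      rw [← coe_mul, norm_coe, norm_coe, norm_coe]
      exact norm_mul_le a b

lemma continuous_const_smul' (c : ℂ) : Continuous (fun a : p.Compl => c • a) :=
  continuous_const_smul c

instance : IsScalarTower ℂ p.Compl p.Compl where
  smul_assoc c a b := by
    change (c • a) * b = c • (a * b)
    refine Completion.induction_on₂ a b (isClosed_eq ?_ ?_) fun a b => ?_
    · exact ((continuous_const_smul' p c).comp continuous_fst).mul continuous_snd
    · exact (continuous_const_smul' p c).comp continuous_mul
    · rw [← coe_smul, ← coe_mul, ← coe_mul, ← coe_smul, smul_mul_assoc]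

instance : SMulCommClass ℂ p.Compl p.Compl where
  smul_comm c a b := by
    change c • (a * b) = a * (c • b)
    refine Completion.induction_on₂ a b (isClosed_eq ?_ ?_) fun a b => ?_
    · exact (continuous_const_smul' p c).comp continuous_mul
    · exact continuous_fst.mul ((continuous_const_smul' p c).comp continuous_snd)
    · rw [← coe_smul, ← coe_mul, ← coe_mul, ← coe_smul, mul_smul_comm]

instance : StarModule ℂ p.Compl where
  star_smul c a := by
    refine Completion.induction_on a (isClosed_eq ?_ ?_) fun a => ?_
    · exact continuous_star.comp (continuous_const_smul' p c)
    · exact (continuous_const_smul' p (star c)).comp continuous_star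
    · rw [← coe_smul, ← coe_star, ← coe_star, ← coe_smul, star_smul]

instance : CStarRing p.Compl where
  norm_mul_self_le a := Completion.induction_on a (isClosed_le (by fun_prop) (by fun_prop))
    fun a => by
      rw [← coe_star, ← coe_mul, norm_coe, norm_coe]
      exact (p.map_star_mul_self a).ge

/-- The canonical map from `E` to the C*-algebra completing it. -/
def of : E →⋆ₙₐ[ℂ] p.Compl where
  toFun x := ((show p.Pre from x) : p.Compl)
  map_smul' c x := coe_smul c (show p.Pre from x)
  map_zero' := coe_zero
  map_add' x y := coe_add (show p.Pre from x) (show p.Pre from y)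
  map_mul' x y := coe_mul p x y
  map_star' x := coe_star p x

lemma norm_of (x : E) : ‖of p x‖ = p.toSeminorm x := norm_coe (show p.Pre from x)

lemma denseRange_of : DenseRange (of p) := denseRange_coe (α := p.Pre)

instance : LMCStarAlgebra p.Compl := LMCStarAlgebra.ofNormed p.Compl

end Compl

end

end CStarSeminorm

/-! ### Completeness with respect to sequences indexed by an ordinal -/

section NuComplete

variable (ν : Ordinal.{w})

/-- Cauchy `ν`-sequences. -/
def IsNuCauchy {A : Type u} [LMCStarAlgebra A] (x : Set.Iio ν → A) : Prop :=
  ∀ U ∈ 𝓝 (0 : A), ∃ γ : Set.Iio ν, ∀ α β : Set.Iio ν, γ ≤ α → γ ≤ β → x α - x β ∈ U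

/-- `A` is `ν`-complete if every Cauchy `ν`-sequence in `A` converges. -/
def IsNuComplete (A : Type u) [LMCStarAlgebra A] : Prop :=
  ∀ x : Set.Iio ν → A, IsNuCauchy ν x → ∃ a : A, Filter.Tendsto x Filter.atTop (𝓝 a)

/-- A set which contains the limits of its convergent `ν`-sequences (no condition if `ν = 0`). -/
def IsNuClosed {X : Type u} [TopologicalSpace X] (T : Set X) : Prop :=
  Nonempty (Set.Iio ν) → ∀ x : Set.Iio ν → X, (∀ α, x α ∈ T) → ∀ b, Filter.Tendsto x Filter.atTop (𝓝 b) → b ∈ T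

/-- The smallest *-subalgebra which contains `T` and is closed under limits of `ν`-sequences. -/
def nuClosure {B : Type u} [LMCStarAlgebra B] (T : NonUnitalStarSubalgebra ℂ B) :
    NonUnitalStarSubalgebra ℂ B :=
  sInf {T' | T ≤ T' ∧ IsNuClosed ν (T' : Set B)}

variable {ν} in
lemma le_nuClosure {B : Type u} [LMCStarAlgebra B] (T : NonUnitalStarSubalgebra ℂ B) :
    T ≤ nuClosure ν T :=
  le_sInf fun _ h => h.1

lemma isNuClosed_nuClosure {B : Type u} [LMCStarAlgebra B] (T : NonUnitalStarSubalgebra ℂ B) :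
    IsNuClosed ν (nuClosure ν T : Set B) := by
  intro hν x hx b hb
  simp only [nuClosure, SetLike.mem_coe, NonUnitalStarAlgebra.mem_sInf] at hx ⊢
  exact fun T' hT' => hT'.2 hν x (fun α => hx α T' hT') b hb

variable {ν} in
lemma nuClosure_le {B : Type u} [LMCStarAlgebra B] {T T' : NonUnitalStarSubalgebra ℂ B}
    (h : T ≤ T') (h' : IsNuClosed ν (T' : Set B)) : nuClosure ν T ≤ T' :=
  sInf_le ⟨h, h'⟩

end NuComplete

/-! ### The Hausdorff `ν`-completion of a *-algebra with respect to a set of C*-seminorms -/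

section NuCompletion

variable (ν : Ordinal.{w})
variable {E : Type u} [NonUnitalRing E] [StarRing E] [Module ℂ E] [IsScalarTower ℂ E E]
  [SMulCommClass ℂ E E] [StarModule ℂ E] (S : Set (CStarSeminorm E))

/-- The product of the C*-algebras completing `E` with respect to the seminorms in `S`. -/
abbrev SeminormProduct : Type u := ∀ p : S, p.1.Compl

/-- The canonical map from `E` to the product of the C*-algebras completing it. Its image is the
Hausdorff quotient of `E` for the topology defined by `S`. -/
def toSeminormProduct : E →⋆ₙₐ[ℂ] SeminormProduct S where
  toFun x p := CStarSeminorm.Compl.of p.1 x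
  map_smul' c x := funext fun p => map_smul (CStarSeminorm.Compl.of p.1) c x
  map_zero' := funext fun p => map_zero (CStarSeminorm.Compl.of p.1)
  map_add' x y := funext fun p => map_add (CStarSeminorm.Compl.of p.1) x y
  map_mul' x y := funext fun p => map_mul (CStarSeminorm.Compl.of p.1) x y
  map_star' x := funext fun p => map_star (CStarSeminorm.Compl.of p.1) x

/-- The `ν`-completion as a subalgebra of the product of all C*-algebra completions. -/
def nuCompletionSubalgebra : NonUnitalStarSubalgebra ℂ (SeminormProduct S) :=
  nuClosure ν (NonUnitalStarAlgHom.range (toSeminormProduct S))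

/-- The Hausdorff `ν`-completion of `E` with respect to `S`: inside the complete algebra
`∏_{p ∈ S} Compl p`, the smallest *-subalgebra containing the image of `E` which is closed under
limits of `ν`-sequences. -/
def NuCompletion : Type u := nuCompletionSubalgebra ν S

namespace NuCompletion

instance : LMCStarAlgebra (NuCompletion ν S) :=
  LMCStarAlgebra.ofSubalgebra (nuCompletionSubalgebra ν S)

/-- The inclusion of the `ν`-completion in the product. -/
def incl : NuCompletion ν S →⋆ₙₐ[ℂ] SeminormProduct S :=
  NonUnitalStarSubalgebraClass.subtype (nuCompletionSubalgebra ν S)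

lemma isInducing_incl : Topology.IsInducing (incl ν S) := Topology.IsInducing.subtypeVal

lemma incl_injective : Function.Injective (incl ν S) := Subtype.val_injective

lemma isNuComplete : IsNuComplete ν (NuCompletion ν S) := by
  intro x hx
  have hx' : ∀ U ∈ 𝓝 (0 : SeminormProduct S), ∃ γ : Set.Iio ν, ∀ α β : Set.Iio ν,
      γ ≤ α → γ ≤ β → incl ν S (x α) - incl ν S (x β) ∈ U := by
    intro U hU
    have h0 : incl ν S ⁻¹' U ∈ 𝓝 (0 : NuCompletion ν S) := by
      rw [(isInducing_incl ν S).nhds_eq_comap, map_zero]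
      exact Filter.preimage_mem_comap hU
    obtain ⟨γ, hγ⟩ := hx _ h0
    exact ⟨γ, fun α β h1 h2 => by simpa [map_sub] using hγ α β h1 h2⟩
  obtain ⟨γ₀, -⟩ := hx' Set.univ Filter.univ_mem
  have hν : Nonempty (Set.Iio ν) := ⟨γ₀⟩
  have hc : CauchySeq (fun α => incl ν S (x α)) := by
    rw [(Filter.basis_sets _).cauchySeq_iff]
    intro V hV
    simp only [id]
    rw [uniformity_eq_comap_nhds_zero] at hV
    obtain ⟨U, hU, hUV⟩ := hV
    obtain ⟨γ, hγ⟩ := hx' U hU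
    exact ⟨γ, fun k hk l hl => hUV (hγ l k hl hk)⟩
  obtain ⟨b, hb⟩ := cauchySeq_tendsto_of_complete hc
  have hmem : b ∈ nuCompletionSubalgebra ν S :=
    isNuClosed_nuClosure ν _ hν (fun α => incl ν S (x α)) (fun α => (x α).2) b hb
  exact ⟨⟨b, hmem⟩, (isInducing_incl ν S).tendsto_nhds_iff.2 hb⟩

/-- The canonical map from `E` to its `ν`-completion. -/
def of : E →⋆ₙₐ[ℂ] NuCompletion ν S where
  toFun x := ⟨toSeminormProduct S x, le_nuClosure _ ⟨x, rfl⟩⟩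
  map_smul' c x := Subtype.ext (map_smul (toSeminormProduct S) c x)
  map_zero' := Subtype.ext (map_zero (toSeminormProduct S))
  map_add' x y := Subtype.ext (map_add (toSeminormProduct S) x y)
  map_mul' x y := Subtype.ext (map_mul (toSeminormProduct S) x y)
  map_star' x := Subtype.ext (map_star (toSeminormProduct S) x)

lemma incl_of (x : E) : incl ν S (of ν S x) = toSeminormProduct S x := rfl

variable {ν S}

/-- Continuous *-homomorphisms on the `ν`-completion are determined on `E`. -/
lemma hom_ext {B : Type v} [LMCStarAlgebra B] {f g : NuCompletion ν S →⋆ₙₐ[ℂ] B}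
    (hf : Continuous f) (hg : Continuous g) (h : ∀ x, f (of ν S x) = g (of ν S x)) : f = g := by
  have key : nuCompletionSubalgebra ν S ≤
      (NonUnitalStarAlgHom.equalizer f g).map (incl ν S) := by
    refine nuClosure_le ?_ ?_
    · rintro _ ⟨x, rfl⟩
      exact ⟨of ν S x, h x, rfl⟩
    · intro hν x hx b hb
      choose y hy hyx using hx
      have hmem : b ∈ nuCompletionSubalgebra ν S :=
        isNuClosed_nuClosure ν _ hν x (fun α => by rw [← hyx α]; exact (y α).2) b hb
      have hlim : Filter.Tendsto y Filter.atTop (𝓝 (⟨b, hmem⟩ : NuCompletion ν S)) :=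
        (isInducing_incl ν S).tendsto_nhds_iff.2 (by
          have : incl ν S ∘ y = x := funext hyx
          rw [this]; exact hb)
      refine ⟨⟨b, hmem⟩, ?_, rfl⟩
      have h1 := (hf.tendsto _).comp hlim
      have h2 := (hg.tendsto _).comp hlim
      have h3 : f ∘ y = g ∘ y := funext hy
      rw [h3] at h1
      exact tendsto_nhds_unique h1 h2
  ext x
  obtain ⟨y, hy, hyx⟩ := key x.2
  rw [← incl_injective ν S hyx]
  exact hy

end NuCompletion

section Map

variable {ν S}
variable {E' : Type v} [NonUnitalRing E'] [StarRing E'] [Module ℂ E'] [IsScalarTower ℂ E' E']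
  [SMulCommClass ℂ E' E'] [StarModule ℂ E'] {S' : Set (CStarSeminorm E')}

/-- The map of C*-algebra completions induced by a *-homomorphism. -/
def CStarSeminorm.Compl.map {p : CStarSeminorm E} {p' : CStarSeminorm E'} (f : E →⋆ₙₐ[ℂ] E')
    (h : ∀ x, p'.toSeminorm (f x) ≤ p.toSeminorm x) : p.Compl →⋆ₙₐ[ℂ] p'.Compl :=
  have hu : UniformContinuous (fun x : p.Pre => (show p'.Pre from f (show E from x))) :=
    AddMonoidHomClass.uniformContinuous_of_bound
      (AddMonoidHom.mk' (fun x : p.Pre => (show p'.Pre from f (show E from x)))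
        (fun a b => map_add f (show E from a) (show E from b))) 1 (fun x => by
          rw [one_mul]; exact h x)
  have hco : ∀ x : p.Pre, UniformSpace.Completion.map
      (fun x : p.Pre => (show p'.Pre from f (show E from x))) (x : p.Compl) =
      CStarSeminorm.Compl.of p' (f x) := fun x => UniformSpace.Completion.map_coe hu x
  have hc : Continuous (UniformSpace.Completion.map
      (fun x : p.Pre => (show p'.Pre from f (show E from x)))) :=
    UniformSpace.Completion.continuous_map
  { toFun := UniformSpace.Completion.map (fun x : p.Pre => (show p'.Pre from f (show E from x)))
    map_smul' := fun c a => by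
      refine UniformSpace.Completion.induction_on a (isClosed_eq ?_ ?_) fun a => ?_
      · exact hc.comp (CStarSeminorm.Compl.continuous_const_smul' p c)
      · exact (CStarSeminorm.Compl.continuous_const_smul' p' c).comp hc
      · rw [hco, ← UniformSpace.Completion.coe_smul, hco]
        exact (congrArg _ (map_smul f c (show E from a))).trans (map_smul _ _ _)
    map_zero' := (hco 0).trans ((congrArg _ (map_zero f)).trans (map_zero _))
    map_add' := fun a b => by
      refine UniformSpace.Completion.induction_on₂ a b (isClosed_eq ?_ ?_) fun a b => ?_
      · exact hc.comp continuous_add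
      · exact (hc.comp continuous_fst).add (hc.comp continuous_snd)
      · rw [hco, hco, ← UniformSpace.Completion.coe_add, hco]
        exact (congrArg _ (map_add f (show E from a) (show E from b))).trans (map_add _ _ _)
    map_mul' := fun a b => by
      refine UniformSpace.Completion.induction_on₂ a b (isClosed_eq ?_ ?_) fun a b => ?_
      · exact hc.comp continuous_mul
      · exact (hc.comp continuous_fst).mul (hc.comp continuous_snd)
      · rw [hco, hco, ← CStarSeminorm.Compl.coe_mul, hco]
        exact (congrArg _ (map_mul f (show E from a) (show E from b))).trans (map_mul _ _ _)
    map_star' := fun a => by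
      refine UniformSpace.Completion.induction_on a (isClosed_eq ?_ ?_) fun a => ?_
      · exact hc.comp continuous_star
      · exact continuous_star.comp hc
      · rw [hco, ← CStarSeminorm.Compl.coe_star, hco]
        exact (congrArg _ (StarHomClass.map_star f (show E from a))).trans (StarHomClass.map_star _ _) }

lemma CStarSeminorm.Compl.continuous_map {p : CStarSeminorm E} {p' : CStarSeminorm E'}
    (f : E →⋆ₙₐ[ℂ] E') (h : ∀ x, p'.toSeminorm (f x) ≤ p.toSeminorm x) :
    Continuous (CStarSeminorm.Compl.map f h) :=
  UniformSpace.Completion.continuous_map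

lemma CStarSeminorm.Compl.map_of {p : CStarSeminorm E} {p' : CStarSeminorm E'}
    (f : E →⋆ₙₐ[ℂ] E') (h : ∀ x, p'.toSeminorm (f x) ≤ p.toSeminorm x) (x : E) :
    CStarSeminorm.Compl.map f h (CStarSeminorm.Compl.of p x) = CStarSeminorm.Compl.of p' (f x) :=
  UniformSpace.Completion.map_coe (AddMonoidHomClass.uniformContinuous_of_bound
      (AddMonoidHom.mk' (fun x : p.Pre => (show p'.Pre from f (show E from x)))
        (fun a b => map_add f (show E from a) (show E from b))) 1 (fun x => by
          rw [one_mul]; exact h x)) _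

namespace NuCompletion

/-- A seminorm in `S` which dominates the pull back of `p'`. -/
def domIdx (f : E →⋆ₙₐ[ℂ] E')
    (h : ∀ p' ∈ S', ∃ p ∈ S, ∀ x, p'.toSeminorm (f x) ≤ p.toSeminorm x) (p' : S') : S :=
  ⟨(h p'.1 p'.2).choose, (h p'.1 p'.2).choose_spec.1⟩

lemma domIdx_spec (f : E →⋆ₙₐ[ℂ] E')
    (h : ∀ p' ∈ S', ∃ p ∈ S, ∀ x, p'.toSeminorm (f x) ≤ p.toSeminorm x) (p' : S') (x : E) :
    p'.1.toSeminorm (f x) ≤ (domIdx f h p').1.toSeminorm x :=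
  (h p'.1 p'.2).choose_spec.2 x

/-- The map of products of C*-algebra completions induced by a *-homomorphism under which every
seminorm in `S'` is dominated by a seminorm in `S`. -/
def productMap (f : E →⋆ₙₐ[ℂ] E')
    (h : ∀ p' ∈ S', ∃ p ∈ S, ∀ x, p'.toSeminorm (f x) ≤ p.toSeminorm x) :
    SeminormProduct S →⋆ₙₐ[ℂ] SeminormProduct S' where
  toFun x p' := CStarSeminorm.Compl.map f (domIdx_spec f h p') (x (domIdx f h p'))
  map_smul' c x := funext fun _ => map_smul (CStarSeminorm.Compl.map f _) c (x _)
  map_zero' := funext fun _ => map_zero (CStarSeminorm.Compl.map f _)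
  map_add' x y := funext fun _ => map_add (CStarSeminorm.Compl.map f _) (x _) (y _)
  map_mul' x y := funext fun _ => map_mul (CStarSeminorm.Compl.map f _) (x _) (y _)
  map_star' x := funext fun _ => map_star (CStarSeminorm.Compl.map f _) (x _)

variable (f : E →⋆ₙₐ[ℂ] E')
    (h : ∀ p' ∈ S', ∃ p ∈ S, ∀ x, p'.toSeminorm (f x) ≤ p.toSeminorm x)

lemma continuous_productMap : Continuous (productMap f h) :=
  continuous_pi fun p' =>
    (CStarSeminorm.Compl.continuous_map f (domIdx_spec f h p')).comp (continuous_apply _)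

lemma productMap_toSeminormProduct (x : E) :
    productMap f h (toSeminormProduct S x) = toSeminormProduct S' (f x) :=
  funext fun p' => CStarSeminorm.Compl.map_of f (domIdx_spec f h p') x

lemma productMap_mem (x : NuCompletion ν S) :
    productMap f h (incl ν S x) ∈ nuCompletionSubalgebra ν S' := by
  have key : nuCompletionSubalgebra ν S ≤
      (nuCompletionSubalgebra ν S').comap (productMap f h) := by
    refine nuClosure_le ?_ ?_
    · rintro _ ⟨x, rfl⟩
      change productMap f h (toSeminormProduct S x) ∈ nuCompletionSubalgebra ν S'
      rw [productMap_toSeminormProduct]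
      exact le_nuClosure _ ⟨f x, rfl⟩
    · intro hν x hx b hb
      exact isNuClosed_nuClosure ν _ hν _ hx _ (((continuous_productMap f h).tendsto b).comp hb)
  exact key x.2

/-- The continuous *-homomorphism of `ν`-completions induced by a *-homomorphism under which every
seminorm in `S'` is dominated by a seminorm in `S`. -/
def map : NuCompletion ν S →⋆ₙₐ[ℂ] NuCompletion ν S' where
  toFun x := ⟨productMap f h (incl ν S x), productMap_mem f h x⟩
  map_smul' c x := Subtype.ext (map_smul ((productMap f h).comp (incl ν S)) c x)
  map_zero' := Subtype.ext (map_zero ((productMap f h).comp (incl ν S)))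
  map_add' x y := Subtype.ext (map_add ((productMap f h).comp (incl ν S)) x y)
  map_mul' x y := Subtype.ext (map_mul ((productMap f h).comp (incl ν S)) x y)
  map_star' x := Subtype.ext (map_star ((productMap f h).comp (incl ν S)) x)

lemma continuous_map : Continuous (map f h : NuCompletion ν S → NuCompletion ν S') :=
  (isInducing_incl ν S').continuous_iff.2
    ((continuous_productMap f h).comp (isInducing_incl ν S).continuous)

lemma map_of (x : E) : map f h (of ν S x) = of ν S' (f x) :=
  Subtype.ext (productMap_toSeminormProduct f h x)

end NuCompletion

end Map

end NuCompletion

/-! ### The minimal C*-tensor product seminorm -/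

namespace CStarSeminorm

section
variable {A : Type u} [NonUnitalRing A] [StarRing A] [Module ℂ A]

/-- A *-representation of `A` by bounded operators on a Hilbert space which is bounded by `p`,
i.e. a *-representation of the C*-algebra `Compl p`. -/
structure Rep (p : CStarSeminorm A) : Type (u + 1) where
  H : Type u
  [normed : NormedAddCommGroup H]
  [inner : InnerProductSpace ℂ H]
  [complete : CompleteSpace H]
  π : A →⋆ₙₐ[ℂ] (H →L[ℂ] H)
  norm_le : ∀ a, ‖π a‖ ≤ p.toSeminorm a

attribute [instance] Rep.normed Rep.inner Rep.complete

end

section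
variable {A : Type u} [NonUnitalRing A] [StarRing A] [Module ℂ A] [IsScalarTower ℂ A A]
  [SMulCommClass ℂ A A] [StarModule ℂ A]
variable {B : Type v} [NonUnitalRing B] [StarRing B] [Module ℂ B] [IsScalarTower ℂ B B]
  [SMulCommClass ℂ B B] [StarModule ℂ B]
variable {p : CStarSeminorm A} {q : CStarSeminorm B}

/-- The tensor product `a ⊗ b ↦ π a ⊗ ρ b` of two representations, acting on the algebraic tensor
product of the Hilbert spaces with its inner product. (The operator norm there is the same as on
the completed tensor product.) -/
def tensorRep (π : p.Rep) (ρ : q.Rep) :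
    A ⊗[ℂ] B →ₗ[ℂ] (π.H ⊗[ℂ] ρ.H →L[ℂ] π.H ⊗[ℂ] ρ.H) :=
  TensorProduct.lift (LinearMap.mk₂ ℂ (fun a b => TensorProduct.mapL (π.π a) (ρ.π b))
    (fun a a' b => by rw [map_add, TensorProduct.mapL_add_left])
    (fun c a b => by rw [map_smul, TensorProduct.mapL_smul_left])
    (fun a b b' => by rw [map_add, TensorProduct.mapL_add_right])
    (fun c a b => by rw [map_smul, TensorProduct.mapL_smul_right]))

@[simp] lemma tensorRep_tmul (π : p.Rep) (ρ : q.Rep) (a : A) (b : B) :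
    tensorRep π ρ (a ⊗ₜ b) = TensorProduct.mapL (π.π a) (ρ.π b) := by
  simp [tensorRep]

lemma tensorRep_mul (π : p.Rep) (ρ : q.Rep) (x y : A ⊗[ℂ] B) :
    tensorRep π ρ (x * y) = tensorRep π ρ x * tensorRep π ρ y := by
  induction x with
  | zero => simp
  | add x x' hx hx' => rw [add_mul, map_add, hx, hx', map_add, add_mul]
  | tmul a b =>
    induction y with
    | zero => simp
    | add y y' hy hy' => rw [mul_add, map_add, hy, hy', map_add, mul_add]
    | tmul a' b' =>
      rw [Algebra.TensorProduct.tmul_mul_tmul, tensorRep_tmul, tensorRep_tmul, tensorRep_tmul,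
        map_mul, map_mul, TensorProduct.mapL_mul]

lemma inner_tensorRep_star (π : p.Rep) (ρ : q.Rep) (x : A ⊗[ℂ] B) (ξ η : π.H ⊗[ℂ] ρ.H) :
    inner ℂ (tensorRep π ρ (star x) ξ) η = inner ℂ ξ (tensorRep π ρ x η) := by
  induction x with
  | zero => simp
  | add x x' hx hx' =>
    rw [star_add, map_add, map_add, add_apply, add_apply,
      inner_add_left, inner_add_right, hx, hx']
  | tmul a b =>
    rw [TensorProduct.star_tmul, tensorRep_tmul, tensorRep_tmul]
    induction ξ with
    | zero => simp
    | add ξ ξ' h h' => rw [map_add, inner_add_left, inner_add_left, h, h']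
    | tmul ξ₁ ξ₂ =>
      induction η with
      | zero => simp
      | add η η' h h' => rw [map_add, inner_add_right, inner_add_right, h, h']
      | tmul η₁ η₂ =>
        rw [TensorProduct.mapL_tmul, TensorProduct.mapL_tmul, TensorProduct.inner_tmul,
          TensorProduct.inner_tmul, StarHomClass.map_star, StarHomClass.map_star,
          ContinuousLinearMap.star_eq_adjoint, ContinuousLinearMap.star_eq_adjoint,
          ContinuousLinearMap.adjoint_inner_left, ContinuousLinearMap.adjoint_inner_left]

/-- The operator norm of `(π ⊗ ρ) x`. -/
def repNorm (π : p.Rep) (ρ : q.Rep) (x : A ⊗[ℂ] B) : ℝ := ‖tensorRep π ρ x‖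

lemma repNorm_nonneg (π : p.Rep) (ρ : q.Rep) (x : A ⊗[ℂ] B) : 0 ≤ repNorm π ρ x :=
  ContinuousLinearMap.opNorm_nonneg _

lemma repNorm_zero (π : p.Rep) (ρ : q.Rep) : repNorm π ρ (0 : A ⊗[ℂ] B) = 0 := by
  rw [repNorm, map_zero]; exact ContinuousLinearMap.opNorm_zero

lemma repNorm_add (π : p.Rep) (ρ : q.Rep) (x y : A ⊗[ℂ] B) :
    repNorm π ρ (x + y) ≤ repNorm π ρ x + repNorm π ρ y := by
  rw [repNorm, map_add]; exact ContinuousLinearMap.opNorm_add_le _ _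

lemma repNorm_smul (π : p.Rep) (ρ : q.Rep) (c : ℂ) (x : A ⊗[ℂ] B) :
    repNorm π ρ (c • x) ≤ ‖c‖ * repNorm π ρ x := by
  rw [repNorm, map_smul]; exact ContinuousLinearMap.opNorm_smul_le _ _

lemma repNorm_mul (π : p.Rep) (ρ : q.Rep) (x y : A ⊗[ℂ] B) :
    repNorm π ρ (x * y) ≤ repNorm π ρ x * repNorm π ρ y := by
  rw [repNorm, tensorRep_mul]; exact ContinuousLinearMap.opNorm_comp_le _ _

lemma repNorm_sq_le (π : p.Rep) (ρ : q.Rep) (x : A ⊗[ℂ] B) :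
    repNorm π ρ x * repNorm π ρ x ≤ repNorm π ρ (star x * x) := by
  have hn := repNorm_nonneg π ρ (star x * x)
  have h : repNorm π ρ x ≤ √ (repNorm π ρ (star x * x)) := by
    refine ContinuousLinearMap.opNorm_le_bound _ (Real.sqrt_nonneg _) fun ξ => ?_
    refine le_of_sq_le_sq ?_ (by positivity)
    rw [mul_pow, Real.sq_sqrt hn, ← inner_self_eq_norm_sq (𝕜 := ℂ), ← inner_tensorRep_star]
    have e : tensorRep π ρ (star x) (tensorRep π ρ x ξ) = tensorRep π ρ (star x * x) ξ := by
      rw [tensorRep_mul]; rfl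
    rw [e]
    calc RCLike.re (inner ℂ (tensorRep π ρ (star x * x) ξ) ξ)
        ≤ ‖tensorRep π ρ (star x * x) ξ‖ * ‖ξ‖ :=
          re_inner_le_norm (𝕜 := ℂ) (tensorRep π ρ (star x * x) ξ) ξ
      _ ≤ (repNorm π ρ (star x * x) * ‖ξ‖) * ‖ξ‖ := by
          gcongr; exact ContinuousLinearMap.le_opNorm _ _
      _ = _ := by ring
  calc _ ≤ √ (repNorm π ρ (star x * x)) * √ (repNorm π ρ (star x * x)) :=
        mul_le_mul h h (repNorm_nonneg π ρ x) (Real.sqrt_nonneg _)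
    _ = _ := Real.mul_self_sqrt hn

lemma repNorm_star_mul_self (π : p.Rep) (ρ : q.Rep) (x : A ⊗[ℂ] B) :
    repNorm π ρ (star x * x) = repNorm π ρ x * repNorm π ρ x := by
  have hle : ∀ y : A ⊗[ℂ] B, repNorm π ρ y ≤ repNorm π ρ (star y) := by
    intro y
    have h1 := repNorm_sq_le π ρ y
    have h2 := repNorm_mul π ρ (star y) y
    have h3 := repNorm_nonneg π ρ y
    have h4 := repNorm_nonneg π ρ (star y)
    by_contra! h
    nlinarith
  refine le_antisymm ((repNorm_mul π ρ _ _).trans ?_) (repNorm_sq_le π ρ x)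
  exact mul_le_mul_of_nonneg_right (by simpa using hle (star x)) (repNorm_nonneg π ρ x)

lemma exists_repNorm_le (p : CStarSeminorm A) (q : CStarSeminorm B) (x : A ⊗[ℂ] B) :
    ∃ C, ∀ (π : p.Rep) (ρ : q.Rep), repNorm π ρ x ≤ C := by
  induction x with
  | zero => exact ⟨0, fun π ρ => (repNorm_zero π ρ).le⟩
  | add x y hx hy =>
    obtain ⟨C, hC⟩ := hx
    obtain ⟨D, hD⟩ := hy
    exact ⟨C + D, fun π ρ => (repNorm_add π ρ x y).trans (add_le_add (hC π ρ) (hD π ρ))⟩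
  | tmul a b =>
    refine ⟨p.toSeminorm a * q.toSeminorm b, fun π ρ => ?_⟩
    rw [repNorm, tensorRep_tmul]
    refine (TensorProduct.norm_mapL_le _ _).trans ?_
    exact mul_le_mul (π.norm_le a) (ρ.norm_le b) (norm_nonneg _) (apply_nonneg _ _)

/-- The supremum of the norms of `(π ⊗ ρ) x` over all representations `π` of `Compl p` and `ρ` of
`Compl q`. -/
def minNorm (p : CStarSeminorm A) (q : CStarSeminorm B) (x : A ⊗[ℂ] B) : ℝ :=
  ⨆ i : p.Rep × q.Rep, repNorm i.1 i.2 x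

lemma repNorm_le_minNorm (π : p.Rep) (ρ : q.Rep) (x : A ⊗[ℂ] B) :
    repNorm π ρ x ≤ minNorm p q x := by
  obtain ⟨C, hC⟩ := exists_repNorm_le p q x
  exact le_ciSup (f := fun i : p.Rep × q.Rep => repNorm i.1 i.2 x)
    ⟨C, by rintro _ ⟨i, rfl⟩; exact hC i.1 i.2⟩ (π, ρ)

lemma minNorm_nonneg (x : A ⊗[ℂ] B) : 0 ≤ minNorm p q x :=
  Real.iSup_nonneg fun i => repNorm_nonneg i.1 i.2 x

lemma minNorm_le {x : A ⊗[ℂ] B} {C : ℝ} (hC : 0 ≤ C)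
    (h : ∀ (π : p.Rep) (ρ : q.Rep), repNorm π ρ x ≤ C) : minNorm p q x ≤ C :=
  Real.iSup_le (fun i => h i.1 i.2) hC

/-- The C*-seminorm `pq` on the algebraic tensor product: the pull back of the norm of the minimal
tensor product of the C*-algebras `Compl p` and `Compl q`. -/
def minTensor (p : CStarSeminorm A) (q : CStarSeminorm B) : CStarSeminorm (A ⊗[ℂ] B) where
  toSeminorm := Seminorm.ofSMulLE (minNorm p q)
    (le_antisymm (minNorm_le le_rfl fun π ρ => (repNorm_zero π ρ).le) (minNorm_nonneg _))
    (fun x y => minNorm_le (add_nonneg (minNorm_nonneg x) (minNorm_nonneg y)) fun π ρ =>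
      (repNorm_add π ρ x y).trans
        (add_le_add (repNorm_le_minNorm π ρ x) (repNorm_le_minNorm π ρ y)))
    (fun c x => minNorm_le (mul_nonneg (norm_nonneg c) (minNorm_nonneg x)) fun π ρ =>
      (repNorm_smul π ρ c x).trans
        (mul_le_mul_of_nonneg_left (repNorm_le_minNorm π ρ x) (norm_nonneg c)))
  mul_le' x y := minNorm_le (mul_nonneg (minNorm_nonneg x) (minNorm_nonneg y)) fun π ρ =>
    (repNorm_mul π ρ x y).trans (mul_le_mul (repNorm_le_minNorm π ρ x) (repNorm_le_minNorm π ρ y)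
      (repNorm_nonneg π ρ y) (minNorm_nonneg x))
  star_mul_self' x := by
    refine le_antisymm ?_ ?_
    · refine minNorm_le (mul_nonneg (minNorm_nonneg x) (minNorm_nonneg x)) fun π ρ => ?_
      rw [repNorm_star_mul_self]
      exact mul_le_mul (repNorm_le_minNorm π ρ x) (repNorm_le_minNorm π ρ x)
        (repNorm_nonneg π ρ x) (minNorm_nonneg x)
    · have h : minNorm p q x ≤ √ (minNorm p q (star x * x)) := by
        refine minNorm_le (Real.sqrt_nonneg _) fun π ρ => Real.le_sqrt_of_sq_le ?_
        rw [sq, ← repNorm_star_mul_self]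
        exact repNorm_le_minNorm π ρ _
      calc _ ≤ √ (minNorm p q (star x * x)) * √ (minNorm p q (star x * x)) :=
            mul_le_mul h h (minNorm_nonneg x) (Real.sqrt_nonneg _)
        _ = _ := Real.mul_self_sqrt (minNorm_nonneg _)

lemma minTensor_apply (p : CStarSeminorm A) (q : CStarSeminorm B) (x : A ⊗[ℂ] B) :
    (minTensor p q).toSeminorm x = minNorm p q x := rfl

end

section
variable {A : Type u} [NonUnitalRing A] [StarRing A] [Module ℂ A] [IsScalarTower ℂ A A]
  [SMulCommClass ℂ A A] [StarModule ℂ A]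
variable {A' : Type u} [NonUnitalRing A'] [StarRing A'] [Module ℂ A'] [IsScalarTower ℂ A' A']
  [SMulCommClass ℂ A' A'] [StarModule ℂ A']
variable {B : Type v} [NonUnitalRing B] [StarRing B] [Module ℂ B] [IsScalarTower ℂ B B]
  [SMulCommClass ℂ B B] [StarModule ℂ B]

/-- The *-homomorphism `φ ⊗ id` of algebraic tensor products. -/
def rTensorHom (B : Type v) [NonUnitalRing B] [StarRing B] [Module ℂ B] [IsScalarTower ℂ B B]
    [SMulCommClass ℂ B B] [StarModule ℂ B] (φ : A →⋆ₙₐ[ℂ] A') : A ⊗[ℂ] B →⋆ₙₐ[ℂ] A' ⊗[ℂ] B where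
  toFun := LinearMap.rTensor B ((φ : A →ₙₐ[ℂ] A') : A →ₗ[ℂ] A')
  map_smul' c x := map_smul _ c x
  map_zero' := map_zero _
  map_add' x y := map_add _ x y
  map_mul' x y := by
    induction x with
    | zero => simp
    | add x x' hx hx' => rw [add_mul, map_add, hx, hx', map_add, add_mul]
    | tmul a b =>
      induction y with
      | zero => simp
      | add y y' hy hy' => rw [mul_add, map_add, hy, hy', map_add, mul_add]
      | tmul a' b' => simp
  map_star' x := by
    induction x with
    | zero => simp
    | add x x' hx hx' => rw [star_add, map_add, hx, hx', map_add, star_add]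
    | tmul a b =>
      change φ (star a) ⊗ₜ[ℂ] star b = star (φ a ⊗ₜ[ℂ] b)
      rw [StarHomClass.map_star, TensorProduct.star_tmul]

@[simp] lemma rTensorHom_tmul (φ : A →⋆ₙₐ[ℂ] A') (a : A) (b : B) :
    rTensorHom B φ (a ⊗ₜ b) = φ a ⊗ₜ b := rfl

lemma minTensor_rTensorHom_le (p : CStarSeminorm A') (q : CStarSeminorm B) (φ : A →⋆ₙₐ[ℂ] A')
    (x : A ⊗[ℂ] B) :
    (minTensor p q).toSeminorm (rTensorHom B φ x) ≤ (minTensor (p.comap φ) q).toSeminorm x := by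
  rw [minTensor_apply, minTensor_apply]
  refine minNorm_le (minNorm_nonneg x) fun π ρ => ?_
  let π' : (p.comap φ).Rep := { H := π.H, π := π.π.comp φ, norm_le := fun a => π.norm_le _ }
  have h : tensorRep π' ρ x = tensorRep π ρ (rTensorHom B φ x) := by
    induction x with
    | zero => simp
    | add x y hx hy => rw [map_add, map_add, map_add, hx, hy]
    | tmul a b => rfl
  refine le_trans (le_of_eq ?_) (repNorm_le_minNorm π' ρ x)
  exact congrArg (fun T : π.H ⊗[ℂ] ρ.H →L[ℂ] π.H ⊗[ℂ] ρ.H => ‖T‖) h.symm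

end

end CStarSeminorm

/-! ### The compact operators -/

/-- The separable infinite dimensional Hilbert space `ℓ²(ℕ)`. -/
abbrev HilbertSeq : Type := lp (fun _ : ℕ => ℂ) 2

lemma isCompactOperator_adjoint {T : HilbertSeq →L[ℂ] HilbertSeq} (hT : IsCompactOperator T) :
    IsCompactOperator (⇑(star T)) := by
  set S : HilbertSeq →L[ℂ] HilbertSeq := star T with hS
  have hTT : IsCompactOperator (⇑(T ∘L S)) := hT.comp_clm S
  have htb : TotallyBounded (⇑(T ∘L S) '' Metric.ball 0 1) :=
    ((isCompactOperator_iff_isCompact_closure_image_ball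
      ((T ∘L S : HilbertSeq →L[ℂ] HilbertSeq) : HilbertSeq →ₗ[ℂ] HilbertSeq) one_pos).1
      hTT).totallyBounded.subset subset_closure
  refine (isCompactOperator_iff_isCompact_closure_image_ball
    (S : HilbertSeq →ₗ[ℂ] HilbertSeq) one_pos).2 ?_
  refine (TotallyBounded.closure ?_).isCompact_of_isClosed isClosed_closure
  change TotallyBounded (⇑S '' Metric.ball 0 1)
  have key : ∀ x : HilbertSeq, ‖S x‖ ^ 2 ≤ ‖T (S x)‖ * ‖x‖ := by
    intro x
    rw [← inner_self_eq_norm_sq (𝕜 := ℂ)]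
    have e : inner ℂ (S x) (S x) = inner ℂ (T (S x)) x := by
      nth_rewrite 2 [hS]
      rw [ContinuousLinearMap.star_eq_adjoint, ContinuousLinearMap.adjoint_inner_right]
    rw [e]
    exact re_inner_le_norm _ _
  rw [Metric.totallyBounded_iff]
  intro ε hε
  obtain ⟨t, ht, htf, hcov⟩ := Metric.finite_approx_of_totallyBounded htb (ε ^ 2 / 2) (by positivity)
  choose! g hg hgy using fun y (hy : y ∈ t) => ht hy
  refine ⟨(fun y => S (g y)) '' t, htf.image _, ?_⟩
  rintro _ ⟨x, hx, rfl⟩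
  obtain ⟨y, hy, hxy⟩ := Set.mem_iUnion₂.1 (hcov ⟨x, hx, rfl⟩)
  refine Set.mem_iUnion₂.2 ⟨S (g y), ⟨y, hy, rfl⟩, ?_⟩
  have hgb := hg y hy
  rw [mem_ball_zero_iff] at hx hgb
  rw [← hgy y hy, mem_ball_iff_norm] at hxy
  rw [mem_ball_iff_norm, ← map_sub]
  have h1 := key (x - g y)
  have h2 : ‖T (S (x - g y))‖ < ε ^ 2 / 2 := by
    rw [map_sub, map_sub]; exact hxy
  have h3 : ‖x - g y‖ ≤ 2 := (norm_sub_le _ _).trans (by linarith)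
  refine lt_of_pow_lt_pow_left₀ 2 hε.le ?_
  have h4 := norm_nonneg (T (S (x - g y)))
  nlinarith [norm_nonneg (x - g y)]

/-- The *-algebra of compact operators on `ℓ²(ℕ)`, as a subalgebra of all bounded operators. -/
def compactOps : NonUnitalStarSubalgebra ℂ (HilbertSeq →L[ℂ] HilbertSeq) where
  carrier := {T | IsCompactOperator T}
  add_mem' h h' := IsCompactOperator.add h h'
  zero_mem' := isCompactOperator_zero
  mul_mem' {_ b} h _ := IsCompactOperator.comp_clm h b
  smul_mem' c _ h := IsCompactOperator.smul h c
  star_mem' h := isCompactOperator_adjoint h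

/-- The C*-algebra `K` of compact operators on `ℓ²(ℕ)`, with the norm topology. -/
def KOp : Type := compactOps

instance : LMCStarAlgebra KOp :=
  letI : LMCStarAlgebra (HilbertSeq →L[ℂ] HilbertSeq) := LMCStarAlgebra.ofNormed _
  LMCStarAlgebra.ofSubalgebra compactOps

/-- The matrix coefficient `k ↦ ⟨e_i, k e_j⟩` of compact operators. -/
def KOp.coeff (i j : ℕ) : KOp →ₗ[ℂ] ℂ where
  toFun k := (k.1 (lp.single 2 j (1 : ℂ)) : ∀ _ : ℕ, ℂ) i
  map_add' _ _ := rfl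
  map_smul' _ _ := rfl

/-! ### Continuous *-homomorphisms -/

/-- The set `Hom(A, B)` of continuous *-homomorphisms. -/
def LHom (A : Type u) (B : Type v) [LMCStarAlgebra A] [LMCStarAlgebra B] : Type (max u v) :=
  {f : A →⋆ₙₐ[ℂ] B // Continuous f}

namespace LHom

variable {A : Type u} {B : Type v} {C : Type w} [LMCStarAlgebra A] [LMCStarAlgebra B]
  [LMCStarAlgebra C]

instance : CoeFun (LHom A B) (fun _ => A → B) := ⟨fun f => f.1⟩

@[ext] lemma ext {f g : LHom A B} (h : ∀ a, f a = g a) : f = g :=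
  Subtype.ext (NonUnitalStarAlgHom.ext h)

/-- The identity. -/
def id (A : Type u) [LMCStarAlgebra A] : LHom A A :=
  ⟨NonUnitalStarAlgHom.id ℂ A, continuous_id⟩

/-- Composition: first `f`, then `g`. -/
def comp (g : LHom B C) (f : LHom A B) : LHom A C := ⟨g.1.comp f.1, g.2.comp f.2⟩

/-- The compact-open topology on `Hom(A, B)`. -/
instance : TopologicalSpace (LHom A B) :=
  TopologicalSpace.induced (fun f => (⟨f, f.2⟩ : C(A, B))) inferInstance

/-- `f` and `g` are homotopic: there is a continuous *-homomorphism `H : A → C([0,1], B)` (for the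
compact-open topology and the pointwise operations on `C([0,1], B)`) with `H(a)(0) = f(a)` and
`H(a)(1) = g(a)`. That `H` is a *-homomorphism means that all `H(·)(t)` are. -/
def Homotopic (f g : LHom A B) : Prop :=
  ∃ H : A → C(unitInterval, B), Continuous H ∧ (∀ t, ∃ h : LHom A B, ∀ a, H a t = h a) ∧
    (∀ a, H a 0 = f a) ∧ ∀ a, H a 1 = g a

end LHom

/-- The set `[A, B]` of homotopy classes of continuous *-homomorphisms. -/
def HomotopyClasses (A : Type u) (B : Type v) [LMCStarAlgebra A] [LMCStarAlgebra B] :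
    Type (max u v) :=
  Quot (LHom.Homotopic (A := A) (B := B))

/-! ### The tensor product -/

/-- The set of C*-seminorms `pq` for continuous C*-seminorms `p` on `A` and `q` on `B`. -/
def tensorSeminorms (A : Type u) (B : Type v) [LMCStarAlgebra A] [LMCStarAlgebra B] :
    Set (CStarSeminorm (A ⊗[ℂ] B)) :=
  {r | ∃ p ∈ contSeminorms A, ∃ q ∈ contSeminorms B, r = CStarSeminorm.minTensor p q}

/-- The tensor product `A ⊗ B`: the Hausdorff `ν`-completion of the algebraic tensor product with
respect to the C*-seminorms `pq`. -/
abbrev NuTensor (ν : Ordinal.{w}) (A : Type u) (B : Type v) [LMCStarAlgebra A]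
    [LMCStarAlgebra B] : Type (max u v) :=
  NuCompletion ν (tensorSeminorms A B)

namespace NuTensor

variable (ν : Ordinal.{w})

lemma dominated {A A' : Type u} [LMCStarAlgebra A] [LMCStarAlgebra A']
    (B : Type v) [LMCStarAlgebra B] (φ : LHom A A') :
    ∀ r' ∈ tensorSeminorms A' B, ∃ r ∈ tensorSeminorms A B,
      ∀ x, r'.toSeminorm (CStarSeminorm.rTensorHom B φ.1 x) ≤ r.toSeminorm x := by
  rintro _ ⟨p, hp, q, hq, rfl⟩
  exact ⟨_, ⟨p.comap φ.1, hp.comp φ.2, q, hq, rfl⟩,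
    CStarSeminorm.minTensor_rTensorHom_le p q φ.1⟩

/-- The map `φ ⊗ id : A ⊗ B → A' ⊗ B`. -/
def map {A A' : Type u} [LMCStarAlgebra A] [LMCStarAlgebra A'] (B : Type v) [LMCStarAlgebra B]
    (φ : LHom A A') : LHom (NuTensor ν A B) (NuTensor ν A' B) :=
  ⟨NuCompletion.map (CStarSeminorm.rTensorHom B φ.1) (dominated B φ),
    NuCompletion.continuous_map _ _⟩

lemma map_id (A : Type u) [LMCStarAlgebra A] (B : Type v) [LMCStarAlgebra B] :
    map ν B (LHom.id A) = LHom.id _ := by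
  refine Subtype.ext (NuCompletion.hom_ext (map ν B (LHom.id A)).2 continuous_id fun x => ?_)
  refine (NuCompletion.map_of _ _ x).trans (congrArg _ ?_)
  induction x with
  | zero => exact map_zero _
  | add x y hx hy => rw [_root_.map_add, hx, hy]
  | tmul a b => rfl

lemma map_comp {A A' A'' : Type u} [LMCStarAlgebra A] [LMCStarAlgebra A'] [LMCStarAlgebra A'']
    (B : Type v) [LMCStarAlgebra B] (ψ : LHom A' A'') (φ : LHom A A') :
    map ν B (ψ.comp φ) = (map ν B ψ).comp (map ν B φ) := by
  refine Subtype.ext (NuCompletion.hom_ext (map ν B (ψ.comp φ)).2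
    ((map ν B ψ).comp (map ν B φ)).2 fun x => ?_)
  refine (NuCompletion.map_of _ _ x).trans ?_
  refine Eq.trans ?_ (congrArg (map ν B ψ).1 (NuCompletion.map_of _ (dominated B φ) x)).symm
  refine Eq.trans (congrArg _ ?_) (NuCompletion.map_of _ (dominated B ψ) _).symm
  induction x with
  | zero => simp
  | add x y hx hy => rw [_root_.map_add, hx, hy, _root_.map_add, _root_.map_add]
  | tmul a b => rfl

end NuTensor

/-! ### The category of `ν`-complete l.m.c.-C*-algebras -/

open CategoryTheory

/-- The category `𝔸_ν` of `ν`-complete l.m.c.-C*-algebras and continuous *-homomorphisms. -/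
structure NuAlg (ν : Ordinal.{w}) : Type (max (u + 1) w) where
  carrier : Type u
  [alg : LMCStarAlgebra carrier]
  complete : IsNuComplete ν carrier

attribute [instance] NuAlg.alg

instance (ν : Ordinal.{w}) : Category.{u} (NuAlg.{u, w} ν) where
  Hom A B := LHom A.carrier B.carrier
  id A := LHom.id A.carrier
  comp f g := LHom.comp g f

instance (ν : Ordinal.{w}) (A B : NuAlg.{u, w} ν) : TopologicalSpace (A ⟶ B) :=
  inferInstanceAs (TopologicalSpace (LHom A.carrier B.carrier))

/-- The functor `– ⊗ K` on `𝔸_ν`. -/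
def tensorK (ν : Ordinal.{w}) : NuAlg.{u, w} ν ⥤ NuAlg.{u, w} ν where
  obj A := ⟨NuTensor ν A.carrier KOp, NuCompletion.isNuComplete ν _⟩
  map φ := NuTensor.map ν KOp φ
  map_id A := NuTensor.map_id ν A.carrier KOp
  map_comp φ ψ := NuTensor.map_comp ν KOp ψ φ

/-! ### The algebra `A ⊗̂ K` -/

section Adjoint

variable (ν : Ordinal.{w})

/-- The slice map `id ⊗ x_ij` on the algebraic tensor product. -/
def sliceK (Z : Type u) [LMCStarAlgebra Z] (i j : ℕ) : Z ⊗[ℂ] KOp →ₗ[ℂ] Z :=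
  TensorProduct.lift (LinearMap.mk₂ ℂ (fun z k => KOp.coeff i j k • z)
    (fun z z' k => smul_add _ _ _)
    (fun c z k => smul_comm _ _ _)
    (fun z k k' => by rw [map_add, add_smul])
    (fun c z k => by rw [map_smul, smul_assoc]))

/-- `z` is the matrix coefficient `w_ij` of `w ∈ Z ⊗ K`. The coefficient is the value at `w` of the
continuous extension of the slice map `id ⊗ x_ij`, so the pair `(w, z)` has to belong to the closure
of the graph of the slice map. (If `Z` is not complete, then `w` may have a coefficient outside
of `Z`.) -/
def IsCoeff {Z : Type u} [LMCStarAlgebra Z] (w : NuTensor ν Z KOp) (i j : ℕ) (z : Z) : Prop :=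
  (w, z) ∈ closure (Set.range fun x : Z ⊗[ℂ] KOp => (NuCompletion.of ν _ x, sliceK Z i j x))

/-- `Z = Z_f`: the matrix coefficients `f(a)_ij` belong to `Z` and generate it as a *-algebra. -/
def IsGeneratedBy {A : Type v} {Z : Type u} [LMCStarAlgebra A] [LMCStarAlgebra Z]
    (f : LHom A (NuTensor ν Z KOp)) : Prop :=
  (∀ i j a, ∃ z, IsCoeff ν (f a) i j z) ∧
    NonUnitalStarAlgebra.adjoin ℂ {z : Z | ∃ i j a, IsCoeff ν (f a) i j z} = ⊤

/-- A set without any structure which is as large as any *-algebra generated by `ℕ × ℕ × A`. -/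
structure Label (A : Type u) : Type u where
  fst : A
  snd : ℂ

/-- The index set `D`: pairs `(Z, f)` of an l.m.c.-C*-algebra `Z` and a continuous *-homomorphism
`f : A → Z ⊗ K` with `Z = Z_f`. To get a set, the underlying set of `Z` is taken among the subsets
of `Label A`: every pair is isomorphic to one of this kind, since `Z` is generated by
`ℕ × ℕ × A`. -/
structure GenPair (A : Type u) [LMCStarAlgebra A] : Type u where
  Z : Set (Label A)
  [alg : LMCStarAlgebra Z]
  f : LHom A (NuTensor ν Z KOp)
  generated : IsGeneratedBy ν f

attribute [instance] GenPair.alg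

/-- A morphism showing `d ≥ e` in `D`: a continuous *-homomorphism `φ : Z_d → Z_e` with
`f_e = (φ ⊗ id) ∘ f_d`. -/
def GenPair.IsTransition {A : Type u} [LMCStarAlgebra A] {ν : Ordinal.{w}} (d e : GenPair ν A)
    (φ : LHom d.Z e.Z) : Prop :=
  e.f = (NuTensor.map ν KOp φ).comp d.f

/-- The inverse limit of the algebras `Z_d`: the compatible families in the product. -/
def limitZ (A : Type u) [LMCStarAlgebra A] :
    NonUnitalStarSubalgebra ℂ (∀ d : GenPair ν A, d.Z) where
  carrier := {z | ∀ (d e : GenPair ν A) (φ : LHom d.Z e.Z), d.IsTransition e φ → φ (z d) = z e}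
  add_mem' {x y} hx hy d e φ h := by
    rw [Pi.add_apply, Pi.add_apply, ← hx d e φ h, ← hy d e φ h]; exact map_add φ.1 _ _
  zero_mem' d e φ _ := map_zero φ.1
  mul_mem' {x y} hx hy d e φ h := by
    rw [Pi.mul_apply, Pi.mul_apply, ← hx d e φ h, ← hy d e φ h]; exact map_mul φ.1 _ _
  smul_mem' c x hx d e φ h := by
    rw [Pi.smul_apply, Pi.smul_apply, ← hx d e φ h]; exact map_smul φ.1 _ _
  star_mem' {x} hx d e φ h := by
    rw [Pi.star_apply, Pi.star_apply, ← hx d e φ h]; exact map_star φ.1 _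

/-- The algebra `A ⊗̂ K`: the `ν`-completion of the inverse limit of the algebras `Z_d`, `d ∈ D`. -/
def hatK (A : NuAlg.{u, w} ν) : NuAlg.{u, w} ν :=
  ⟨NuCompletion ν (contSeminorms (limitZ ν A.carrier)), NuCompletion.isNuComplete ν _⟩

end Adjoint

end

open CategoryTheory

noncomputable section

/-! ### C*-seminorms -/

/-! Let `B` be `ν`-complete and `f : A → B ⊗ K`. All coefficients of `f` lie in `B`, and the
*-algebra they generate is small enough to have a copy in `D`; so `f = (g ⊗ id) ∘ f_d` for some `d`
and some `g : Z_d → B` (`exists_genPair`). The `f_d` have compatible coefficients and combine to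
`limitHom : A → lim Z_d ⊗ K`. Applied to `limitHom` itself, the same argument yields an index `d`
that maps to the limit and lies above every `e`. Hence the limit is already generated by the
coefficients of `limitHom` (`adjoin_limitHom`). Consequently `φ ↦ (φ ⊗ id) ∘ hatUnit` is injective,
since `φ` is determined on coefficients, and surjective, since `f` factors through a projection of
the limit.

Lifting homomorphisms to `Z ⊗ K` along maps `φ_j : Z → Y_j` (`exists_lift_of_isSupOn`) rests on a
norm estimate, `tensorK_le_of_forall`: if `p` is a supremum of pulled back seminorms, so is its
extension to `Z ⊗ K`. On an `n × n` corner the norm is at most the sum of the norms of the `n²`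
coefficients, and the C*-identity, iterated along the powers `2^k`, removes the constant. Countable
cofinality makes `ν`-complete algebras sequentially complete, so that an element can be built as the
limit of its corners.

The delicate point is that `φ ↦ φ ⊗ id` is continuous for the compact-open topologies
(`NuTensor.continuous_map`): smallness on a compact subset of `Z ⊗ K` has to be forced by finitely
many conditions on compact subsets of `Z`. Finite corners cause no trouble. For the columns of index
at least `n`, the diagonal entries of high powers of `(1 - pₙ) w* w (1 - pₙ)` are used. After
rescaling they still tend to zero, so together with `0` they form a compact subset of `Z`; and if a
homomorphism is bounded by `1` on it, all tails are small (`seminorm_tail_le_of_diagPow_le`).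

For homotopies, `C([0,1], B)` is again a `ν`-complete l.m.c.-C*-algebra. Homomorphisms to `C([0,1],
B) ⊗ K` correspond to homomorphisms to `C([0,1], B ⊗ K)`: one direction uses the continuity just
described, the other the lifting principle with evaluations as `φ_j`. The bijection for `C([0,1],
B)` therefore matches homotopies on both sides. -/

lemma Real.le_of_pow_two_pow_le_mul {a b C : ℝ} (hb : 0 ≤ b)
    (h : ∀ k : ℕ, a ^ 2 ^ k ≤ C * b ^ 2 ^ k) : a ≤ b := by
  by_contra! hab
  have ha' : 0 < a := hb.trans_lt hab
  have hr : Filter.Tendsto (fun k : ℕ => C * (b / a) ^ 2 ^ k) Filter.atTop (𝓝 (C * 0)) :=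
    ((tendsto_pow_atTop_nhds_zero_of_lt_one (by positivity) ((div_lt_one ha').2 hab)).comp
      (tendsto_pow_atTop_atTop_of_one_lt one_lt_two)).const_mul C
  rw [mul_zero] at hr
  obtain ⟨k, hk⟩ := (hr.eventually (gt_mem_nhds one_pos)).exists
  have := h k
  rw [div_pow, ← mul_div_assoc, div_lt_one (by positivity)] at hk
  linarith

namespace CStarSeminorm

section
variable {E : Type u} [NonUnitalRing E] [StarRing E] [Module ℂ E]

/-- The iterated squares `x, x* x, (x* x)* (x* x), …`. -/
def starSq (x : E) : ℕ → E
  | 0 => x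
  | k + 1 => star (starSq x k) * starSq x k

lemma starSq_apply (p : CStarSeminorm E) (x : E) (k : ℕ) :
    p.toSeminorm (starSq x k) = p.toSeminorm x ^ 2 ^ k := by
  induction k with
  | zero => simp [starSq]
  | succ k ih => rw [starSq, p.map_star_mul_self, ih, pow_succ, pow_mul, sq]

/-- The C*-identity makes constants disappear: apply the bound to the iterated squares of `x`, where
both seminorms are raised exactly to the power `2^k`, and let `k` grow. -/
lemma le_of_le_mul {p q : CStarSeminorm E} {C : ℝ}
    (h : ∀ x, p.toSeminorm x ≤ C * q.toSeminorm x) (x : E) : p.toSeminorm x ≤ q.toSeminorm x :=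
  Real.le_of_pow_two_pow_le_mul (apply_nonneg _ _) fun k => by
    rw [← starSq_apply, ← starSq_apply]; exact h _

/-- By homogeneity the implication is a bound with constant `ε⁻¹`, which the previous lemma removes.
Continuity estimates thus become plain inequalities between C*-seminorms. -/
lemma le_of_lt_imp_lt {p q : CStarSeminorm E} {ε : ℝ} (hε : 0 < ε)
    (h : ∀ x, q.toSeminorm x < ε → p.toSeminorm x < 1) (x : E) :
    p.toSeminorm x ≤ q.toSeminorm x := by
  refine le_of_le_mul (C := ε⁻¹) (fun x => ?_) x
  -- Rescaling uses an arbitrary `s > ε⁻¹ q(x)`, because `q(x)` itself may vanish.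
  refine le_of_forall_gt_imp_ge_of_dense fun s hs => ?_
  have hs0 : 0 < s := lt_of_le_of_lt (by positivity) hs
  have h1 := h ((s⁻¹ : ℂ) • x) (by
    rw [map_smul_eq_mul, norm_inv, Complex.norm_real, Real.norm_of_nonneg hs0.le,
      inv_mul_lt_iff₀ hs0]
    rwa [inv_mul_lt_iff₀ hε, mul_comm] at hs)
  rw [map_smul_eq_mul, norm_inv, Complex.norm_real, Real.norm_of_nonneg hs0.le,
    inv_mul_lt_iff₀ hs0, mul_one] at h1
  exact h1.le

/-- The supremum of a pointwise bounded family of C*-seminorms. -/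
def iSup {κ : Type*} (p : κ → CStarSeminorm E)
    (hb : ∀ x, BddAbove (Set.range fun k => (p k).toSeminorm x)) : CStarSeminorm E :=
  have h0 : ∀ x, 0 ≤ ⨆ k, (p k).toSeminorm x := fun x => Real.iSup_nonneg fun k => apply_nonneg _ _
  have hle : ∀ x k, (p k).toSeminorm x ≤ ⨆ k, (p k).toSeminorm x := fun x k => le_ciSup (hb x) k
  { toSeminorm := Seminorm.ofSMulLE (fun x => ⨆ k, (p k).toSeminorm x)
      (by simp)
      (fun x y => Real.iSup_le (fun k => (map_add_le_add _ _ _).trans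
        (add_le_add (hle x k) (hle y k))) (add_nonneg (h0 x) (h0 y)))
      (fun c x => Real.iSup_le (fun k => by
        rw [map_smul_eq_mul]
        exact mul_le_mul_of_nonneg_left (hle x k) (norm_nonneg c))
        (mul_nonneg (norm_nonneg c) (h0 x)))
    mul_le' := fun x y => Real.iSup_le (fun k => ((p k).map_mul_le x y).trans
        (mul_le_mul (hle x k) (hle y k) (apply_nonneg _ _) (h0 x))) (mul_nonneg (h0 x) (h0 y))
    star_mul_self' := fun x => by
      refine le_antisymm (Real.iSup_le (fun k => ?_) (mul_nonneg (h0 x) (h0 x))) ?_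
      · rw [map_star_mul_self]
        exact mul_le_mul (hle x k) (hle x k) (apply_nonneg _ _) (h0 x)
      · have h : ⨆ k, (p k).toSeminorm x ≤ √ (⨆ k, (p k).toSeminorm (star x * x)) :=
          Real.iSup_le (fun k => Real.le_sqrt_of_sq_le (by
            rw [sq, ← map_star_mul_self]; exact hle _ k)) (Real.sqrt_nonneg _)
        calc _ ≤ √ (⨆ k, (p k).toSeminorm (star x * x)) * √ (⨆ k, (p k).toSeminorm (star x * x)) :=
              mul_le_mul h h (h0 x) (Real.sqrt_nonneg _)
          _ = _ := Real.mul_self_sqrt (h0 _) }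

lemma le_iSup {κ : Type*} (p : κ → CStarSeminorm E)
    (hb : ∀ x, BddAbove (Set.range fun k => (p k).toSeminorm x)) (k : κ) (x : E) :
    (p k).toSeminorm x ≤ (iSup p hb).toSeminorm x :=
  le_ciSup (hb x) k

lemma iSup_le {κ : Type*} {p : κ → CStarSeminorm E}
    {hb : ∀ x, BddAbove (Set.range fun k => (p k).toSeminorm x)} {x : E} {C : ℝ} (hC : 0 ≤ C)
    (h : ∀ k, (p k).toSeminorm x ≤ C) : (iSup p hb).toSeminorm x ≤ C :=
  Real.iSup_le h hC

/-- The maximum of a finite family of C*-seminorms. -/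
def finsetSup {κ : Type*} (s : Finset κ) (p : κ → CStarSeminorm E) :
    CStarSeminorm E :=
  iSup (fun k : s => p k) fun _ => (Set.finite_range _).bddAbove

lemma le_finsetSup {κ : Type*} {s : Finset κ} (p : κ → CStarSeminorm E) {k : κ} (hk : k ∈ s)
    (x : E) : (p k).toSeminorm x ≤ (finsetSup s p).toSeminorm x :=
  le_iSup (fun k : s => p k) (fun _ => (Set.finite_range _).bddAbove) ⟨k, hk⟩ x

lemma finsetSup_le {κ : Type*} {s : Finset κ} {p : κ → CStarSeminorm E} {x : E} {C : ℝ}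
    (hC : 0 ≤ C) (h : ∀ k ∈ s, (p k).toSeminorm x ≤ C) : (finsetSup s p).toSeminorm x ≤ C :=
  iSup_le hC fun k => h k k.2

end

end CStarSeminorm

/-! ### The topology of an l.m.c.-C*-algebra -/

namespace LMCStarAlgebra

section
variable {Z : Type u} [LMCStarAlgebra Z]

instance : IsTopologicalAddGroup Z := by
  obtain ⟨ι, p, hp⟩ := exists_seminorms (A := Z)
  exact hp.topologicalAddGroup

instance : ContinuousSMul ℂ Z := by
  obtain ⟨ι, p, hp⟩ := exists_seminorms (A := Z)
  exact hp.continuousSMul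

end

lemma continuous_of_le {Z : Type u} [LMCStarAlgebra Z] {p : CStarSeminorm Z} {q : Z → ℝ}
    (hq : Continuous q) (hq0 : q 0 = 0) (h : ∀ z, p.toSeminorm z ≤ q z) :
    Continuous p.toSeminorm := by
  refine Seminorm.continuous_of_continuousAt_zero ?_
  rw [ContinuousAt, map_zero]
  exact squeeze_zero (fun z => apply_nonneg _ _) h (by simpa [hq0] using hq.tendsto 0)

lemma finsetSup_mem {Z : Type u} [LMCStarAlgebra Z] {κ : Type*} (s : Finset κ)
    {p : κ → CStarSeminorm Z} (h : ∀ k ∈ s, p k ∈ contSeminorms Z) :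
    CStarSeminorm.finsetSup s p ∈ contSeminorms Z := by
  refine continuous_of_le (q := fun z => ∑ k ∈ s, (p k).toSeminorm z)
    (continuous_finsetSum _ h) (by simp) fun z => ?_
  exact CStarSeminorm.finsetSup_le (Finset.sum_nonneg fun k _ => apply_nonneg _ _) fun k hk =>
    Finset.single_le_sum (f := fun k => (p k).toSeminorm z) (fun k _ => apply_nonneg _ _) hk

/-- One seminorm suffices because finite maxima of continuous C*-seminorms are again continuous
C*-seminorms. -/
lemma mem_nhds_zero_iff {Z : Type u} [LMCStarAlgebra Z] {U : Set Z} :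
    U ∈ 𝓝 (0 : Z) ↔ ∃ p ∈ contSeminorms Z, ∃ ε > 0, ∀ z, p.toSeminorm z < ε → z ∈ U := by
  constructor
  · intro hU
    obtain ⟨ι, p, hp⟩ := exists_seminorms (A := Z)
    obtain ⟨s, r, hr, hs⟩ := (hp.mem_nhds_iff 0 U).1 hU
    refine ⟨_, finsetSup_mem s (p := p) fun k _ => hp.continuous_seminorm k, r, hr, fun z hz => ?_⟩
    refine hs ?_
    rw [Seminorm.mem_ball_zero]
    exact (Seminorm.finset_sup_apply_le (apply_nonneg _ _) fun k hk =>
      CStarSeminorm.le_finsetSup p hk z).trans_lt hz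
  · rintro ⟨p, hp, ε, hε, h⟩
    exact Filter.mem_of_superset
      ((isOpen_lt (hp : Continuous p.toSeminorm) continuous_const).mem_nhds
        (by simpa using hε)) h

lemma eq_zero_of_forall {Z : Type u} [LMCStarAlgebra Z] {z : Z}
    (h : ∀ p ∈ contSeminorms Z, p.toSeminorm z = 0) : z = 0 := by
  by_contra hz
  obtain ⟨p, hp, ε, hε, hU⟩ := mem_nhds_zero_iff.1 (isOpen_compl_singleton.mem_nhds (Ne.symm hz))
  exact hU z (by rw [h p hp]; exact hε) rfl

lemma tendsto_nhds_iff {Z : Type u} [LMCStarAlgebra Z] {X : Type*} {l : Filter X} {f : X → Z}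
    {z : Z} : Filter.Tendsto f l (𝓝 z) ↔ ∀ p ∈ contSeminorms Z,
      Filter.Tendsto (fun x => p.toSeminorm (f x - z)) l (𝓝 0) := by
  rw [← tendsto_sub_nhds_zero_iff]
  constructor
  · intro h p hp
    have := ((hp : Continuous p.toSeminorm).tendsto 0).comp h
    rwa [map_zero] at this
  · intro h U hU
    obtain ⟨p, hp, ε, hε, hU⟩ := mem_nhds_zero_iff.1 hU
    exact Filter.mem_of_superset ((h p hp).eventually (gt_mem_nhds hε)) fun x hx => hU _ hx

instance {Z : Type u} [LMCStarAlgebra Z] : ContinuousStar Z where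
  continuous_star := continuous_iff_continuousAt.2 fun z => tendsto_nhds_iff.2 fun p hp => by
    refine (tendsto_nhds_iff.1 (Filter.tendsto_id (x := 𝓝 z)) p hp).congr fun x => ?_
    rw [← star_sub, p.map_star]; rfl

instance {Z : Type u} [LMCStarAlgebra Z] : IsTopologicalRing Z where
  continuous_mul := continuous_iff_continuousAt.2 fun ⟨a, b⟩ => tendsto_nhds_iff.2 fun p hp => by
    have hp' : Continuous p.toSeminorm := hp
    have hlim : Filter.Tendsto (fun x : Z × Z => p.toSeminorm (x.1 - a) * p.toSeminorm x.2 +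
        p.toSeminorm a * p.toSeminorm (x.2 - b)) (𝓝 (a, b)) (𝓝 0) := by
      have : Continuous (fun x : Z × Z => p.toSeminorm (x.1 - a) * p.toSeminorm x.2 +
        p.toSeminorm a * p.toSeminorm (x.2 - b)) := by fun_prop
      simpa using this.tendsto (a, b)
    refine squeeze_zero (fun _ => apply_nonneg _ _) (fun x => ?_) hlim
    have e : x.1 * x.2 - a * b = (x.1 - a) * x.2 + a * (x.2 - b) := by
      rw [sub_mul, mul_sub]; abel
    change p.toSeminorm (x.1 * x.2 - a * b) ≤ _
    rw [e]
    exact (map_add_le_add _ _ _).trans (add_le_add (p.map_mul_le _ _) (p.map_mul_le _ _))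

/-- A neighbourhood of zero in an initial topology involves finitely many of the maps. A common
radius for these gives an inclusion of balls, and `le_of_lt_imp_lt` turns it into a domination
without constant. -/
lemma exists_le_finsetSup_of_inducing {Z : Type u} [LMCStarAlgebra Z] {J : Type v} {Y : J → Type w}
    [∀ j, LMCStarAlgebra (Y j)] {φ : ∀ j, LHom Z (Y j)}
    (hφ : 𝓝 (0 : Z) = ⨅ j, Filter.comap (φ j) (𝓝 0)) {p : CStarSeminorm Z}
    (hp : p ∈ contSeminorms Z) : ∃ (s : Finset J) (q : ∀ j, CStarSeminorm (Y j)),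
      (∀ j, q j ∈ contSeminorms (Y j)) ∧
      ∀ z, p.toSeminorm z ≤ (CStarSeminorm.finsetSup s fun j => (q j).comap (φ j).1).toSeminorm z := by
  have hU : {z | p.toSeminorm z < 1} ∈ 𝓝 (0 : Z) :=
    (isOpen_lt (hp : Continuous p.toSeminorm) continuous_const).mem_nhds (by simp)
  rw [hφ, Filter.mem_iInf'] at hU
  obtain ⟨I, hI, V, hV, -, hUV, -⟩ := hU
  have hV' : ∀ j, ∃ q ∈ contSeminorms (Y j), ∃ ε > 0,
      ∀ z, q.toSeminorm (φ j z) < ε → z ∈ V j := fun j => by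
    obtain ⟨W, hW, hWV⟩ := Filter.mem_comap.1 (hV j)
    obtain ⟨q, hq, ε, hε, h⟩ := mem_nhds_zero_iff.1 hW
    exact ⟨q, hq, ε, hε, fun z hz => hWV (h _ hz)⟩
  choose q hq ε hε h using hV'
  obtain ⟨δ, hδ, hδε⟩ : ∃ δ > 0, ∀ j ∈ hI.toFinset, δ ≤ ε j := by
    rcases hI.toFinset.eq_empty_or_nonempty with h0 | h0
    · exact ⟨1, one_pos, by simp [h0]⟩
    · exact ⟨hI.toFinset.inf' h0 ε, (Finset.lt_inf'_iff _).2 fun j _ => hε j,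
        fun j hj => Finset.inf'_le _ hj⟩
  refine ⟨hI.toFinset, q, hq, CStarSeminorm.le_of_lt_imp_lt hδ fun z hz => ?_⟩
  have : z ∈ ⋂ i ∈ I, V i := Set.mem_iInter₂.2 fun j hj => h j z <| by
    have hj' := hI.mem_toFinset.2 hj
    exact (CStarSeminorm.le_finsetSup (fun j => (q j).comap (φ j).1) hj' z).trans_lt
      (hz.trans_le (hδε j hj'))
  rwa [← hUV] at this

end LMCStarAlgebra

/-! ### Representations separate points -/

open ComplexOrder in
/-- Positive functionals separate the points of a C*-algebra. -/
lemma PositiveLinearMap.exists_apply_star_mul_self_ne_zero {A : Type u} [NonUnitalCStarAlgebra A]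
    [PartialOrder A] [StarOrderedRing A] {a : A} (ha : a ≠ 0) :
    ∃ f : A →ₚ[ℂ] ℂ, f (star a * a) ≠ 0 := by
  have hpos : (0 : A) ≤ star a * a := star_mul_self_nonneg a
  have hne : star a * a ≠ 0 := (CStarRing.star_mul_self_ne_zero_iff a).2 ha
  -- A nonzero `-(a* a)` lies outside the closed cone of positive elements, so a functional that is
  -- nonnegative on the cone is negative there.
  obtain ⟨g, hg, hga⟩ := ProperCone.hyperplane_separation_point (ProperCone.positive ℝ A)
    (x₀ := -(star a * a)) (fun h => hne (le_antisymm (neg_nonneg.1 (by simpa using h)) hpos))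
  -- Composing with the real part kills `i` times the self-adjoint elements, so the complex-linear
  -- extension still agrees with `g` on self-adjoint elements.
  let f₀ : A →ₗ[ℝ] ℝ := (g : A →ₗ[ℝ] ℝ) ∘ₗ (selfAdjoint.submodule ℝ A).subtype ∘ₗ realPart
  have hf₀ : ∀ x : A, IsSelfAdjoint x → f₀ x = g x := fun x hx => by
    change g (realPart x : A) = g x
    rw [hx.coe_realPart]
  have hf₁ : ∀ x : A, IsSelfAdjoint x → f₀ (Complex.I • x) = 0 := fun x hx => by
    change g (realPart (Complex.I • x) : A) = 0
    rw [realPart_I_smul, hx.imaginaryPart]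
    simp
  have hF : ∀ x : A, IsSelfAdjoint x →
      (Module.Dual.extendRCLikeₗ (𝕜 := ℂ) f₀) x = (g x : ℂ) := fun x hx => by
    change (Module.Dual.extendRCLike (𝕜 := ℂ) f₀) x = (g x : ℂ)
    rw [Module.Dual.extendRCLike_apply]
    simp [hf₀ x hx, hf₁ x hx]
  refine ⟨PositiveLinearMap.mk₀ (Module.Dual.extendRCLikeₗ (𝕜 := ℂ) f₀) fun x hx => ?_, ?_⟩
  · rw [hF x (IsSelfAdjoint.of_nonneg hx)]
    exact Complex.zero_le_real.2 (hg x (by simpa using hx))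
  · change (Module.Dual.extendRCLikeₗ (𝕜 := ℂ) f₀) (star a * a) ≠ 0
    rw [hF _ (IsSelfAdjoint.star_mul_self a)]
    rw [map_neg] at hga
    exact_mod_cast (by linarith : g (star a * a) ≠ 0)

open ComplexOrder in
/-- The GNS representations separate the points of a C*-algebra. -/
lemma PositiveLinearMap.exists_gns_apply_ne_zero {A : Type u} [NonUnitalCStarAlgebra A]
    [PartialOrder A] [StarOrderedRing A] {a : A} (ha : a ≠ 0) :
    ∃ f : A →ₚ[ℂ] ℂ, f.gnsNonUnitalStarAlgHom a ≠ 0 := by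
  -- Without a unit there is no cyclic vector at hand. The test vector is the class of `a*`, which
  -- is sent to the class of `a a*`; so the functional is chosen for `a a*`.
  have hb : a * star a ≠ 0 := (CStarRing.mul_star_self_ne_zero_iff a).2 ha
  obtain ⟨f, hf⟩ := exists_apply_star_mul_self_ne_zero hb
  refine ⟨f, fun h => hf ?_⟩
  have h1 : f.gnsNonUnitalStarAlgHom a (f.toPreGNS (star a) : f.PreGNS) = 0 := by rw [h]; rfl
  rw [gnsNonUnitalStarAlgHom_apply_coe, leftMulMapPreGNS_apply] at h1
  have h2 : ‖f.toPreGNS (a * star a)‖ = 0 := by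
    rw [← UniformSpace.Completion.norm_coe]; exact (congrArg norm h1).trans norm_zero
  have h3 := f.preGNS_norm_sq (f.toPreGNS (a * star a))
  rw [h2] at h3
  simpa using h3.symm

namespace CStarSeminorm

section
variable {E : Type u} [NonUnitalRing E] [StarRing E] [Module ℂ E] [IsScalarTower ℂ E E]
  [SMulCommClass ℂ E E] [StarModule ℂ E] (p : CStarSeminorm E)

instance : NonUnitalCStarAlgebra p.Compl where

/-- A *-representation of the completion, as a representation bounded by `p`. -/
def Rep.ofCompl {H : Type u} [NormedAddCommGroup H] [InnerProductSpace ℂ H] [CompleteSpace H]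
    (π : p.Compl →⋆ₙₐ[ℂ] (H →L[ℂ] H)) : p.Rep where
  H := H
  π := π.comp (Compl.of p)
  norm_le a := (NonUnitalStarAlgHom.norm_apply_le π _).trans (Compl.norm_of p a).le

/-- The C*-seminorm of a *-representation. -/
def ofRep {A : Type u} [NonUnitalRing A] [StarRing A] [Module ℂ A] {H : Type v}
    [NormedAddCommGroup H] [InnerProductSpace ℂ H] [CompleteSpace H]
    (π : A →⋆ₙₐ[ℂ] (H →L[ℂ] H)) : CStarSeminorm A :=
  (ofNorm (H →L[ℂ] H)).comap π

/-- The supremum `r` of the seminorms of all representations is a norm on the completion, since GNS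
representations separate points. The map to the completion for `r` is then an injective
*-homomorphism of C*-algebras, hence isometric. This is the source of all lower bounds for minimal
tensor norms. -/
lemma le_of_forall_rep {z : E} {C : ℝ} (hC : 0 ≤ C) (h : ∀ π : p.Rep, ‖π.π z‖ ≤ C) :
    p.toSeminorm z ≤ C := by
  let : PartialOrder p.Compl := CStarAlgebra.spectralOrder _
  have : StarOrderedRing p.Compl := CStarAlgebra.spectralOrderedRing _
  let s : (Σ' (H : Type u) (_ : NormedAddCommGroup H) (_ : InnerProductSpace ℂ H)
      (_ : CompleteSpace H), p.Compl →⋆ₙₐ[ℂ] (H →L[ℂ] H)) → CStarSeminorm p.Compl :=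
    fun ⟨_, _, _, _, π⟩ => ofRep π
  have hs : ∀ i x, (s i).toSeminorm x ≤ ‖x‖ := fun ⟨_, _, _, _, π⟩ x =>
    NonUnitalStarAlgHom.norm_apply_le π x
  let r : CStarSeminorm p.Compl := iSup s fun x => ⟨‖x‖, by rintro _ ⟨i, rfl⟩; exact hs i x⟩
  have hr : Function.Injective (Compl.of r) := by
    rw [injective_iff_map_eq_zero]
    intro a ha
    by_contra hne
    obtain ⟨f, hf⟩ := PositiveLinearMap.exists_gns_apply_ne_zero hne
    have h1 : r.toSeminorm a = 0 := by rw [← Compl.norm_of, ha, norm_zero]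
    have h2 := le_iSup s (fun x => ⟨‖x‖, by rintro _ ⟨i, rfl⟩; exact hs i x⟩)
      ⟨f.GNS, inferInstance, inferInstance, inferInstance, f.gnsNonUnitalStarAlgHom⟩ a
    exact hf (norm_le_zero_iff.1 (h2.trans h1.le))
  calc p.toSeminorm z = ‖Compl.of p z‖ := (Compl.norm_of p z).symm
    _ = ‖Compl.of r (Compl.of p z)‖ := (NonUnitalStarAlgHom.norm_map _ hr _).symm
    _ = r.toSeminorm (Compl.of p z) := Compl.norm_of r _
    _ ≤ C := iSup_le hC fun ⟨H, _, _, _, π⟩ => h (Rep.ofCompl p π)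

end

end CStarSeminorm

/-! ### Matrix units in the compact operators -/

namespace KOp

/-- The inclusion of the compact operators in the bounded operators. -/
def toOp : KOp →⋆ₙₐ[ℂ] (HilbertSeq →L[ℂ] HilbertSeq) :=
  NonUnitalStarSubalgebraClass.subtype compactOps

lemma toOp_injective : Function.Injective toOp := Subtype.val_injective

lemma isCompactOperator_toOp (k : KOp) : IsCompactOperator (toOp k) := k.2

/-- The operator norm, as a C*-seminorm on the compact operators. -/
def normK : CStarSeminorm KOp := CStarSeminorm.ofRep toOp

lemma normK_apply (k : KOp) : normK.toSeminorm k = ‖toOp k‖ := rfl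

lemma continuous_toOp : Continuous toOp := continuous_subtype_val

lemma normK_mem : normK ∈ contSeminorms KOp := continuous_norm.comp continuous_toOp

/-- The norm dominates every continuous C*-seminorm of `K`, so on `Z ⊗ K` only the seminorm on the
first factor has to vary. -/
lemma le_normK {q : CStarSeminorm KOp} (hq : q ∈ contSeminorms KOp) (k : KOp) :
    q.toSeminorm k ≤ normK.toSeminorm k := by
  have hU : {k | q.toSeminorm k < 1} ∈ 𝓝 (0 : KOp) :=
    (isOpen_lt (hq : Continuous q.toSeminorm) continuous_const).mem_nhds (by simp)
  have h1 : 𝓝 (0 : KOp) = Filter.comap toOp (𝓝 0) := by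
    have h : Topology.IsInducing toOp := Topology.IsInducing.subtypeVal
    rw [h.nhds_eq_comap, map_zero]
  rw [h1] at hU
  obtain ⟨ε, hε, h⟩ := (Metric.nhds_basis_ball.comap toOp).mem_iff.1 hU
  refine CStarSeminorm.le_of_lt_imp_lt hε (fun k hk => h ?_) k
  rwa [Set.mem_preimage, mem_ball_zero_iff]

/-- The standard basis of `ℓ²(ℕ)`. -/
def basisVec (i : ℕ) : HilbertSeq := lp.single 2 i (1 : ℂ)

lemma inner_basisVec (i : ℕ) (x : HilbertSeq) : inner ℂ (basisVec i) x = x i := by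
  rw [basisVec, lp.inner_single_left]; simp

lemma norm_basisVec (i : ℕ) : ‖basisVec i‖ = 1 := by
  rw [basisVec, lp.norm_single (by norm_num)]; simp

lemma inner_basisVec_basisVec (i j : ℕ) :
    inner ℂ (basisVec i) (basisVec j) = if i = j then (1 : ℂ) else 0 := by
  rw [inner_basisVec, basisVec, lp.single_apply]
  by_cases h : i = j
  · subst h; simp
  · simp [h]

lemma coeff_eq (i j : ℕ) (k : KOp) : coeff i j k = inner ℂ (basisVec i) (toOp k (basisVec j)) := by
  rw [inner_basisVec]; rfl

/-- The matrix units. -/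
def unit (i j : ℕ) : KOp :=
  ⟨InnerProductSpace.rankOne ℂ (basisVec i) (basisVec j), by
    have h : IsCompactOperator (innerSL ℂ (basisVec j)) :=
      isCompactOperator_of_locallyCompactSpace_dom (innerSL ℂ (basisVec j))
    exact h.clm_comp (ContinuousLinearMap.toSpanSingleton ℂ (basisVec i))⟩

lemma toOp_unit (i j : ℕ) :
    toOp (unit i j) = InnerProductSpace.rankOne ℂ (basisVec i) (basisVec j) := rfl

lemma toOp_unit_apply (i j : ℕ) (x : HilbertSeq) : toOp (unit i j) x = inner ℂ (basisVec j) x • basisVec i := by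
  rw [toOp_unit, InnerProductSpace.rankOne_apply]

lemma normK_unit (i j : ℕ) : normK.toSeminorm (unit i j) = 1 := by
  rw [normK_apply, toOp_unit, InnerProductSpace.norm_rankOne, norm_basisVec, norm_basisVec, one_mul]

lemma star_unit (i j : ℕ) : star (unit i j) = unit j i := by
  apply toOp_injective
  rw [StarHomClass.map_star, toOp_unit, toOp_unit, ContinuousLinearMap.star_eq_adjoint,
    InnerProductSpace.adjoint_rankOne]

lemma unit_mul_mul_unit (i i' j' j : ℕ) (k : KOp) :
    unit i i' * k * unit j' j = coeff i' j' k • unit i j := by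
  apply toOp_injective
  rw [map_mul, map_mul, map_smul]
  ext1 x
  change toOp (unit i i') (toOp k (toOp (unit j' j) x)) = coeff i' j' k • toOp (unit i j) x
  rw [toOp_unit_apply, toOp_unit_apply, toOp_unit_apply, map_smul,
    inner_smul_right, ← coeff_eq, smul_smul, mul_comm]

lemma unit_mul_unit (i j l : ℕ) : unit i j * unit j l = unit i l := by
  apply toOp_injective
  rw [map_mul]
  ext1 x
  change toOp (unit i j) (toOp (unit j l) x) = toOp (unit i l) x
  rw [toOp_unit_apply j, toOp_unit_apply, toOp_unit_apply, inner_smul_right,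
    inner_basisVec_basisVec]
  simp

lemma unit_mul_unit_of_ne {i j j' l : ℕ} (h : j ≠ j') : unit i j * unit j' l = 0 := by
  apply toOp_injective
  rw [map_mul, map_zero]
  ext1 x
  change toOp (unit i j) (toOp (unit j' l) x) = 0
  rw [toOp_unit_apply j', toOp_unit_apply, inner_smul_right, inner_basisVec_basisVec]
  simp [h]

/-- The projection to the first `n` basis vectors. -/
def projN (n : ℕ) : KOp := ∑ i ∈ Finset.range n, unit i i

lemma star_projN (n : ℕ) : star (projN n) = projN n := by
  simp [projN, star_unit]

lemma projN_succ (n : ℕ) : projN (n + 1) = projN n + unit n n := Finset.sum_range_succ _ _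

lemma projN_mul_unit {n i j : ℕ} (h : i < n) : projN n * unit i j = unit i j := by
  rw [projN, Finset.sum_mul, Finset.sum_eq_single i, unit_mul_unit]
  · exact fun b _ hb => unit_mul_unit_of_ne hb
  · exact fun hi => absurd (Finset.mem_range.2 h) hi

lemma projN_mul_unit_of_le {n i j : ℕ} (h : n ≤ i) : projN n * unit i j = 0 := by
  rw [projN, Finset.sum_mul]
  refine Finset.sum_eq_zero fun b hb => unit_mul_unit_of_ne ?_
  have := Finset.mem_range.1 hb
  omega

lemma projN_mul_projN_of_le {m n : ℕ} (h : n ≤ m) : projN m * projN n = projN n := by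
  conv_lhs => rw [projN.eq_1 n, Finset.mul_sum]
  exact Finset.sum_congr rfl fun i hi => projN_mul_unit ((Finset.mem_range.1 hi).trans_le h)

lemma projN_mul_self (n : ℕ) : projN n * projN n = projN n := projN_mul_projN_of_le le_rfl

lemma normK_projN_le (n : ℕ) : normK.toSeminorm (projN n) ≤ 1 := by
  have h := normK.map_star_mul_self (projN n)
  rw [star_projN, projN_mul_self] at h
  have h0 : 0 ≤ normK.toSeminorm (projN n) := apply_nonneg _ _
  by_contra! h1
  nlinarith

lemma projN_mul_mul_projN (n : ℕ) (k : KOp) : projN n * k * projN n =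
    ∑ i ∈ Finset.range n, ∑ j ∈ Finset.range n, coeff i j k • unit i j := by
  simp_rw [← unit_mul_mul_unit, projN, Finset.sum_mul, Finset.mul_sum]

lemma tendsto_toOp_projN (x : HilbertSeq) :
    Filter.Tendsto (fun n => toOp (projN n) x) Filter.atTop (𝓝 x) := by
  have h := (lp.hasSum_single (by norm_num) x).tendsto_sum_nat
  refine h.congr fun n => ?_
  rw [projN, map_sum, sum_apply]
  refine Finset.sum_congr rfl fun i _ => ?_
  rw [toOp_unit_apply, inner_basisVec, basisVec, ← lp.single_smul, smul_eq_mul, mul_one]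

/-- The projections are contractive and converge strongly to the identity, hence uniformly on the
totally bounded image of the unit ball under `k`. -/
lemma tendsto_projN_mul (k : KOp) :
    Filter.Tendsto (fun n => normK.toSeminorm (projN n * k - k)) Filter.atTop (𝓝 0) := by
  rw [Metric.tendsto_atTop]
  intro ε hε
  obtain ⟨t, ht, htk⟩ := Metric.totallyBounded_iff.1
    ((isCompactOperator_toOp k).isCompact_closure_image_closedBall
      (f := (toOp k : HilbertSeq →ₗ[ℂ] HilbertSeq)) 1).totallyBounded (ε / 4) (by positivity)
  have h1 : ∀ᶠ n in Filter.atTop, ∀ y ∈ t, ‖toOp (projN n) y - y‖ < ε / 4 :=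
    (Filter.eventually_all_finite ht).2 fun y _ => by
      have := (tendsto_toOp_projN y).sub_const y
      rw [sub_self] at this
      exact this.norm.eventually (gt_mem_nhds (by rw [norm_zero]; positivity))
  obtain ⟨N, hN⟩ := Filter.eventually_atTop.1 h1
  refine ⟨N, fun n hn => ?_⟩
  rw [Real.dist_0_eq_abs, abs_of_nonneg (apply_nonneg _ _), normK_apply]
  -- Three errors below `ε / 4` occur; bounding the operator norm loses strictness, which the
  -- remaining quarter restores.
  refine lt_of_le_of_lt (b := 3 / 4 * ε) ?_ (by linarith)
  refine ContinuousLinearMap.opNorm_le_of_unit_norm (by positivity) fun x hx => ?_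
  have hx' : toOp k x ∈ closure ((toOp k : HilbertSeq →ₗ[ℂ] HilbertSeq) ''
      Metric.closedBall 0 1) := subset_closure ⟨x, by simp [hx], rfl⟩
  obtain ⟨y, hy, hxy⟩ := Set.mem_iUnion₂.1 (htk hx')
  rw [mem_ball_iff_norm] at hxy
  rw [map_sub, map_mul]
  change ‖toOp (projN n) (toOp k x) - toOp k x‖ ≤ _
  have e : toOp (projN n) (toOp k x) - toOp k x = toOp (projN n) (toOp k x - y) +
      (toOp (projN n) y - y) - (toOp k x - y) := by rw [map_sub]; abel
  have h2 : ‖toOp (projN n) (toOp k x - y)‖ ≤ 1 * ‖toOp k x - y‖ :=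
    (toOp (projN n)).le_of_opNorm_le (normK_projN_le n) _
  rw [e]
  have h3 := hN n hn y hy
  calc _ ≤ ‖toOp (projN n) (toOp k x - y)‖ + ‖toOp (projN n) y - y‖ + ‖toOp k x - y‖ :=
        (norm_sub_le _ _).trans (add_le_add_left (norm_add_le _ _) _)
    _ ≤ _ := by linarith

lemma tendsto_projN_mul_mul_projN (k : KOp) :
    Filter.Tendsto (fun n => normK.toSeminorm (projN n * k * projN n - k))
      Filter.atTop (𝓝 0) := by
  refine squeeze_zero (fun n => apply_nonneg _ _) (fun n => ?_)
    (by simpa using (tendsto_projN_mul (star k)).add (tendsto_projN_mul k))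
  have e : projN n * k * projN n - k =
      projN n * star (projN n * star k - star k) + (projN n * k - k) := by
    rw [star_sub, star_mul, star_star, star_projN, mul_sub, mul_assoc]; abel
  rw [e]
  refine (map_add_le_add _ _ _).trans (add_le_add_left ?_ _)
  refine (normK.map_mul_le _ _).trans ?_
  rw [normK.map_star]
  exact mul_le_of_le_one_left (apply_nonneg _ _) (normK_projN_le n)

end KOp

/-! ### The algebraic tensor product with the compact operators -/

section TensorK

variable (Z : Type u) [LMCStarAlgebra Z]

/-- Right multiplication by `1 ⊗ k` on `Z ⊗ K`. -/
def rightMulK (k : KOp) : Z ⊗[ℂ] KOp →ₗ[ℂ] Z ⊗[ℂ] KOp := (LinearMap.mulRight ℂ k).lTensor Z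

/-- Left multiplication by `1 ⊗ k` on `Z ⊗ K`. -/
def leftMulK (k : KOp) : Z ⊗[ℂ] KOp →ₗ[ℂ] Z ⊗[ℂ] KOp := (LinearMap.mulLeft ℂ k).lTensor Z

variable {Z}

@[simp] lemma rightMulK_tmul (k l : KOp) (z : Z) : rightMulK Z k (z ⊗ₜ l) = z ⊗ₜ (l * k) := rfl

@[simp] lemma leftMulK_tmul (k l : KOp) (z : Z) : leftMulK Z k (z ⊗ₜ l) = z ⊗ₜ (k * l) := rfl

@[simp] lemma sliceK_tmul (i j : ℕ) (z : Z) (k : KOp) :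
    sliceK Z i j (z ⊗ₜ k) = KOp.coeff i j k • z := by simp [sliceK]

lemma star_rightMulK (k : KOp) (x : Z ⊗[ℂ] KOp) :
    star (rightMulK Z k x) = leftMulK Z (star k) (star x) := by
  induction x with
  | zero => simp
  | add x y hx hy => rw [map_add, star_add, hx, hy, star_add, map_add]
  | tmul z l => simp [TensorProduct.star_tmul]

lemma star_leftMulK (k : KOp) (x : Z ⊗[ℂ] KOp) :
    star (leftMulK Z k x) = rightMulK Z (star k) (star x) := by
  rw [← star_star (rightMulK Z (star k) (star x)), star_rightMulK, star_star, star_star]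

lemma rightMulK_mul (k : KOp) (x y : Z ⊗[ℂ] KOp) :
    rightMulK Z k (x * y) = x * rightMulK Z k y := by
  induction x with
  | zero => simp
  | add x x' hx hx' => rw [add_mul, map_add, hx, hx', add_mul]
  | tmul z l =>
    induction y with
    | zero => simp
    | add y y' hy hy' => rw [mul_add, map_add, hy, hy', map_add, mul_add]
    | tmul z' l' => simp [mul_assoc]

lemma leftMulK_mul (k : KOp) (x y : Z ⊗[ℂ] KOp) :
    leftMulK Z k (x * y) = leftMulK Z k x * y := by
  rw [← star_star (leftMulK Z k (x * y)), star_leftMulK, star_mul, rightMulK_mul, star_mul,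
    ← star_leftMulK, star_star, star_star]

lemma rightMulK_mul_eq (k : KOp) (x y : Z ⊗[ℂ] KOp) :
    rightMulK Z k x * y = x * leftMulK Z k y := by
  induction x with
  | zero => simp
  | add x x' hx hx' => rw [map_add, add_mul, hx, hx', add_mul]
  | tmul z l =>
    induction y with
    | zero => simp
    | add y y' hy hy' => rw [mul_add, hy, hy', map_add, mul_add]
    | tmul z' l' => simp [mul_assoc]

lemma rightMulK_rightMulK (k l : KOp) (x : Z ⊗[ℂ] KOp) :
    rightMulK Z k (rightMulK Z l x) = rightMulK Z (l * k) x := by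
  induction x with
  | zero => simp
  | add x y hx hy => simp only [map_add, hx, hy]
  | tmul z m => simp [mul_assoc]

lemma leftMulK_leftMulK (k l : KOp) (x : Z ⊗[ℂ] KOp) :
    leftMulK Z k (leftMulK Z l x) = leftMulK Z (k * l) x := by
  induction x with
  | zero => simp
  | add x y hx hy => simp only [map_add, hx, hy]
  | tmul z m => simp [mul_assoc]

lemma leftMulK_rightMulK (k l : KOp) (x : Z ⊗[ℂ] KOp) :
    leftMulK Z k (rightMulK Z l x) = rightMulK Z l (leftMulK Z k x) := by
  induction x with
  | zero => simp
  | add x y hx hy => simp only [map_add, hx, hy]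
  | tmul z m => simp [mul_assoc]

lemma rightMulK_add (k l : KOp) (x : Z ⊗[ℂ] KOp) :
    rightMulK Z (k + l) x = rightMulK Z k x + rightMulK Z l x := by
  induction x with
  | zero => simp
  | add x y hx hy => simp only [map_add, hx, hy]; abel
  | tmul z m => simp [mul_add, TensorProduct.tmul_add]

/-- Coefficients are thereby compressions by matrix units, which have norm one; this yields the
estimates for slices and passes to completions. -/
lemma leftMulK_unit_rightMulK_unit (i i' j' j : ℕ) (x : Z ⊗[ℂ] KOp) :
    leftMulK Z (KOp.unit i i') (rightMulK Z (KOp.unit j' j) x) =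
      sliceK Z i' j' x ⊗ₜ KOp.unit i j := by
  induction x with
  | zero => simp
  | add x y hx hy => simp only [map_add, hx, hy, TensorProduct.add_tmul]
  | tmul z m =>
    rw [rightMulK_tmul, leftMulK_tmul, ← mul_assoc, KOp.unit_mul_mul_unit, sliceK_tmul,
      TensorProduct.smul_tmul]

/-- Truncation to the upper left corner of size `n`. -/
def truncK (n : ℕ) (x : Z ⊗[ℂ] KOp) : Z ⊗[ℂ] KOp :=
  leftMulK Z (KOp.projN n) (rightMulK Z (KOp.projN n) x)

lemma truncK_eq_sum (n : ℕ) (x : Z ⊗[ℂ] KOp) : truncK n x =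
    ∑ i ∈ Finset.range n, ∑ j ∈ Finset.range n, sliceK Z i j x ⊗ₜ KOp.unit i j := by
  induction x with
  | zero => simp [truncK]
  | add x y hx hy =>
    simp only [truncK, map_add, TensorProduct.add_tmul, Finset.sum_add_distrib] at hx hy ⊢
    rw [hx, hy]
  | tmul z m =>
    rw [truncK, rightMulK_tmul, leftMulK_tmul, ← mul_assoc, KOp.projN_mul_mul_projN]
    simp only [TensorProduct.tmul_sum, sliceK_tmul, TensorProduct.smul_tmul]

lemma truncK_truncK (n : ℕ) (x : Z ⊗[ℂ] KOp) : truncK n (truncK n x) = truncK n x := by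
  rw [truncK, truncK, ← leftMulK_rightMulK, leftMulK_leftMulK, rightMulK_rightMulK,
    KOp.projN_mul_self]

/-- The corner is a *-subalgebra, so iterated squares of its elements stay in it. -/
lemma truncK_star_mul_self {n : ℕ} {x : Z ⊗[ℂ] KOp} (hx : truncK n x = x) :
    truncK n (star x * x) = star x * x := by
  have h1 : rightMulK Z (KOp.projN n) x = x := by
    conv_lhs => rw [← hx, truncK, ← leftMulK_rightMulK, rightMulK_rightMulK, KOp.projN_mul_self]
    exact hx
  have h2 : leftMulK Z (KOp.projN n) (star x) = star x := by
    rw [← KOp.star_projN, ← star_rightMulK, h1]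
  rw [truncK, rightMulK_mul, h1, leftMulK_mul, h2]

lemma sliceK_rTensorHom {Y : Type u} [LMCStarAlgebra Y] (φ : Z →⋆ₙₐ[ℂ] Y) (i j : ℕ)
    (x : Z ⊗[ℂ] KOp) :
    sliceK Y i j (CStarSeminorm.rTensorHom KOp φ x) = φ (sliceK Z i j x) := by
  induction x with
  | zero => simp
  | add x y hx hy => simp only [map_add, hx, hy]
  | tmul z m => simp

lemma rightMulK_rTensorHom {Y : Type u} [LMCStarAlgebra Y] (φ : Z →⋆ₙₐ[ℂ] Y) (k : KOp)
    (x : Z ⊗[ℂ] KOp) : rightMulK Y k (CStarSeminorm.rTensorHom KOp φ x) =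
      CStarSeminorm.rTensorHom KOp φ (rightMulK Z k x) := by
  induction x with
  | zero => simp
  | add x y hx hy => simp only [map_add, hx, hy]
  | tmul z m => simp

lemma leftMulK_rTensorHom {Y : Type u} [LMCStarAlgebra Y] (φ : Z →⋆ₙₐ[ℂ] Y) (k : KOp)
    (x : Z ⊗[ℂ] KOp) : leftMulK Y k (CStarSeminorm.rTensorHom KOp φ x) =
      CStarSeminorm.rTensorHom KOp φ (leftMulK Z k x) := by
  induction x with
  | zero => simp
  | add x y hx hy => simp only [map_add, hx, hy]
  | tmul z m => simp

lemma truncK_rTensorHom {Y : Type u} [LMCStarAlgebra Y] (φ : Z →⋆ₙₐ[ℂ] Y) (n : ℕ)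
    (x : Z ⊗[ℂ] KOp) : truncK n (CStarSeminorm.rTensorHom KOp φ x) =
      CStarSeminorm.rTensorHom KOp φ (truncK n x) := by
  rw [truncK, rightMulK_rTensorHom, leftMulK_rTensorHom, truncK]

end TensorK

/-! ### The minimal tensor seminorms on `Z ⊗ K` -/

namespace CStarSeminorm

open KOp

section
variable {Z : Type u} [LMCStarAlgebra Z]

lemma minTensor_tmul_le (p : CStarSeminorm Z) (q : CStarSeminorm KOp) (z : Z) (k : KOp) :
    (minTensor p q).toSeminorm (z ⊗ₜ k) ≤ p.toSeminorm z * q.toSeminorm k := by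
  refine minNorm_le (mul_nonneg (apply_nonneg _ _) (apply_nonneg _ _)) fun π ρ => ?_
  rw [repNorm, tensorRep_tmul]
  exact (TensorProduct.norm_mapL_le _ _).trans
    (mul_le_mul (π.norm_le z) (ρ.norm_le k) (norm_nonneg _) (apply_nonneg _ _))

lemma minTensor_mono {p p' : CStarSeminorm Z} {q q' : CStarSeminorm KOp}
    (hp : ∀ z, p.toSeminorm z ≤ p'.toSeminorm z) (hq : ∀ k, q.toSeminorm k ≤ q'.toSeminorm k)
    (x : Z ⊗[ℂ] KOp) : (minTensor p q).toSeminorm x ≤ (minTensor p' q').toSeminorm x :=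
  minNorm_le (minNorm_nonneg x) fun π ρ =>
    repNorm_le_minNorm (p := p') (q := q')
      { H := π.H, π := π.π, norm_le := fun z => (π.norm_le z).trans (hp z) }
      { H := ρ.H, π := ρ.π, norm_le := fun k => (ρ.norm_le k).trans (hq k) } x

lemma minTensor_rightMulK_le (p : CStarSeminorm Z) (q : CStarSeminorm KOp) (k : KOp)
    (x : Z ⊗[ℂ] KOp) : (minTensor p q).toSeminorm (rightMulK Z k x) ≤
      q.toSeminorm k * (minTensor p q).toSeminorm x := by
  refine minNorm_le (mul_nonneg (apply_nonneg _ _) (minNorm_nonneg x)) fun π ρ => ?_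
  have e : tensorRep π ρ (rightMulK Z k x) =
      (tensorRep π ρ x).comp (TensorProduct.mapL (ContinuousLinearMap.id ℂ π.H) (ρ.π k)) := by
    induction x with
    | zero => simp
    | add x y hx hy => rw [map_add, map_add, map_add, hx, hy, ContinuousLinearMap.add_comp]
    | tmul z l =>
      rw [rightMulK_tmul, tensorRep_tmul, tensorRep_tmul, map_mul, ← TensorProduct.mapL_comp]
      rfl
  rw [repNorm, e, mul_comm]
  refine (ContinuousLinearMap.opNorm_comp_le _ _).trans ?_
  refine mul_le_mul (repNorm_le_minNorm π ρ x) ?_ (norm_nonneg _) (minNorm_nonneg x)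
  refine (TensorProduct.norm_mapL_le _ _).trans ?_
  exact (mul_le_of_le_one_left (norm_nonneg _) ContinuousLinearMap.norm_id_le).trans (ρ.norm_le k)

lemma minTensor_leftMulK_le (p : CStarSeminorm Z) (q : CStarSeminorm KOp) (k : KOp)
    (x : Z ⊗[ℂ] KOp) : (minTensor p q).toSeminorm (leftMulK Z k x) ≤
      q.toSeminorm k * (minTensor p q).toSeminorm x := by
  rw [← map_star, star_leftMulK, ← q.map_star, ← (minTensor p q).map_star x]
  exact minTensor_rightMulK_le p q _ _

/-- The seminorm on `Z ⊗ K` defined by a C*-seminorm on `Z` and the norm of `K`. -/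
abbrev tensorK (p : CStarSeminorm Z) : CStarSeminorm (Z ⊗[ℂ] KOp) := minTensor p normK

/-- In `π ⊗ ρ`, with `ρ` the defining representation of `K`, the vector `ξ ⊗ e_j` goes to `π(z) ξ ⊗
e_i`. So the tensor norm dominates `‖π(z)‖` for all `π`, and these norms recover `p`. -/
lemma le_tensorK_tmul_unit (p : CStarSeminorm Z) (z : Z) (i j : ℕ) :
    p.toSeminorm z ≤ p.tensorK.toSeminorm (z ⊗ₜ unit i j) := by
  refine le_of_forall_rep p (apply_nonneg _ _) fun π => ?_
  let ρ : normK.Rep := { H := HilbertSeq, π := toOp, norm_le := fun k => le_rfl }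
  refine le_trans ?_ (repNorm_le_minNorm π ρ _)
  refine ContinuousLinearMap.opNorm_le_bound _ (repNorm_nonneg _ _ _) fun ξ => ?_
  have h := (tensorRep π ρ (z ⊗ₜ unit i j)).le_opNorm (ξ ⊗ₜ[ℂ] basisVec j)
  have e : tensorRep π ρ (z ⊗ₜ unit i j) (ξ ⊗ₜ[ℂ] basisVec j) = π.π z ξ ⊗ₜ[ℂ] basisVec i := by
    rw [tensorRep_tmul]
    change π.π z ξ ⊗ₜ[ℂ] (toOp (unit i j) (basisVec j)) = _
    rw [toOp_unit_apply, inner_basisVec_basisVec, if_pos rfl, one_smul]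
  have n1 : ‖π.π z ξ ⊗ₜ[ℂ] basisVec i‖ = ‖π.π z ξ‖ := by
    rw [TensorProduct.norm_tmul, norm_basisVec, mul_one]
  have n2 : ‖ξ ⊗ₜ[ℂ] basisVec j‖ = ‖ξ‖ := by
    rw [TensorProduct.norm_tmul, norm_basisVec, mul_one]
  rw [e, n1, n2] at h
  exact h

/-- Moving the coefficient to position `(0, 0)` only multiplies by the matrix units `e_{0i}` and
`e_{j0}` of norm one. -/
lemma sliceK_le (p : CStarSeminorm Z) (i j : ℕ) (x : Z ⊗[ℂ] KOp) :
    p.toSeminorm (sliceK Z i j x) ≤ p.tensorK.toSeminorm x := by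
  refine (le_tensorK_tmul_unit p _ 0 0).trans ?_
  rw [← leftMulK_unit_rightMulK_unit]
  refine (minTensor_leftMulK_le _ _ _ _).trans ?_
  rw [normK_unit, one_mul]
  refine (minTensor_rightMulK_le _ _ _ _).trans ?_
  rw [normK_unit, one_mul]

lemma tensorK_truncK_le (p : CStarSeminorm Z) (n : ℕ) (x : Z ⊗[ℂ] KOp) :
    p.tensorK.toSeminorm (truncK n x) ≤ p.tensorK.toSeminorm x :=
  (minTensor_leftMulK_le _ _ _ _).trans <|
    (mul_le_of_le_one_left (apply_nonneg _ _) (normK_projN_le n)).trans <|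
    (minTensor_rightMulK_le _ _ _ _).trans <|
    mul_le_of_le_one_left (apply_nonneg _ _) (normK_projN_le n)

lemma tensorK_sum_le (p : CStarSeminorm Z) (n : ℕ) (z : ℕ → ℕ → Z) :
    p.tensorK.toSeminorm
      (∑ i ∈ Finset.range n, ∑ j ∈ Finset.range n, z i j ⊗ₜ[ℂ] unit i j) ≤
      ∑ i ∈ Finset.range n, ∑ j ∈ Finset.range n, p.toSeminorm (z i j) := by
  have hs := fun (f : ℕ → Z ⊗[ℂ] KOp) => Finset.le_sum_of_subadditive p.tensorK.toSeminorm
    (map_zero _).le (map_add_le_add _) (Finset.range n) f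
  refine (hs _).trans (Finset.sum_le_sum fun i _ => (hs _).trans (Finset.sum_le_sum fun j _ => ?_))
  refine (minTensor_tmul_le _ _ _ _).trans ?_
  rw [normK_unit, mul_one]

lemma tendsto_truncK (p : CStarSeminorm Z) (x : Z ⊗[ℂ] KOp) :
    Filter.Tendsto (fun n => p.tensorK.toSeminorm (truncK n x - x)) Filter.atTop (𝓝 0) := by
  induction x with
  | zero => simp [truncK]
  | add x y hx hy =>
    refine squeeze_zero (fun _ => apply_nonneg _ _) (fun n => ?_) (by simpa using hx.add hy)
    have e : truncK n (x + y) - (x + y) = (truncK n x - x) + (truncK n y - y) := by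
      simp only [truncK, map_add]; abel
    rw [e]
    exact map_add_le_add _ _ _
  | tmul z k =>
    have h := (tendsto_projN_mul_mul_projN k).const_mul (p.toSeminorm z)
    rw [mul_zero] at h
    refine squeeze_zero (fun _ => apply_nonneg _ _) (fun n => ?_) h
    rw [truncK, rightMulK_tmul, leftMulK_tmul, ← mul_assoc, ← TensorProduct.tmul_sub]
    exact minTensor_tmul_le _ _ _ _

lemma map_starSq {A : Type u} {B : Type v} [NonUnitalRing A] [StarRing A] [Module ℂ A]
    [NonUnitalRing B] [StarRing B] [Module ℂ B] (f : A →⋆ₙₐ[ℂ] B) (x : A) (k : ℕ) :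
    f (starSq x k) = starSq (f x) k := by
  induction k with
  | zero => rfl
  | succ k ih => rw [starSq, map_mul, StarHomClass.map_star, ih, starSq]

/-- If a C*-seminorm on `Z` is bounded by the supremum of the pull backs of C*-seminorms along
*-homomorphisms, then the same holds for the seminorms on the tensor products with `K`. -/
lemma tensorK_le_of_forall {J : Type*} {Y : J → Type u} [∀ j, LMCStarAlgebra (Y j)]
    (φ : ∀ j, Z →⋆ₙₐ[ℂ] Y j) (q : ∀ j, CStarSeminorm (Y j)) (p : CStarSeminorm Z)
    (h : ∀ z C, 0 ≤ C → (∀ j, (q j).toSeminorm (φ j z) ≤ C) → p.toSeminorm z ≤ C)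
    {x : Z ⊗[ℂ] KOp} {C : ℝ} (hC : 0 ≤ C)
    (hx : ∀ j, (q j).tensorK.toSeminorm (rTensorHom KOp (φ j) x) ≤ C) :
    p.tensorK.toSeminorm x ≤ C := by
  -- On the `n × n` corner, the norm is at most the sum of the norms of `n²` coefficients, each of
  -- which is controlled by hypothesis. Applied to the iterated squares, this gives the bound up to
  -- a factor `n²` independent of `k`, which then drops out.
  have key : ∀ (n : ℕ) (y : Z ⊗[ℂ] KOp), truncK n y = y →
      (∀ j, (q j).tensorK.toSeminorm (rTensorHom KOp (φ j) y) ≤ C) →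
      p.tensorK.toSeminorm y ≤ C := by
    intro n y hy hyC
    have hk : ∀ k, truncK n (starSq y k) = starSq y k := fun k => by
      induction k with
      | zero => exact hy
      | succ k ih => exact truncK_star_mul_self ih
    refine Real.le_of_pow_two_pow_le_mul (C := n * n) hC fun k => ?_
    have hs : ∀ i j, p.toSeminorm (sliceK Z i j (starSq y k)) ≤ C ^ 2 ^ k := fun i j =>
      h _ _ (by positivity) fun m => by
        rw [← sliceK_rTensorHom]
        refine (sliceK_le _ _ _ _).trans ?_
        rw [map_starSq, starSq_apply]
        exact pow_le_pow_left₀ (apply_nonneg _ _) (hyC m) _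
    rw [← starSq_apply, ← hk k, truncK_eq_sum]
    refine (tensorK_sum_le _ _ _).trans ?_
    refine (Finset.sum_le_sum fun i _ => Finset.sum_le_sum fun j _ => hs i j).trans ?_
    simp [mul_assoc]
  have hlim := tendsto_truncK p x
  -- A general element is approximated by its corners, for which the hypothesis persists because
  -- truncation is contractive and natural.
  refine ge_of_tendsto' (f := fun n => C + p.tensorK.toSeminorm (truncK n x - x))
    (x := Filter.atTop) (by simpa using hlim.const_add C) fun n => ?_
  have e : x = truncK n x - (truncK n x - x) := by abel
  conv_lhs => rw [e]
  refine (map_sub_le_add _ _ _).trans (add_le_add_left ?_ _)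
  refine key n _ (truncK_truncK n x) fun j => ?_
  rw [← truncK_rTensorHom]
  exact (tensorK_truncK_le _ _ _).trans (hx j)

end

end CStarSeminorm

/-! ### Ordinals of countable cofinality -/

/-- For a countable cofinal family `c`, send `α` to the least `n` with `α ≤ c n`. Beyond `c 0, …, c
(N - 1)` this index is at least `N`. Such a map turns ordinary sequences into `ν`-sequences. -/
lemma Ordinal.exists_tendsto_nat_of_cof_eq_aleph0 {ν : Ordinal.{w}} (hν : ν.cof = Cardinal.aleph0) :
    Nonempty (Set.Iio ν) ∧
      ∃ k : Set.Iio ν → ℕ, Filter.Tendsto k Filter.atTop Filter.atTop := by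
  have hlim : Order.IsSuccLimit ν := Ordinal.one_lt_cof_iff.1 (hν ▸ Cardinal.one_lt_aleph0)
  have hne : Nonempty (Set.Iio ν) := ⟨⟨0, hlim.bot_lt⟩⟩
  have hmax : NoMaxOrder (Set.Iio ν) :=
    ⟨fun a => ⟨⟨Order.succ a.1, hlim.succ_lt a.2⟩, Order.lt_succ a.1⟩⟩
  refine ⟨hne, ?_⟩
  obtain ⟨s, hs, hsc⟩ := Order.exists_cof_eq (Set.Iio ν)
  rw [Ordinal.cof_Iio, ← Ordinal.lift_cof, hν, Cardinal.lift_aleph0] at hsc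
  have hcount : s.Countable := Cardinal.le_aleph0_iff_set_countable.1 hsc.le
  have hsne : s.Nonempty := by
    obtain ⟨b, hb, -⟩ := hs hne.some
    exact ⟨b, hb⟩
  obtain ⟨c, rfl⟩ := hcount.exists_eq_range hsne
  have hc : ∀ α, ∃ n, α ≤ c n := fun α => by
    obtain ⟨_, ⟨n, rfl⟩, h⟩ := hs α
    exact ⟨n, h⟩
  classical
  refine ⟨fun α => Nat.find (hc α), Filter.tendsto_atTop.2 fun N => ?_⟩
  have : ∀ᶠ α in Filter.atTop, ∀ n ∈ Finset.range N, c n < α :=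
    (Filter.eventually_all_finset _).2 fun n _ => Filter.eventually_gt_atTop (c n)
  refine this.mono fun α hα => ?_
  by_contra! h
  exact (hα _ (Finset.mem_range.2 h)).not_ge (Nat.find_spec (hc α))

lemma isNuCauchy_iff {ν : Ordinal.{w}} {A : Type u} [LMCStarAlgebra A] {x : Set.Iio ν → A} :
    IsNuCauchy ν x ↔ ∀ p ∈ contSeminorms A, ∀ ε > 0, ∃ γ : Set.Iio ν, ∀ α β : Set.Iio ν,
      γ ≤ α → γ ≤ β → p.toSeminorm (x α - x β) < ε := by
  constructor
  · intro h p hp ε hε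
    exact h {z | p.toSeminorm z < ε} (LMCStarAlgebra.mem_nhds_zero_iff.2
      ⟨p, hp, ε, hε, fun _ h => h⟩)
  · intro h U hU
    obtain ⟨p, hp, ε, hε, hU⟩ := LMCStarAlgebra.mem_nhds_zero_iff.1 hU
    obtain ⟨γ, hγ⟩ := h p hp ε hε
    exact ⟨γ, fun α β h1 h2 => hU _ (hγ α β h1 h2)⟩

/-- Cauchy sequences converge in `ν`-complete algebras if `ν` has countable cofinality. -/
lemma IsNuComplete.exists_tendsto {ν : Ordinal.{w}} (hν : ν.cof = Cardinal.aleph0) {A : Type u}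
    [LMCStarAlgebra A] (hA : IsNuComplete ν A) {s : ℕ → A}
    (hs : ∀ p ∈ contSeminorms A, ∀ ε > 0, ∃ N, ∀ m n, N ≤ m → N ≤ n →
      p.toSeminorm (s m - s n) < ε) : ∃ a, Filter.Tendsto s Filter.atTop (𝓝 a) := by
  obtain ⟨hne, k, hk⟩ := Ordinal.exists_tendsto_nat_of_cof_eq_aleph0 hν
  -- The reindexed sequence is a Cauchy `ν`-sequence. As `k` takes arbitrarily large values, its
  -- limit is also the limit of the Cauchy sequence `s`.
  obtain ⟨a, ha⟩ := hA (s ∘ k) (isNuCauchy_iff.2 fun p hp ε hε => by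
    obtain ⟨N, hN⟩ := hs p hp ε hε
    obtain ⟨γ, hγ⟩ := Filter.eventually_atTop.1 (hk.eventually_ge_atTop N)
    exact ⟨γ, fun α β h1 h2 => hN _ _ (hγ α h1) (hγ β h2)⟩)
  refine ⟨a, LMCStarAlgebra.tendsto_nhds_iff.2 fun p hp => ?_⟩
  rw [Metric.tendsto_atTop]
  intro ε hε
  obtain ⟨N, hN⟩ := hs p hp (ε / 2) (by positivity)
  have h1 := (LMCStarAlgebra.tendsto_nhds_iff.1 ha p hp).eventually
    (gt_mem_nhds (half_pos hε))
  obtain ⟨α, hα, hαN⟩ := (h1.and (hk.eventually_ge_atTop N)).exists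
  refine ⟨N, fun n hn => ?_⟩
  rw [Real.dist_0_eq_abs, abs_of_nonneg (apply_nonneg _ _)]
  have e : s n - a = (s n - s (k α)) + (s (k α) - a) := by abel
  rw [e]
  refine (map_add_le_add _ _ _).trans_lt ?_
  have h2 := hN n (k α) hn hαN
  have h3 : p.toSeminorm (s (k α) - a) < ε / 2 := hα
  linarith

/-! ### The `ν`-closure as a set -/

section NuClosure

variable {ν : Ordinal.{w}}

lemma IsNuClosed.preimage {X : Type u} {Y : Type v} [TopologicalSpace X] [TopologicalSpace Y]
    {C : Set Y} (hC : IsNuClosed ν C) {f : X → Y} (hf : Continuous f) : IsNuClosed ν (f ⁻¹' C) :=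
  fun hν x hx b hb => hC hν (f ∘ x) hx _ ((hf.tendsto b).comp hb)

lemma IsClosed.isNuClosed {X : Type u} [TopologicalSpace X] {C : Set X} (hC : IsClosed C) :
    IsNuClosed ν C := fun _ _ hx _ hb =>
  hC.mem_of_tendsto hb (Filter.Eventually.of_forall hx)

/-- The `ν`-closure of a *-subalgebra is contained in every `ν`-closed set which contains the
subalgebra. -/
lemma nuClosure_subset {B : Type u} [LMCStarAlgebra B] {T : NonUnitalStarSubalgebra ℂ B}
    {C : Set B} (hT : (T : Set B) ⊆ C) (hC : IsNuClosed ν C) : (nuClosure ν T : Set B) ⊆ C := by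
  -- The smallest `ν`-closed set containing `T` is automatically a *-subalgebra: the operations are
  -- continuous in each variable separately, so stability extends from `T` one variable at a time.
  let D : Set B := ⋂₀ {C | (T : Set B) ⊆ C ∧ IsNuClosed ν C}
  have hTD : (T : Set B) ⊆ D := Set.subset_sInter fun C hC => hC.1
  have hD : IsNuClosed ν D := fun hν x hx b hb =>
    Set.mem_sInter.2 fun C hC => hC.2 hν x (fun α => Set.mem_sInter.1 (hx α) C hC) b hb
  have hDC : ∀ {C : Set B}, (T : Set B) ⊆ C → IsNuClosed ν C → D ⊆ C := fun h1 h2 =>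
    Set.sInter_subset_of_mem ⟨h1, h2⟩
  have hun : ∀ f : B → B, Continuous f → (∀ x ∈ T, f x ∈ T) → ∀ x ∈ D, f x ∈ D :=
    fun f hf hfT => hDC (fun x hx => hTD (hfT x hx)) (hD.preimage hf)
  have hbin : ∀ f : B → B → B, (∀ x, Continuous (f x)) → (∀ y, Continuous fun x => f x y) →
      (∀ x ∈ T, ∀ y ∈ T, f x y ∈ T) → ∀ x ∈ D, ∀ y ∈ D, f x y ∈ D := by
    intro f hf1 hf2 hfT x hx y hy
    have h1 : ∀ x ∈ T, f x y ∈ D := fun x hx =>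
      hDC (C := f x ⁻¹' D) (fun y hy => hTD (hfT x hx y hy)) (hD.preimage (hf1 x)) hy
    exact hDC (C := (fun x => f x y) ⁻¹' D) h1 (hD.preimage (hf2 y)) hx
  let D' : NonUnitalStarSubalgebra ℂ B :=
    { carrier := D
      add_mem' := fun {x y} hx hy => hbin (· + ·) (fun _ => by fun_prop) (fun _ => by fun_prop)
        (fun x hx y hy => add_mem hx hy) x hx y hy
      zero_mem' := hTD (zero_mem T)
      mul_mem' := fun {x y} hx hy => hbin (· * ·) (fun _ => by fun_prop) (fun _ => by fun_prop)
        (fun x hx y hy => mul_mem hx hy) x hx y hy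
      smul_mem' := fun c x hx => hun (c • ·) (by fun_prop) (fun x hx => T.smul_mem' c hx) x hx
      star_mem' := fun {x} hx => hun star (by fun_prop) (fun x hx => star_mem hx) x hx }
  exact fun x hx => hDC hT hC (nuClosure_le (T' := D') hTD hD hx)

end NuClosure

/-! ### Seminorms and linear maps on the `ν`-completion -/

namespace NuCompletion

variable {ν : Ordinal.{w}}
variable {E : Type u} [NonUnitalRing E] [StarRing E] [Module ℂ E] [IsScalarTower ℂ E E]
  [SMulCommClass ℂ E E] [StarModule ℂ E] {S : Set (CStarSeminorm E)}

/-- By `nuClosure_subset`, `C` does not have to be a subalgebra; this makes density and bounded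
linear maps accessible. -/
lemma induction_on {C : Set (SeminormProduct S)} (hC : IsNuClosed ν C)
    (h : ∀ x, toSeminormProduct S x ∈ C) (w : NuCompletion ν S) : incl ν S w ∈ C :=
  nuClosure_subset (T := NonUnitalStarAlgHom.range (toSeminormProduct S))
    (by rintro _ ⟨x, rfl⟩; exact h x) hC w.2

lemma denseRange_of : DenseRange (of ν S) := by
  intro w
  rw [(isInducing_incl ν S).closure_eq_preimage_closure_image, Set.mem_preimage]
  exact induction_on isClosed_closure.isNuClosed
    (fun x => subset_closure (Set.mem_image_of_mem (incl ν S) (Set.mem_range_self x))) w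

variable (ν) in
/-- The component in `Compl p`, as a continuous *-homomorphism. -/
def component (p : S) : LHom (NuCompletion ν S) p.1.Compl :=
  ⟨(LMCStarAlgebra.proj _ p).comp (incl ν S),
    (continuous_apply p).comp (isInducing_incl ν S).continuous⟩

variable (ν) in
/-- The extension to the `ν`-completion of a C*-seminorm in `S`. -/
def seminorm (p : S) : CStarSeminorm (NuCompletion ν S) :=
  (CStarSeminorm.ofNorm p.1.Compl).comap (component ν p).1

lemma seminorm_mem (p : S) : seminorm ν p ∈ contSeminorms (NuCompletion ν S) :=
  continuous_norm.comp (component ν p).2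

lemma continuous_seminorm (p : S) : Continuous (seminorm ν p).toSeminorm := seminorm_mem p

@[simp] lemma seminorm_of (p : S) (x : E) :
    (seminorm ν p).toSeminorm (of ν S x) = p.1.toSeminorm x := CStarSeminorm.Compl.norm_of _ _

lemma nhds_zero_eq_iInf :
    𝓝 (0 : NuCompletion ν S) = ⨅ p : S, Filter.comap (component ν p) (𝓝 0) := by
  rw [(isInducing_incl ν S).nhds_eq_comap, map_zero, nhds_pi, Filter.pi, Filter.comap_iInf]
  simp only [Filter.comap_comap]
  rfl

lemma exists_le_finsetSup {P : CStarSeminorm (NuCompletion ν S)}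
    (hP : P ∈ contSeminorms (NuCompletion ν S)) : ∃ s : Finset S, ∀ w,
      P.toSeminorm w ≤ (CStarSeminorm.finsetSup s (seminorm ν)).toSeminorm w := by
  obtain ⟨s, q, hq, h⟩ := LMCStarAlgebra.exists_le_finsetSup_of_inducing nhds_zero_eq_iInf hP
  refine ⟨s, fun w => (h w).trans (CStarSeminorm.finsetSup_le (apply_nonneg _ _) fun p hp => ?_)⟩
  refine le_trans ?_ (CStarSeminorm.le_finsetSup (seminorm ν) hp w)
  -- On the C*-algebra `Compl p` every continuous C*-seminorm is below the norm, so the unspecified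
  -- `q p` may be replaced by `seminorm ν p`.
  have hU : {k | (q p).toSeminorm k < 1} ∈ 𝓝 (0 : p.1.Compl) :=
    (isOpen_lt (hq p : Continuous (q p).toSeminorm) continuous_const).mem_nhds (by simp)
  obtain ⟨ε, hε, h⟩ := Metric.nhds_basis_ball.mem_iff.1 hU
  refine CStarSeminorm.le_of_lt_imp_lt (q := CStarSeminorm.ofNorm p.1.Compl) hε
    (fun k hk => h ?_) (component ν p w)
  rw [mem_ball_zero_iff]
  exact hk

section Linear

variable {E' : Type v} [NonUnitalRing E'] [StarRing E'] [Module ℂ E'] [IsScalarTower ℂ E' E']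
  [SMulCommClass ℂ E' E'] [StarModule ℂ E'] {S' : Set (CStarSeminorm E')}

/-- The continuous linear map of completions induced by a bounded linear map. -/
def linMapCompl {p : CStarSeminorm E} {p' : CStarSeminorm E'} (f : E →ₗ[ℂ] E') (C : ℝ)
    (h : ∀ x, p'.toSeminorm (f x) ≤ C * p.toSeminorm x) : p.Compl →L[ℂ] p'.Compl :=
  ContinuousLinearMap.completion (LinearMap.mkContinuous
    (show p.Pre →ₗ[ℂ] p'.Pre from f) C h)

lemma linMapCompl_of {p : CStarSeminorm E} {p' : CStarSeminorm E'} (f : E →ₗ[ℂ] E') (C : ℝ)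
    (h : ∀ x, p'.toSeminorm (f x) ≤ C * p.toSeminorm x) (x : E) :
    linMapCompl f C h (CStarSeminorm.Compl.of p x) = CStarSeminorm.Compl.of p' (f x) :=
  ContinuousLinearMap.completion_apply_coe _ _

variable (f : E →ₗ[ℂ] E')
  (h : ∀ p' ∈ S', ∃ p ∈ S, ∃ C : ℝ, ∀ x, p'.toSeminorm (f x) ≤ C * p.toSeminorm x)

/-- The continuous linear map of products of completions induced by a linear map. -/
def linMapProduct : SeminormProduct S →L[ℂ] SeminormProduct S' :=
  ContinuousLinearMap.pi fun p' => (linMapCompl (p := (h p'.1 p'.2).choose) f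
    (h p'.1 p'.2).choose_spec.2.choose (h p'.1 p'.2).choose_spec.2.choose_spec).comp
    (ContinuousLinearMap.proj (φ := fun p : S => p.1.Compl)
      (⟨_, (h p'.1 p'.2).choose_spec.1⟩ : S))

lemma linMapProduct_toSeminormProduct (x : E) :
    linMapProduct f h (toSeminormProduct S x) = toSeminormProduct S' (f x) :=
  funext fun p' => linMapCompl_of f (h p'.1 p'.2).choose_spec.2.choose
    (h p'.1 p'.2).choose_spec.2.choose_spec x

lemma linMapProduct_mem (w : NuCompletion ν S) :
    linMapProduct f h (incl ν S w) ∈ nuCompletionSubalgebra ν S' :=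
  induction_on
    (IsNuClosed.preimage (C := (nuCompletionSubalgebra ν S' : Set (SeminormProduct S')))
      (isNuClosed_nuClosure ν _) (linMapProduct f h).continuous)
    (fun x => by
      rw [Set.mem_preimage, linMapProduct_toSeminormProduct]
      exact le_nuClosure _ ⟨f x, rfl⟩) w

variable (ν) in
/-- The continuous linear map of `ν`-completions induced by a linear map. -/
def linMap : NuCompletion ν S →L[ℂ] NuCompletion ν S' where
  toFun w := ⟨linMapProduct f h (incl ν S w), linMapProduct_mem f h w⟩
  map_add' x y := Subtype.ext ((congrArg (linMapProduct f h) (map_add (incl ν S) x y)).trans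
    (map_add (linMapProduct f h) _ _))
  map_smul' c x := Subtype.ext ((congrArg (linMapProduct f h) (map_smul (incl ν S) c x)).trans
    (map_smul (linMapProduct f h) _ _))
  cont := (isInducing_incl ν S').continuous_iff.2
    ((linMapProduct f h).continuous.comp (isInducing_incl ν S).continuous)

@[simp] lemma linMap_of (x : E) : linMap ν f h (of ν S x) = of ν S' (f x) :=
  Subtype.ext (linMapProduct_toSeminormProduct f h x)

end Linear

end NuCompletion

/-! ### The `ν`-completion of an l.m.c.-C*-algebra -/

/-- The pull back of continuous C*-seminorms along a continuous *-homomorphism. -/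
def LHom.comapSeminorm {A : Type u} {B : Type v} [LMCStarAlgebra A] [LMCStarAlgebra B]
    (f : LHom A B) (q : contSeminorms B) : contSeminorms A :=
  ⟨q.1.comap f.1, q.2.comp f.2⟩

lemma LMCStarAlgebra.continuous_of_forall {A : Type u} {B : Type v} [LMCStarAlgebra A]
    [LMCStarAlgebra B] (f : A →⋆ₙₐ[ℂ] B)
    (h : ∀ q ∈ contSeminorms B, ∃ p ∈ contSeminorms A, ∀ a, q.toSeminorm (f a) ≤ p.toSeminorm a) :
    Continuous f := by
  refine continuous_iff_continuousAt.2 fun a => tendsto_nhds_iff.2 fun q hq => ?_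
  obtain ⟨p, hp, hpq⟩ := h q hq
  refine squeeze_zero (fun _ => apply_nonneg _ _) (fun x => ?_)
    (tendsto_nhds_iff.1 (Filter.tendsto_id (x := 𝓝 a)) p hp)
  rw [← map_sub]
  exact hpq _

namespace NuCompletion

variable {ν : Ordinal.{w}} {Z : Type u} [LMCStarAlgebra Z]

variable (ν Z) in
/-- The canonical map of an l.m.c.-C*-algebra to its `ν`-completion. -/
def ofHom : LHom Z (NuCompletion ν (contSeminorms Z)) :=
  ⟨of ν _, LMCStarAlgebra.continuous_of_forall _ fun q hq => by
    obtain ⟨s, hs⟩ := exists_le_finsetSup hq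
    refine ⟨CStarSeminorm.finsetSup s fun p => p.1,
      LMCStarAlgebra.finsetSup_mem s fun p _ => p.2, fun a => (hs _).trans ?_⟩
    refine CStarSeminorm.finsetSup_le (apply_nonneg _ _) fun p hp => ?_
    rw [seminorm_of]
    exact CStarSeminorm.le_finsetSup (fun p : contSeminorms Z => p.1) hp a⟩

lemma ofHom_apply (z : Z) : ofHom ν Z z = of ν _ z := rfl

lemma ofHom_injective : Function.Injective (ofHom ν Z) := by
  refine (injective_iff_map_eq_zero (ofHom ν Z).1).2 fun z hz => ?_
  refine LMCStarAlgebra.eq_zero_of_forall fun p hp => ?_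
  rw [← seminorm_of (ν := ν) (⟨p, hp⟩ : contSeminorms Z), ← ofHom_apply]
  exact (congrArg _ hz).trans (map_zero _)

/-- The image of a `ν`-complete algebra in the product of its C*-completions is `ν`-closed: the
components have the continuous seminorms as norms, so a convergent `ν`-sequence in the image comes
from a Cauchy one. -/
lemma ofHom_surjective (hν : ν.cof = Cardinal.aleph0) (hZ : IsNuComplete ν Z) :
    Function.Surjective (ofHom ν Z) := by
  intro w
  have hne := (Ordinal.exists_tendsto_nat_of_cof_eq_aleph0 hν).1
  have hC : IsNuClosed ν (Set.range (toSeminormProduct (contSeminorms Z))) := by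
    intro _ x hx b hb
    choose y hy using hx
    have hx' : ∀ α, x α = incl ν _ (ofHom ν Z (y α)) := fun α => (hy α).symm
    obtain ⟨a, ha⟩ := hZ y (isNuCauchy_iff.2 fun p hp ε hε => by
      have h1 := (tendsto_pi_nhds.1 hb ⟨p, hp⟩).cauchySeq
      obtain ⟨γ, hγ⟩ := Metric.cauchySeq_iff.1 h1 ε hε
      refine ⟨γ, fun α β h2 h3 => ?_⟩
      have h4 := hγ α h2 β h3
      rw [dist_eq_norm, ← hy α, ← hy β] at h4
      rw [← CStarSeminorm.Compl.norm_of, map_sub]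
      exact h4)
    refine ⟨a, tendsto_nhds_unique ?_ hb⟩
    have h1 := (((isInducing_incl ν (contSeminorms Z)).continuous.comp
      (ofHom ν Z).2).tendsto a).comp ha
    refine h1.congr fun α => (hx' α).symm
  obtain ⟨z, hz⟩ := induction_on hC (fun x => ⟨x, rfl⟩) w
  exact ⟨z, incl_injective ν _ hz⟩

/-- The inverse of the canonical map of a `ν`-complete algebra to its `ν`-completion. -/
def retract (hν : ν.cof = Cardinal.aleph0) (hZ : IsNuComplete ν Z) :
    LHom (NuCompletion ν (contSeminorms Z)) Z :=
  let e := StarAlgEquiv.ofBijective (ofHom ν Z).1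
    ⟨ofHom_injective, ofHom_surjective hν hZ⟩
  ⟨(e.symm : _ →⋆ₙₐ[ℂ] Z), LMCStarAlgebra.continuous_of_forall _ fun q hq =>
    ⟨_, seminorm_mem ⟨q, hq⟩, fun w => by
      obtain ⟨z, rfl⟩ := ofHom_surjective hν hZ w
      rw [ofHom_apply, seminorm_of]
      exact (congrArg _ (e.symm_apply_apply z)).le⟩⟩

lemma retract_ofHom (hν : ν.cof = Cardinal.aleph0) (hZ : IsNuComplete ν Z) (z : Z) :
    retract hν hZ (ofHom ν Z z) = z :=
  (StarAlgEquiv.ofBijective (ofHom ν Z).1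
    ⟨ofHom_injective, ofHom_surjective hν hZ⟩).symm_apply_apply z

lemma ofHom_retract (hν : ν.cof = Cardinal.aleph0) (hZ : IsNuComplete ν Z)
    (w : NuCompletion ν (contSeminorms Z)) : ofHom ν Z (retract hν hZ w) = w :=
  (StarAlgEquiv.ofBijective (ofHom ν Z).1
    ⟨ofHom_injective, ofHom_surjective hν hZ⟩).apply_symm_apply w

variable (ν) in
/-- The functoriality of the `ν`-completion. -/
def mapHom {Y : Type v} [LMCStarAlgebra Y] (φ : LHom Z Y) :
    LHom (NuCompletion ν (contSeminorms Z)) (NuCompletion ν (contSeminorms Y)) :=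
  have h := fun q (hq : q ∈ contSeminorms Y) =>
    ⟨_, (φ.comapSeminorm ⟨q, hq⟩).2, fun _ => le_rfl⟩
  ⟨map φ.1 h, continuous_map _ _⟩

lemma mapHom_ofHom {Y : Type v} [LMCStarAlgebra Y] (φ : LHom Z Y) (z : Z) :
    mapHom ν φ (ofHom ν Z z) = ofHom ν Y (φ z) := map_of _ _ z

/-- The extension to the `ν`-completion of a continuous *-homomorphism with values in a
`ν`-complete algebra. -/
def lift (hν : ν.cof = Cardinal.aleph0) {Y : Type v} [LMCStarAlgebra Y] (hY : IsNuComplete ν Y)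
    (φ : LHom Z Y) : LHom (NuCompletion ν (contSeminorms Z)) Y :=
  (retract hν hY).comp (mapHom ν φ)

lemma lift_ofHom (hν : ν.cof = Cardinal.aleph0) {Y : Type v} [LMCStarAlgebra Y]
    (hY : IsNuComplete ν Y) (φ : LHom Z Y) (z : Z) : lift hν hY φ (ofHom ν Z z) = φ z :=
  (congrArg (retract hν hY) (mapHom_ofHom φ z)).trans (retract_ofHom hν hY _)

lemma lift_comp_ofHom (hν : ν.cof = Cardinal.aleph0) {Y : Type v} [LMCStarAlgebra Y]
    (hY : IsNuComplete ν Y) (φ : LHom Z Y) : (lift hν hY φ).comp (ofHom ν Z) = φ :=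
  LHom.ext (lift_ofHom hν hY φ)

lemma LHom_ext {Y : Type v} [LMCStarAlgebra Y] {φ ψ : LHom (NuCompletion ν (contSeminorms Z)) Y}
    (h : φ.comp (ofHom ν Z) = ψ.comp (ofHom ν Z)) : φ = ψ :=
  Subtype.ext (hom_ext φ.2 ψ.2 fun z => congrArg (fun f : LHom Z Y => f z) h)

end NuCompletion

/-! ### The tensor product `Z ⊗ K` -/

namespace NuTensor

open KOp CStarSeminorm

variable (ν : Ordinal.{w}) {Z : Type u} [LMCStarAlgebra Z]

/-- The canonical map from the algebraic tensor product. -/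
abbrev of : Z ⊗[ℂ] KOp →⋆ₙₐ[ℂ] NuTensor ν Z KOp := NuCompletion.of ν (tensorSeminorms Z KOp)

/-- The extension to `Z ⊗ K` of the C*-seminorm defined by a continuous C*-seminorm on `Z` and the
norm of `K`. -/
def seminorm (p : contSeminorms Z) : CStarSeminorm (NuTensor ν Z KOp) :=
  NuCompletion.seminorm ν (⟨p.1.tensorK, p.1, p.2, normK, normK_mem, rfl⟩ :
    tensorSeminorms Z KOp)

lemma seminorm_mem (p : contSeminorms Z) : seminorm ν p ∈ contSeminorms (NuTensor ν Z KOp) :=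
  NuCompletion.seminorm_mem _

@[fun_prop] lemma continuous_seminorm (p : contSeminorms Z) :
    Continuous (seminorm ν p).toSeminorm := seminorm_mem ν p

@[simp] lemma seminorm_of (p : contSeminorms Z) (x : Z ⊗[ℂ] KOp) :
    (seminorm ν p).toSeminorm (of ν x) = p.1.tensorK.toSeminorm x := NuCompletion.seminorm_of _ x

variable {ν}

@[elab_as_elim] lemma induction_on {C : NuTensor ν Z KOp → Prop} (w : NuTensor ν Z KOp)
    (hC : IsClosed {w | C w}) (h : ∀ x, C (of ν x)) : C w :=
  NuCompletion.denseRange_of.induction_on w hC h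

lemma seminorm_mono {p q : contSeminorms Z} (h : ∀ z, p.1.toSeminorm z ≤ q.1.toSeminorm z)
    (w : NuTensor ν Z KOp) : (seminorm ν p).toSeminorm w ≤ (seminorm ν q).toSeminorm w :=
  induction_on w (isClosed_le (by fun_prop) (by fun_prop)) fun x => by
    rw [seminorm_of, seminorm_of]
    exact minTensor_mono h (fun _ => le_rfl) x

/-- The seminorms on `K` are replaced by the norm, and the maximum of finitely many seminorms `pq`
by the seminorm of the maximum of the `p`. -/
lemma exists_le_seminorm {P : CStarSeminorm (NuTensor ν Z KOp)}
    (hP : P ∈ contSeminorms (NuTensor ν Z KOp)) :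
    ∃ p : contSeminorms Z, ∀ w, P.toSeminorm w ≤ (seminorm ν p).toSeminorm w := by
  obtain ⟨s, hs⟩ := NuCompletion.exists_le_finsetSup hP
  choose p hp q hq hr using fun r : tensorSeminorms Z KOp => r.2
  refine ⟨⟨_, LMCStarAlgebra.finsetSup_mem s fun r _ => hp r⟩, fun w => (hs w).trans ?_⟩
  refine CStarSeminorm.finsetSup_le (apply_nonneg _ _) fun r hrs => ?_
  refine induction_on w (isClosed_le (NuCompletion.continuous_seminorm r) (by fun_prop)) fun x => ?_
  rw [NuCompletion.seminorm_of, seminorm_of, hr r]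
  exact minTensor_mono (CStarSeminorm.le_finsetSup p hrs) (le_normK (hq r)) x

lemma tendsto_nhds_iff {X : Type*} {l : Filter X} {f : X → NuTensor ν Z KOp}
    {w : NuTensor ν Z KOp} : Filter.Tendsto f l (𝓝 w) ↔ ∀ p : contSeminorms Z,
      Filter.Tendsto (fun x => (seminorm ν p).toSeminorm (f x - w)) l (𝓝 0) := by
  rw [LMCStarAlgebra.tendsto_nhds_iff]
  refine ⟨fun h p => h _ (seminorm_mem ν p), fun h P hP => ?_⟩
  obtain ⟨p, hp⟩ := exists_le_seminorm hP
  exact squeeze_zero (fun _ => apply_nonneg _ _) (fun _ => hp _) (h p)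

lemma eq_of_forall_seminorm {w w' : NuTensor ν Z KOp}
    (h : ∀ p : contSeminorms Z, (seminorm ν p).toSeminorm (w - w') = 0) : w = w' := by
  refine sub_eq_zero.1 (LMCStarAlgebra.eq_zero_of_forall fun P hP => ?_)
  obtain ⟨p, hp⟩ := exists_le_seminorm hP
  exact le_antisymm ((hp _).trans (h p).le) (apply_nonneg _ _)

lemma exists_seminorm_sub_of_lt (p : contSeminorms Z) (w : NuTensor ν Z KOp) {ε : ℝ}
    (hε : 0 < ε) : ∃ x, (seminorm ν p).toSeminorm (w - of ν x) < ε := by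
  have ho : IsOpen {w' | (seminorm ν p).toSeminorm (w - w') < ε} :=
    isOpen_lt (by fun_prop) continuous_const
  obtain ⟨x, hx⟩ := NuCompletion.denseRange_of.exists_mem_open ho ⟨w, by simpa using hε⟩
  exact ⟨x, hx⟩

variable (ν) in
/-- The matrix coefficients, with values in the `ν`-completion. -/
def coeff (i j : ℕ) : NuTensor ν Z KOp →L[ℂ] NuCompletion ν (contSeminorms Z) :=
  NuCompletion.linMap ν (sliceK Z i j) fun p hp =>
    ⟨p.tensorK, ⟨p, hp, normK, normK_mem, rfl⟩, 1, fun x => by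
      rw [one_mul]; exact sliceK_le p i j x⟩

@[simp] lemma coeff_of (i j : ℕ) (x : Z ⊗[ℂ] KOp) :
    coeff ν i j (of ν x) = NuCompletion.ofHom ν Z (sliceK Z i j x) := NuCompletion.linMap_of _ _ x

variable (ν) in
/-- Right multiplication by `1 ⊗ k`. -/
def rightMul (k : KOp) : NuTensor ν Z KOp →L[ℂ] NuTensor ν Z KOp :=
  NuCompletion.linMap ν (rightMulK Z k) fun r ⟨p, hp, q, hq, hr⟩ =>
    ⟨r, ⟨p, hp, q, hq, hr⟩, q.toSeminorm k, fun x => by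
      rw [hr]; exact minTensor_rightMulK_le p q k x⟩

@[simp] lemma rightMul_of (k : KOp) (x : Z ⊗[ℂ] KOp) :
    rightMul ν k (of ν x) = of ν (rightMulK Z k x) := NuCompletion.linMap_of _ _ x

variable (ν) in
/-- Left multiplication by `1 ⊗ k`. -/
def leftMul (k : KOp) : NuTensor ν Z KOp →L[ℂ] NuTensor ν Z KOp :=
  NuCompletion.linMap ν (leftMulK Z k) fun r ⟨p, hp, q, hq, hr⟩ =>
    ⟨r, ⟨p, hp, q, hq, hr⟩, q.toSeminorm k, fun x => by
      rw [hr]; exact minTensor_leftMulK_le p q k x⟩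

@[simp] lemma leftMul_of (k : KOp) (x : Z ⊗[ℂ] KOp) :
    leftMul ν k (of ν x) = of ν (leftMulK Z k x) := NuCompletion.linMap_of _ _ x

variable (ν Z) in
/-- The map `z ↦ z ⊗ e_ij`. -/
def tmulUnit (i j : ℕ) : NuCompletion ν (contSeminorms Z) →L[ℂ] NuTensor ν Z KOp :=
  NuCompletion.linMap ν ((TensorProduct.mk ℂ Z KOp).flip (unit i j)) fun r ⟨p, hp, q, hq, hr⟩ =>
    ⟨p, hp, q.toSeminorm (unit i j), fun z => by
      rw [hr, mul_comm]; exact minTensor_tmul_le p q z _⟩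

@[simp] lemma tmulUnit_ofHom (i j : ℕ) (z : Z) :
    tmulUnit ν Z i j (NuCompletion.ofHom ν Z z) = of ν (z ⊗ₜ unit i j) :=
  NuCompletion.linMap_of _ _ z

lemma seminorm_coeff_le (p : contSeminorms Z) (i j : ℕ) (w : NuTensor ν Z KOp) :
    (NuCompletion.seminorm ν p).toSeminorm (coeff ν i j w) ≤ (seminorm ν p).toSeminorm w :=
  induction_on w (isClosed_le (Continuous.comp' (NuCompletion.continuous_seminorm p) (coeff ν i j).continuous)
    (by fun_prop)) fun x => by
    rw [coeff_of, NuCompletion.ofHom_apply, NuCompletion.seminorm_of, seminorm_of]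
    exact sliceK_le _ _ _ _

lemma seminorm_rightMul_le (p : contSeminorms Z) (k : KOp) (w : NuTensor ν Z KOp) :
    (seminorm ν p).toSeminorm (rightMul ν k w) ≤
      normK.toSeminorm k * (seminorm ν p).toSeminorm w :=
  induction_on w (isClosed_le (by fun_prop) (by fun_prop)) fun x => by
    rw [rightMul_of, seminorm_of, seminorm_of]
    exact minTensor_rightMulK_le _ _ _ _

lemma seminorm_leftMul_le (p : contSeminorms Z) (k : KOp) (w : NuTensor ν Z KOp) :
    (seminorm ν p).toSeminorm (leftMul ν k w) ≤
      normK.toSeminorm k * (seminorm ν p).toSeminorm w :=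
  induction_on w (isClosed_le (by fun_prop) (by fun_prop)) fun x => by
    rw [leftMul_of, seminorm_of, seminorm_of]
    exact minTensor_leftMulK_le _ _ _ _

lemma seminorm_tmulUnit (p : contSeminorms Z) (i j : ℕ) (z : NuCompletion ν (contSeminorms Z)) :
    (seminorm ν p).toSeminorm (tmulUnit ν Z i j z) = (NuCompletion.seminorm ν p).toSeminorm z :=
  NuCompletion.denseRange_of.induction_on z
    (isClosed_eq (by fun_prop) (NuCompletion.continuous_seminorm p)) fun z => by
    rw [← NuCompletion.ofHom_apply, tmulUnit_ofHom, seminorm_of, NuCompletion.ofHom_apply,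
      NuCompletion.seminorm_of]
    refine le_antisymm ((minTensor_tmul_le _ _ _ _).trans ?_) (le_tensorK_tmul_unit _ _ _ _)
    rw [normK_unit, mul_one]

lemma star_rightMul (k : KOp) (w : NuTensor ν Z KOp) :
    star (rightMul ν k w) = leftMul ν (star k) (star w) :=
  induction_on w (isClosed_eq (by fun_prop) (by fun_prop)) fun x => by
    rw [rightMul_of, ← StarHomClass.map_star, star_rightMulK, ← StarHomClass.map_star, leftMul_of]

lemma rightMul_mul (k : KOp) (w w' : NuTensor ν Z KOp) :
    rightMul ν k (w * w') = w * rightMul ν k w' :=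
  induction_on w (isClosed_eq ((rightMul ν k).continuous.comp' (continuous_mul_const w'))
      (continuous_mul_const _)) fun x =>
    induction_on w' (isClosed_eq ((rightMul ν k).continuous.comp' (continuous_const_mul _))
      ((continuous_const_mul _).comp' (rightMul ν k).continuous)) fun y => by
        rw [← map_mul, rightMul_of, rightMul_of, ← map_mul, rightMulK_mul]

lemma leftMul_mul (k : KOp) (w w' : NuTensor ν Z KOp) :
    leftMul ν k (w * w') = leftMul ν k w * w' :=
  induction_on w (isClosed_eq ((leftMul ν k).continuous.comp' (continuous_mul_const w'))
      ((continuous_mul_const _).comp' (leftMul ν k).continuous)) fun x =>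
    induction_on w' (isClosed_eq ((leftMul ν k).continuous.comp' (continuous_const_mul _))
      (continuous_const_mul _)) fun y => by
        rw [← map_mul, leftMul_of, leftMul_of, ← map_mul, leftMulK_mul]

lemma rightMul_mul_eq (k : KOp) (w w' : NuTensor ν Z KOp) :
    rightMul ν k w * w' = w * leftMul ν k w' :=
  induction_on w (isClosed_eq ((continuous_mul_const w').comp' (rightMul ν k).continuous)
      (continuous_mul_const _)) fun x =>
    induction_on w' (isClosed_eq (continuous_const_mul _)
      ((continuous_const_mul _).comp' (leftMul ν k).continuous)) fun y => by
        rw [rightMul_of, leftMul_of, ← map_mul, ← map_mul, rightMulK_mul_eq]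

lemma rightMul_rightMul (k l : KOp) (w : NuTensor ν Z KOp) :
    rightMul ν k (rightMul ν l w) = rightMul ν (l * k) w :=
  induction_on w (isClosed_eq (by fun_prop) (by fun_prop)) fun x => by
    rw [rightMul_of, rightMul_of, rightMul_of, rightMulK_rightMulK]

lemma leftMul_rightMul (k l : KOp) (w : NuTensor ν Z KOp) :
    leftMul ν k (rightMul ν l w) = rightMul ν l (leftMul ν k w) :=
  induction_on w (isClosed_eq (by fun_prop) (by fun_prop)) fun x => by
    rw [rightMul_of, leftMul_of, leftMul_of, rightMul_of, leftMulK_rightMulK]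

lemma rightMul_add (k l : KOp) (w : NuTensor ν Z KOp) :
    rightMul ν (k + l) w = rightMul ν k w + rightMul ν l w :=
  induction_on w (isClosed_eq (by fun_prop) (by fun_prop)) fun x => by
    rw [rightMul_of, rightMul_of, rightMul_of, rightMulK_add, map_add]

lemma leftMul_unit_rightMul_unit (i i' j' j : ℕ) (w : NuTensor ν Z KOp) :
    leftMul ν (unit i i') (rightMul ν (unit j' j) w) = tmulUnit ν Z i j (coeff ν i' j' w) :=
  induction_on w (isClosed_eq (by fun_prop) (by fun_prop)) fun x => by
    rw [rightMul_of, leftMul_of, leftMulK_unit_rightMulK_unit, coeff_of, tmulUnit_ofHom]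

variable (ν) in
/-- Truncation to the upper left corner of size `n`. -/
def trunc (n : ℕ) : NuTensor ν Z KOp →L[ℂ] NuTensor ν Z KOp :=
  (leftMul ν (projN n)).comp (rightMul ν (projN n))

lemma trunc_apply (n : ℕ) (w : NuTensor ν Z KOp) :
    trunc ν n w = leftMul ν (projN n) (rightMul ν (projN n) w) := rfl

lemma trunc_of (n : ℕ) (x : Z ⊗[ℂ] KOp) : trunc ν n (of ν x) = of ν (truncK n x) := by
  rw [trunc_apply, rightMul_of, leftMul_of, truncK]

lemma seminorm_trunc_le (p : contSeminorms Z) (n : ℕ) (w : NuTensor ν Z KOp) :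
    (seminorm ν p).toSeminorm (trunc ν n w) ≤ (seminorm ν p).toSeminorm w :=
  (seminorm_leftMul_le _ _ _).trans <|
    (mul_le_of_le_one_left (apply_nonneg _ _) (normK_projN_le n)).trans <|
    (seminorm_rightMul_le _ _ _).trans <|
    mul_le_of_le_one_left (apply_nonneg _ _) (normK_projN_le n)

lemma trunc_eq_sum (n : ℕ) (w : NuTensor ν Z KOp) : trunc ν n w =
    ∑ i ∈ Finset.range n, ∑ j ∈ Finset.range n, tmulUnit ν Z i j (coeff ν i j w) :=
  induction_on w (isClosed_eq (by fun_prop) (by fun_prop)) fun x => by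
    simp only [coeff_of, tmulUnit_ofHom, trunc_of, truncK_eq_sum, map_sum]

/-- Truncations are contractive, so convergence at finitely many algebraic tensors, chosen close to
the compact set, is uniform on the set. -/
lemma exists_forall_seminorm_trunc_sub_lt (p : contSeminorms Z) {K : Set (NuTensor ν Z KOp)}
    (hK : IsCompact K) {ε : ℝ} (hε : 0 < ε) :
    ∃ N, ∀ n, N ≤ n → ∀ w ∈ K, (seminorm ν p).toSeminorm (trunc ν n w - w) < ε := by
  choose x hx using fun w : NuTensor ν Z KOp =>
    exists_seminorm_sub_of_lt p w (show 0 < ε / 3 by positivity)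
  obtain ⟨t, -, ht⟩ := hK.elim_nhds_subcover
    (fun w => {w' | (seminorm ν p).toSeminorm (w' - of ν (x w)) < ε / 3})
    fun w _ => (isOpen_lt (by fun_prop) continuous_const).mem_nhds (hx w)
  have h1 : ∀ᶠ n in Filter.atTop, ∀ w ∈ t,
      p.1.tensorK.toSeminorm (truncK n (x w) - x w) < ε / 3 :=
    (Filter.eventually_all_finset t).2 fun w _ =>
      (tendsto_truncK p.1 (x w)).eventually (gt_mem_nhds (by positivity))
  obtain ⟨N, hN⟩ := Filter.eventually_atTop.1 h1
  refine ⟨N, fun n hn w hw => ?_⟩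
  obtain ⟨w', hw', hww'⟩ := Set.mem_iUnion₂.1 (ht hw)
  have h2 := hN n hn w' hw'
  rw [← seminorm_of ν p, map_sub, ← trunc_of] at h2
  have h3 : (seminorm ν p).toSeminorm (w - of ν (x w')) < ε / 3 := hww'
  have h4 := (seminorm_trunc_le p n (w - of ν (x w'))).trans_lt h3
  have e : trunc ν n w - w = trunc ν n (w - of ν (x w')) + (trunc ν n (of ν (x w')) - of ν (x w'))
      - (w - of ν (x w')) := by rw [map_sub]; abel
  rw [e]
  have h5 := map_sub_le_add (seminorm ν p).toSeminorm
    (trunc ν n (w - of ν (x w')) + (trunc ν n (of ν (x w')) - of ν (x w'))) (w - of ν (x w'))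
  have h6 := map_add_le_add (seminorm ν p).toSeminorm (trunc ν n (w - of ν (x w')))
    (trunc ν n (of ν (x w')) - of ν (x w'))
  linarith

lemma tendsto_trunc (w : NuTensor ν Z KOp) :
    Filter.Tendsto (fun n => trunc ν n w) Filter.atTop (𝓝 w) := by
  refine tendsto_nhds_iff.2 fun p => Metric.tendsto_atTop.2 fun ε hε => ?_
  obtain ⟨N, hN⟩ := exists_forall_seminorm_trunc_sub_lt p (isCompact_singleton (x := w)) hε
  refine ⟨N, fun n hn => ?_⟩
  rw [Real.dist_0_eq_abs, abs_of_nonneg (apply_nonneg _ _)]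
  exact hN n hn w rfl

lemma eq_of_forall_coeff {w w' : NuTensor ν Z KOp} (h : ∀ i j, coeff ν i j w = coeff ν i j w') :
    w = w' := by
  refine tendsto_nhds_unique (tendsto_trunc w) ((tendsto_trunc w').congr fun n => ?_)
  rw [trunc_eq_sum, trunc_eq_sum]
  simp only [h]

/-- The equation on the right is a closed condition that holds on the graph of the slice map.
Conversely, algebraic tensors near `w` have slices near `z`, because the topology of `Z` is given by
seminorms that extend to its completion. -/
lemma isCoeff_iff {w : NuTensor ν Z KOp} {i j : ℕ} {z : Z} :
    IsCoeff ν w i j z ↔ coeff ν i j w = NuCompletion.ofHom ν Z z := by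
  constructor
  · intro h
    have hc : IsClosed {y : NuTensor ν Z KOp × Z | coeff ν i j y.1 = NuCompletion.ofHom ν Z y.2} :=
      isClosed_eq ((coeff ν i j).continuous.comp continuous_fst)
        ((NuCompletion.ofHom ν Z).2.comp continuous_snd)
    exact closure_minimal (by rintro _ ⟨x, rfl⟩; exact coeff_of i j x) hc h
  · intro h
    refine mem_closure_iff_nhds.2 fun U hU => ?_
    rw [nhds_prod_eq] at hU
    obtain ⟨V, hV, W, hW, hVW⟩ := Filter.mem_prod_iff.1 hU
    have hW' : (fun z' => z + z') ⁻¹' W ∈ 𝓝 (0 : Z) :=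
      (continuous_const.add continuous_id).continuousAt.preimage_mem_nhds (by simpa using hW)
    obtain ⟨p, hp, ε, hε, hpW⟩ := LMCStarAlgebra.mem_nhds_zero_iff.1 hW'
    have hV' : {w' | (NuCompletion.seminorm ν ⟨p, hp⟩).toSeminorm
        (coeff ν i j w' - NuCompletion.ofHom ν Z z) < ε} ∈ 𝓝 w := by
      have hcont : Continuous fun w' => (NuCompletion.seminorm ν ⟨p, hp⟩).toSeminorm
          (coeff ν i j w' - NuCompletion.ofHom ν Z z) :=
        (NuCompletion.continuous_seminorm _).comp ((coeff ν i j).continuous.sub continuous_const)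
      exact (isOpen_lt hcont continuous_const).mem_nhds (by simpa [h] using hε)
    obtain ⟨x, hx1, hx2⟩ := NuCompletion.denseRange_of.mem_nhds (Filter.inter_mem hV hV')
    refine ⟨_, hVW ⟨hx1, ?_⟩, ⟨x, rfl⟩⟩
    have h2 : p.toSeminorm (sliceK Z i j x - z) < ε := by
      rw [Set.mem_ofPred_eq, coeff_of, ← map_sub] at hx2
      exact (NuCompletion.seminorm_of (ν := ν) (⟨p, hp⟩ : contSeminorms Z) _).symm.trans_lt hx2
    simpa using hpW _ h2

end NuTensor

/-! ### Naturality of coefficients, and lifting homomorphisms along families of maps. -/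

namespace NuTensor

open KOp CStarSeminorm

lemma _root_.KOp.coeff_unit (i j i' j' : ℕ) :
    KOp.coeff i j (unit i' j') = if i = i' ∧ j = j' then 1 else 0 := by
  rw [coeff_eq, toOp_unit_apply, inner_smul_right, inner_basisVec_basisVec,
    inner_basisVec_basisVec]
  by_cases h1 : i = i' <;> by_cases h2 : j = j' <;> simp [h1, h2, eq_comm]

variable {ν : Ordinal.{w}} {Z Y : Type u} [LMCStarAlgebra Z] [LMCStarAlgebra Y]

lemma map_of (φ : LHom Z Y) (x : Z ⊗[ℂ] KOp) :
    map ν KOp φ (of ν x) = of ν (rTensorHom KOp φ.1 x) :=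
  NuCompletion.map_of _ _ x

lemma coeff_map (φ : LHom Z Y) (i j : ℕ) (w : NuTensor ν Z KOp) :
    coeff ν i j (map ν KOp φ w) = NuCompletion.mapHom ν φ (coeff ν i j w) :=
  induction_on w (isClosed_eq ((coeff ν i j).continuous.comp' (map ν KOp φ).2)
    ((NuCompletion.mapHom ν φ).2.comp' (coeff ν i j).continuous)) fun x => by
      rw [map_of, coeff_of, coeff_of, NuCompletion.mapHom_ofHom, sliceK_rTensorHom]

lemma coeff_map_of_eq {φ : LHom Z Y} {i j : ℕ} {w : NuTensor ν Z KOp} {z : Z}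
    (h : coeff ν i j w = NuCompletion.ofHom ν Z z) :
    coeff ν i j (map ν KOp φ w) = NuCompletion.ofHom ν Y (φ z) := by
  rw [coeff_map, h, NuCompletion.mapHom_ofHom]

lemma seminorm_map_le (φ : LHom Z Y) (q : contSeminorms Y) (w : NuTensor ν Z KOp) :
    (seminorm ν q).toSeminorm (map ν KOp φ w) ≤ (seminorm ν (φ.comapSeminorm q)).toSeminorm w :=
  induction_on w (isClosed_le ((continuous_seminorm ν q).comp' (map ν KOp φ).2) (by fun_prop))
    fun x => by
      rw [map_of, seminorm_of, seminorm_of]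
      exact minTensor_rTensorHom_le _ _ _ _

/-- `p` is the supremum over `j ∈ s` of the pull backs of the `q j` along the `φ j`. -/
structure IsSupOn {J : Type*} {Y : J → Type u} [∀ j, LMCStarAlgebra (Y j)]
    (φ : ∀ j, LHom Z (Y j)) (q : ∀ j, contSeminorms (Y j)) (s : Set J)
    (p : contSeminorms Z) : Prop where
  le : ∀ j ∈ s, ∀ z, (q j).1.toSeminorm (φ j z) ≤ p.1.toSeminorm z
  le_of_forall : ∀ z C, 0 ≤ C → (∀ j ∈ s, (q j).1.toSeminorm (φ j z) ≤ C) → p.1.toSeminorm z ≤ C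

section
variable {J : Type*} {Y : J → Type u} [∀ j, LMCStarAlgebra (Y j)]
  {φ : ∀ j, LHom Z (Y j)} {q : ∀ j, contSeminorms (Y j)} {s : Set J} {p : contSeminorms Z}

lemma IsSupOn.seminorm_map_le (h : IsSupOn φ q s p) {j : J} (hj : j ∈ s)
    (w : NuTensor ν Z KOp) :
    (seminorm ν (q j)).toSeminorm (map ν KOp (φ j) w) ≤ (seminorm ν p).toSeminorm w :=
  (NuTensor.seminorm_map_le _ _ _).trans (seminorm_mono (h.le j hj) w)

/-- This extends `tensorK_le_of_forall` to the completion: replacing `w` by an algebraic tensor at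
distance below `ε / 2` costs `ε / 2` in the hypothesis and again in the conclusion. -/
lemma IsSupOn.seminorm_le (h : IsSupOn φ q s p) {w : NuTensor ν Z KOp} {C : ℝ} (hC : 0 ≤ C)
    (hw : ∀ j ∈ s, (seminorm ν (q j)).toSeminorm (map ν KOp (φ j) w) ≤ C) :
    (seminorm ν p).toSeminorm w ≤ C := by
  refine le_of_forall_pos_lt_add fun ε hε => ?_
  obtain ⟨x, hx⟩ := exists_seminorm_sub_of_lt p w (half_pos hε)
  have h1 : p.1.tensorK.toSeminorm x ≤ C + ε / 2 := by
    refine tensorK_le_of_forall (fun j : s => (φ j).1) (fun j : s => (q j).1) p.1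
      (fun z D hD hz => h.le_of_forall z D hD fun j hj => hz ⟨j, hj⟩) (by positivity) ?_
    rintro ⟨j, hj⟩
    rw [← seminorm_of ν (q j), ← map_of]
    have e : map ν KOp (φ j) (of ν x)
        = map ν KOp (φ j) w - map ν KOp (φ j) (w - of ν x) := by
      rw [_root_.map_sub, sub_sub_cancel]
    rw [e]
    refine (map_sub_le_add (seminorm ν (q j)).toSeminorm _ _).trans ?_
    exact add_le_add (hw j hj) ((h.seminorm_map_le hj _).trans hx.le)
  rw [← seminorm_of ν p] at h1
  have h2 := map_add_le_add (seminorm ν p).toSeminorm (w - of ν x) (of ν x)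
  rw [sub_add_cancel] at h2
  linarith

end

lemma coeff_of_tmul_unit_self (i j : ℕ) (z : Z) :
    coeff ν i j (of ν (z ⊗ₜ unit i j)) = NuCompletion.ofHom ν Z z := by
  rw [coeff_of, sliceK_tmul, coeff_unit, if_pos ⟨rfl, rfl⟩, one_smul]

lemma coeff_of_tmul_unit_of_ne {i j i' j' : ℕ} (h : ¬ (i = i' ∧ j = j')) (z : Z) :
    coeff ν i j (of ν (z ⊗ₜ unit i' j')) = 0 := by
  rw [coeff_of, sliceK_tmul, coeff_unit, if_neg h, zero_smul]
  exact map_zero (NuCompletion.ofHom ν Z).1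

lemma coeff_sum_tmul_unit {i j n : ℕ} (hi : i < n) (hj : j < n) (z : ℕ → ℕ → Z) :
    coeff ν i j (∑ a ∈ Finset.range n, ∑ b ∈ Finset.range n, of ν (z a b ⊗ₜ unit a b)) =
      NuCompletion.ofHom ν Z (z i j) := by
  rw [map_sum, Finset.sum_eq_single_of_mem i (Finset.mem_range.2 hi), map_sum,
    Finset.sum_eq_single_of_mem j (Finset.mem_range.2 hj), coeff_of_tmul_unit_self]
  · exact fun b _ hb => coeff_of_tmul_unit_of_ne (fun h => hb h.2.symm) _
  · intro a _ ha
    rw [map_sum]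
    exact Finset.sum_eq_zero fun b _ => coeff_of_tmul_unit_of_ne (fun h => ha h.1.symm) _

section
variable {J : Type*} {Y : J → Type u} [∀ j, LMCStarAlgebra (Y j)]

/-- The finite sums of the `z a b ⊗ e_ab` are mapped by `φ_j ⊗ id` to the truncations of `w j`. As
these converge uniformly over `s`, and the seminorm is a supremum over `s`, the sums form a Cauchy
sequence; countable cofinality provides the limit. -/
lemma exists_forall_coeff_eq (hν : ν.cof = Cardinal.aleph0) {φ : ∀ j, LHom Z (Y j)}
    {w : ∀ j, NuTensor ν (Y j) KOp} {z : ℕ → ℕ → Z}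
    (hz : ∀ i l j, coeff ν i l (w j) = NuCompletion.ofHom ν (Y j) (φ j (z i l)))
    (hφ : ∀ p₀ ∈ contSeminorms Z, ∃ s q p, (∀ z, p₀.toSeminorm z ≤ p.1.toSeminorm z) ∧
      IsSupOn φ q s p ∧ ∀ ε > 0, ∃ N, ∀ n, N ≤ n → ∀ j ∈ s,
        (seminorm ν (q j)).toSeminorm (trunc ν n (w j) - w j) < ε) :
    ∃ w₀ : NuTensor ν Z KOp, ∀ i l, coeff ν i l w₀ = NuCompletion.ofHom ν Z (z i l) := by
  set t : ℕ → NuTensor ν Z KOp := fun n =>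
    ∑ a ∈ Finset.range n, ∑ b ∈ Finset.range n, of ν (z a b ⊗ₜ unit a b)
  have ht : ∀ n j, map ν KOp (φ j) (t n) = trunc ν n (w j) := fun n j => by
    refine (map_sum (map ν KOp (φ j)).1 _ _).trans ?_
    rw [trunc_eq_sum]
    refine Finset.sum_congr rfl fun a _ => (map_sum (map ν KOp (φ j)).1 _ _).trans ?_
    refine Finset.sum_congr rfl fun b _ => ?_
    rw [hz, tmulUnit_ofHom]
    exact map_of _ _
  obtain ⟨w₀, hw₀⟩ := (NuCompletion.isNuComplete ν (tensorSeminorms Z KOp)).exists_tendsto hν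
    (s := t) fun P hP ε hε => by
      obtain ⟨p₀, hp₀⟩ := exists_le_seminorm hP
      obtain ⟨s, q, p, hp₀p, hs, h⟩ := hφ _ p₀.2
      obtain ⟨N, hN⟩ := h (ε / 3) (by positivity)
      refine ⟨N, fun m n hm hn => ?_⟩
      refine ((hp₀ _).trans (seminorm_mono hp₀p _)).trans_lt ?_
      refine (hs.seminorm_le (C := 2 * (ε / 3)) (by positivity) fun j hj => ?_).trans_lt
        (by linarith)
      have e : map ν KOp (φ j) (t m - t n)
          = (trunc ν m (w j) - w j) - (trunc ν n (w j) - w j) := by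
        rw [_root_.map_sub, ht, ht, sub_sub_sub_cancel_right]
      rw [e]
      refine (map_sub_le_add (seminorm ν (q j)).toSeminorm _ _).trans ?_
      linarith [hN m hm j hj, hN n hn j hj]
  refine ⟨w₀, fun i l => ?_⟩
  refine tendsto_nhds_unique (((coeff ν i l).continuous.tendsto w₀).comp hw₀) ?_
  refine tendsto_const_nhds.congr' ?_
  filter_upwards [Filter.eventually_gt_atTop i, Filter.eventually_gt_atTop l] with n hi hl
  exact (coeff_sum_tmul_unit hi hl z).symm

/-- The topology of `Z` is defined by suprema of pull backs of seminorms along the `φ j`. -/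
def IsSupFamily (φ : ∀ j, LHom Z (Y j)) : Prop :=
  ∀ p₀ ∈ contSeminorms Z, ∃ s q p, (∀ z, p₀.toSeminorm z ≤ p.1.toSeminorm z) ∧ IsSupOn φ q s p

variable {φ : ∀ j, LHom Z (Y j)}

lemma exists_isSupOn_of_inducing (hφ : 𝓝 (0 : Z) = ⨅ j, Filter.comap (φ j) (𝓝 0))
    {p₀ : CStarSeminorm Z} (hp₀ : p₀ ∈ contSeminorms Z) :
    ∃ (s : Finset J) (q : ∀ j, contSeminorms (Y j)) (p : contSeminorms Z),
      (∀ z, p₀.toSeminorm z ≤ p.1.toSeminorm z) ∧ IsSupOn φ q s p := by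
  obtain ⟨s, q, hq, h⟩ := LMCStarAlgebra.exists_le_finsetSup_of_inducing hφ hp₀
  refine ⟨s, fun j => ⟨q j, hq j⟩, ⟨_, LMCStarAlgebra.finsetSup_mem s
    fun j _ => ((φ j).comapSeminorm ⟨q j, hq j⟩).2⟩, h, ?_, ?_⟩
  · exact fun j hj z => le_finsetSup (fun j => (q j).comap (φ j).1) hj z
  · exact fun z C hC h => finsetSup_le hC h

lemma IsSupFamily.eq_of_forall (hφ : IsSupFamily φ) {z z' : Z} (h : ∀ j, φ j z = φ j z') :
    z = z' := by
  refine sub_eq_zero.1 (LMCStarAlgebra.eq_zero_of_forall fun p₀ hp₀ => ?_)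
  obtain ⟨s, q, p, hp, hs⟩ := hφ _ hp₀
  refine le_antisymm ((hp _).trans (hs.le_of_forall _ _ le_rfl fun j _ => ?_)) (apply_nonneg _ _)
  rw [_root_.map_sub, h, sub_self, map_zero]

lemma IsSupFamily.eq_of_forall_map_eq (hφ : IsSupFamily φ) {w w' : NuTensor ν Z KOp}
    (h : ∀ j, map ν KOp (φ j) w = map ν KOp (φ j) w') : w = w' := by
  refine eq_of_forall_seminorm fun p₀ => ?_
  obtain ⟨s, q, p, hp₀, hs⟩ := hφ _ p₀.2
  refine le_antisymm ((seminorm_mono hp₀ _).trans ?_) (apply_nonneg _ _)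
  refine hs.seminorm_le le_rfl fun j _ => ?_
  rw [_root_.map_sub, h, sub_self, map_zero]

/-- The lift is built element by element. Since the maps `φ_j ⊗ id` are jointly injective, it is a
*-homomorphism, and the bound by `P`, uniform in `j ∈ s`, makes it continuous. The set `s` may be
infinite, which is needed for the evaluations of paths; this is why both uniformity conditions are
assumed. -/
lemma exists_lift_of_isSupOn (hν : ν.cof = Cardinal.aleph0) {A : Type v} [LMCStarAlgebra A]
    (f : ∀ j, LHom A (NuTensor ν (Y j) KOp))
    (hφ : ∀ p₀ ∈ contSeminorms Z, ∃ s q p, (∀ z, p₀.toSeminorm z ≤ p.1.toSeminorm z) ∧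
      IsSupOn φ q s p ∧ (∀ a, ∀ ε > 0, ∃ N, ∀ n, N ≤ n → ∀ j ∈ s,
        (seminorm ν (q j)).toSeminorm (trunc ν n (f j a) - f j a) < ε) ∧
      ∃ P ∈ contSeminorms A, ∀ a, ∀ j ∈ s,
        (seminorm ν (q j)).toSeminorm (f j a) ≤ P.toSeminorm a)
    (hf : ∀ i l a, ∃ z, ∀ j, coeff ν i l (f j a) = NuCompletion.ofHom ν (Y j) (φ j z)) :
    ∃ h : LHom A (NuTensor ν Z KOp), (∀ j, (map ν KOp (φ j)).comp h = f j) ∧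
      ∀ i l a z, (∀ j, coeff ν i l (f j a) = NuCompletion.ofHom ν (Y j) (φ j z)) →
        coeff ν i l (h a) = NuCompletion.ofHom ν Z z := by
  have hφ' : IsSupFamily φ := fun p₀ hp₀ => by
    obtain ⟨s, q, p, hp, hs, -⟩ := hφ p₀ hp₀
    exact ⟨s, q, p, hp, hs⟩
  choose z hz using hf
  have H : ∀ a, ∃ w₀ : NuTensor ν Z KOp, (∀ j, map ν KOp (φ j) w₀ = f j a) ∧
      ∀ i l, coeff ν i l w₀ = NuCompletion.ofHom ν Z (z i l a) := fun a => by
    obtain ⟨w₀, hw₀⟩ := exists_forall_coeff_eq hν (φ := φ) (w := fun j => f j a)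
      (z := fun i l => z i l a) (fun i l j => hz i l a j) fun p₀ hp₀ => by
        obtain ⟨s, q, p, hp, hs, ht, -⟩ := hφ p₀ hp₀
        exact ⟨s, q, p, hp, hs, ht a⟩
    refine ⟨w₀, fun j => eq_of_forall_coeff fun i l => ?_, hw₀⟩
    rw [hz, coeff_map_of_eq (hw₀ i l)]
  choose h hh hc using H
  refine ⟨⟨{ toFun := h
             map_smul' := fun c a => ?_
             map_zero' := ?_
             map_add' := fun a b => ?_
             map_mul' := fun a b => ?_
             map_star' := fun a => ?_ }, ?_⟩, fun j => LHom.ext fun a => hh a j,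
    fun i l a z' hz' => ?_⟩
  · refine hφ'.eq_of_forall_map_eq fun j => ?_
    exact (hh _ j).trans ((map_smul (f j).1 c a).trans
      ((congrArg _ (hh a j).symm).trans (map_smul (map ν KOp (φ j)).1 c (h a)).symm))
  · refine hφ'.eq_of_forall_map_eq fun j => ?_
    exact (hh _ j).trans ((map_zero (f j).1).trans (map_zero (map ν KOp (φ j)).1).symm)
  · refine hφ'.eq_of_forall_map_eq fun j => ?_
    rw [hh, map_add, map_add, hh, hh]
  · refine hφ'.eq_of_forall_map_eq fun j => ?_
    rw [hh, map_mul, map_mul, hh, hh]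
  · refine hφ'.eq_of_forall_map_eq fun j => ?_
    rw [hh, StarHomClass.map_star, StarHomClass.map_star, hh]
  · refine LMCStarAlgebra.continuous_of_forall _ fun P hP => ?_
    obtain ⟨p₀, hp₀⟩ := exists_le_seminorm hP
    obtain ⟨s, q, p, hp, hs, -, P', hP', hP'f⟩ := hφ _ p₀.2
    refine ⟨P', hP', fun a => (hp₀ _).trans <| (seminorm_mono hp _).trans ?_⟩
    refine hs.seminorm_le (apply_nonneg _ _) fun j hj => (le_of_eq ?_).trans (hP'f a j hj)
    rw [← hh a j]
    rfl
  · have e : z i l a = z' := hφ'.eq_of_forall fun j =>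
      NuCompletion.ofHom_injective ((hz i l a j).symm.trans (hz' j))
    rw [← e]
    exact hc a i l

/-- For an initial topology the sets `s` are finite, and both uniformity conditions hold
automatically. -/
lemma exists_lift (hν : ν.cof = Cardinal.aleph0)
    (hφ : 𝓝 (0 : Z) = ⨅ j, Filter.comap (φ j) (𝓝 0)) {A : Type v} [LMCStarAlgebra A]
    (f : ∀ j, LHom A (NuTensor ν (Y j) KOp))
    (hf : ∀ i l a, ∃ z, ∀ j, coeff ν i l (f j a) = NuCompletion.ofHom ν (Y j) (φ j z)) :
    ∃ h : LHom A (NuTensor ν Z KOp), (∀ j, (map ν KOp (φ j)).comp h = f j) ∧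
      ∀ i l a z, (∀ j, coeff ν i l (f j a) = NuCompletion.ofHom ν (Y j) (φ j z)) →
        coeff ν i l (h a) = NuCompletion.ofHom ν Z z := by
  refine exists_lift_of_isSupOn hν f (fun p₀ hp₀ => ?_) hf
  obtain ⟨s, q, p, hp, hs⟩ := exists_isSupOn_of_inducing hφ hp₀
  refine ⟨s, q, p, hp, hs, fun a ε hε => ?_, finsetSup s fun j => (seminorm ν (q j)).comap (f j).1,
    LMCStarAlgebra.finsetSup_mem s fun j _ => (seminorm_mem ν (q j)).comp (f j).2, fun a j hj => ?_⟩
  · refine Filter.eventually_atTop.1 ((Filter.eventually_all_finset s).2 fun j _ => ?_)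
    exact (tendsto_nhds_iff.1 (tendsto_trunc (f j a)) (q j)).eventually (gt_mem_nhds hε)
  · exact le_finsetSup (fun j => (seminorm ν (q j)).comap (f j).1) hj a

end

lemma exists_lift_of_inducing (hν : ν.cof = Cardinal.aleph0) {φ : LHom Z Y}
    (hφ : Topology.IsInducing φ) {A : Type v} [LMCStarAlgebra A]
    (f : LHom A (NuTensor ν Y KOp))
    (hf : ∀ i l a, ∃ z, coeff ν i l (f a) = NuCompletion.ofHom ν Y (φ z)) :
    ∃ h : LHom A (NuTensor ν Z KOp), (map ν KOp φ).comp h = f ∧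
      ∀ i l a z, coeff ν i l (f a) = NuCompletion.ofHom ν Y (φ z) →
        coeff ν i l (h a) = NuCompletion.ofHom ν Z z := by
  obtain ⟨h, hh, hc⟩ := exists_lift hν (J := Unit) (φ := fun _ => φ)
    (by rw [iInf_const, hφ.nhds_eq_comap]; exact congrArg _ (congrArg _ (map_zero φ.1)))
    (fun _ => f) fun i l a => (hf i l a).imp fun z hz _ => hz
  exact ⟨h, hh (), fun i l a z hz => hc i l a z fun _ => hz⟩

end NuTensor

/-! ### Generated subalgebras -/

/-- Transport of the structure of an l.m.c.-C*-algebra along a bijection. -/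
abbrev LMCStarAlgebra.ofEquiv {X Z : Type u} [LMCStarAlgebra Z] (e : X ≃ Z) :
    LMCStarAlgebra X :=
  letI : NonUnitalRing X := e.nonUnitalRing
  letI : Module ℂ X := e.module ℂ
  letI : TopologicalSpace X := .induced e inferInstance
  letI : StarRing X :=
    { star := fun x => e.symm (star (e x))
      star_involutive := fun x => by simp
      star_mul := fun x y => e.injective (by simp [e.mul_def])
      star_add := fun x y => e.injective (by simp [e.add_def]) }
  let φ : X →⋆ₙₐ[ℂ] Z :=
    { toFun := e
      map_smul' := fun _ _ => e.apply_symm_apply _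
      map_zero' := e.apply_symm_apply _
      map_add' := fun _ _ => e.apply_symm_apply _
      map_mul' := fun _ _ => e.apply_symm_apply _
      map_star' := fun _ => e.apply_symm_apply _ }
  { smul_assoc := fun c x y => e.injective <| by
      change φ ((c • x) * y) = φ (c • (x * y))
      rw [map_mul, map_smul, map_smul, map_mul, smul_mul_assoc]
    smul_comm := fun c x y => e.injective <| by
      change φ (c • (x * y)) = φ (x * (c • y))
      rw [map_mul, map_smul, map_smul, map_mul, mul_smul_comm]
    star_smul := fun c x => e.injective <| by
      change φ (star (c • x)) = φ (star c • star x)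
      rw [StarHomClass.map_star, map_smul, map_smul, StarHomClass.map_star, star_smul]
    t2 := (Topology.IsEmbedding.t2Space ⟨⟨rfl⟩, e.injective⟩).t2
    exists_seminorms := LMCStarAlgebra.exists_seminorms_of_inducing φ ⟨rfl⟩ }

/-- The bijection along which a structure is transported, as a *-homomorphism. -/
def LMCStarAlgebra.ofEquivHom {X Z : Type u} [LMCStarAlgebra Z] (e : X ≃ Z) :
    letI := LMCStarAlgebra.ofEquiv e
    LHom X Z :=
  letI := LMCStarAlgebra.ofEquiv e
  ⟨{ toFun := e
     map_smul' := fun _ _ => e.apply_symm_apply _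
     map_zero' := e.apply_symm_apply _
     map_add' := fun _ _ => e.apply_symm_apply _
     map_mul' := fun _ _ => e.apply_symm_apply _
     map_star' := fun _ => e.apply_symm_apply _ }, continuous_induced_dom⟩

open Cardinal in
lemma NonUnitalStarAlgebra.cardinalMk_adjoin_le {B : Type u} [NonUnitalRing B] [StarRing B]
    [Module ℂ B] [IsScalarTower ℂ B B] [SMulCommClass ℂ B B] [StarModule ℂ B] (s : Set B) :
    #(NonUnitalStarAlgebra.adjoin ℂ s) ≤ max (lift.{u} (𝔠 : Cardinal.{0})) #s := by
  -- In the unitization, the known bound for the cardinality of a unital generated algebra applies;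
  -- adding adjoints at most doubles the set of generators.
  set s' : Set (Unitization ℂ B) := Unitization.inr '' (s ∪ star s)
  have h1 : #s' ≤ #s + #s := by
    refine mk_image_le.trans ((mk_union_le _ _).trans (add_le_add le_rfl ?_))
    rw [← Set.image_star]
    exact mk_image_le
  have h2 : ∀ x ∈ NonUnitalStarAlgebra.adjoin ℂ s,
      (x : Unitization ℂ B) ∈ Algebra.adjoin ℂ s' := by
    intro x hx
    rw [← NonUnitalStarSubalgebra.mem_toNonUnitalSubalgebra,
      NonUnitalStarAlgebra.adjoin_toNonUnitalSubalgebra] at hx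
    induction hx using NonUnitalAlgebra.adjoin_induction with
    | mem x hx => exact Algebra.subset_adjoin ⟨x, hx, rfl⟩
    | add x y _ _ hx hy => rw [Unitization.inr_add]; exact add_mem hx hy
    | zero => rw [Unitization.inr_zero]; exact zero_mem _
    | mul x y _ _ hx hy => rw [Unitization.inr_mul]; exact mul_mem hx hy
    | smul c x _ hx => rw [Unitization.inr_smul]; exact SMulMemClass.smul_mem c hx
  have h3 : #(NonUnitalStarAlgebra.adjoin ℂ s) ≤ #(Algebra.adjoin ℂ s') :=
    mk_le_of_injective (f := fun x => ⟨_, h2 x x.2⟩) fun x y h =>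
      Subtype.ext (Unitization.inr_injective (congrArg Subtype.val h))
  have h4 : ℵ₀ ≤ max (lift.{u} (𝔠 : Cardinal.{0})) #s := le_max_of_le_left (by simp [aleph0_le_continuum])
  have h5 := Algebra.lift_cardinalMk_adjoin_le ℂ s'
  simp only [lift_id'.{0, u}, mk_complex] at h5
  refine h3.trans (h5.trans (max_le (max_le (le_max_left _ _) ?_) h4))
  exact h1.trans (add_le_of_le h4 (le_max_right _ _) (le_max_right _ _))

lemma Label.lift_continuum_le (A : Type u) [Nonempty A] :
    Cardinal.lift.{u} Cardinal.continuum.{0} ≤ Cardinal.mk (Label A) := by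
  rw [← Cardinal.mk_complex, ← Cardinal.lift_id'.{0, u} (Cardinal.mk (Label A))]
  exact Cardinal.lift_mk_le_lift_mk_of_injective (f := fun c => ⟨Classical.arbitrary A, c⟩)
    fun c c' h => congrArg Label.snd h

namespace NuTensor

variable {ν : Ordinal.{w}} {A Y : Type u} [LMCStarAlgebra A] [LMCStarAlgebra Y]

lemma mk_setOf_isCoeff_le (f : LHom A (NuTensor ν Y KOp)) :
    Cardinal.mk {z : Y | ∃ i j a, IsCoeff ν (f a) i j z} ≤ Cardinal.mk (Label A) := by
  choose i j a h using fun z : {z : Y | ∃ i j a, IsCoeff ν (f a) i j z} => z.2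
  -- The two indices are stored in one complex number `i + j√-1`. The label determines `z`, because
  -- the coefficient of a given element is unique.
  refine Cardinal.mk_le_of_injective (f := fun z => ⟨a z, ⟨i z, j z⟩⟩) fun z z' hzz' => ?_
  simp only [Label.mk.injEq, Complex.mk.injEq, Nat.cast_inj] at hzz'
  obtain ⟨h1, h2, h3⟩ := hzz'
  have h4 := isCoeff_iff.1 (h z)
  have h5 := isCoeff_iff.1 (h z')
  rw [h1, h2, h3] at h4
  exact Subtype.ext (NuCompletion.ofHom_injective (h4.symm.trans h5))

/-- The algebra generated by the coefficients has at most as many elements as `Label A`, so its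
structure can be transported to a subset of `Label A`. The map `f` lifts to it because the inclusion
induces the topology and all coefficients are in its range. -/
lemma exists_genPair (hν : ν.cof = Cardinal.aleph0) (f : LHom A (NuTensor ν Y KOp))
    (hf : ∀ i j a, ∃ z, IsCoeff ν (f a) i j z) :
    ∃ (d : GenPair ν A) (φ : LHom d.Z Y), (map ν KOp φ).comp d.f = f ∧
      Set.range φ =
        NonUnitalStarAlgebra.adjoin ℂ {z : Y | ∃ i j a, IsCoeff ν (f a) i j z} := by
  set S : Set Y := {z : Y | ∃ i j a, IsCoeff ν (f a) i j z} with hS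
  set T := NonUnitalStarAlgebra.adjoin ℂ S with hT
  have hcard : Cardinal.mk T ≤ Cardinal.mk (Label A) :=
    (NonUnitalStarAlgebra.cardinalMk_adjoin_le S).trans
      (max_le (Label.lift_continuum_le A) (mk_setOf_isCoeff_le f))
  obtain ⟨u⟩ := Cardinal.le_def _ _ |>.1 hcard
  let X : Set (Label A) := Set.range u
  let e : X ≃ T := (Equiv.ofInjective u u.injective).symm
  let _ : LMCStarAlgebra X := LMCStarAlgebra.ofEquiv e
  let incl : LHom T Y := ⟨NonUnitalStarSubalgebraClass.subtype T, continuous_subtype_val⟩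
  let φ : LHom X Y := incl.comp (LMCStarAlgebra.ofEquivHom e)
  have hφ : Topology.IsInducing φ :=
    Topology.IsInducing.subtypeVal.comp (⟨rfl⟩ : Topology.IsInducing e)
  have hφi : Function.Injective φ := Subtype.val_injective.comp e.injective
  have hrange : Set.range φ = T := by
    ext y
    constructor
    · rintro ⟨x, rfl⟩
      exact (e x).2
    · intro hy
      exact ⟨e.symm ⟨y, hy⟩, congrArg Subtype.val (e.apply_symm_apply ⟨y, hy⟩)⟩
  have hmem : ∀ z ∈ S, ∃ x, φ x = z := fun z hz => by
    have : z ∈ Set.range φ := by rw [hrange]; exact NonUnitalStarAlgebra.subset_adjoin ℂ S hz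
    exact this
  have hcoef : ∀ i l a, ∃ x, coeff ν i l (f a) = NuCompletion.ofHom ν Y (φ x) := by
    intro i l a
    obtain ⟨z, hz⟩ := hf i l a
    obtain ⟨x, rfl⟩ := hmem z ⟨i, l, a, hz⟩
    exact ⟨x, isCoeff_iff.1 hz⟩
  obtain ⟨h, hh, hc⟩ := exists_lift_of_inducing hν hφ f hcoef
  have hgen : IsGeneratedBy ν h := by
    refine ⟨fun i l a => ?_, ?_⟩
    · obtain ⟨x, hx⟩ := hcoef i l a
      exact ⟨x, isCoeff_iff.2 (hc i l a x hx)⟩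
    · refine NonUnitalStarAlgebra.eq_top_iff.2 fun x => ?_
      -- Generation is checked in `Y`, where the coefficients of `f` are the images of those of `h`,
      -- and pulled back along the injective `φ`.
      have h1 : T ≤ (NonUnitalStarAlgebra.adjoin ℂ
          {z : X | ∃ i j a, IsCoeff ν (h a) i j z}).map φ.1 := by
        refine NonUnitalStarAlgebra.adjoin_le ?_
        intro z hz
        obtain ⟨x, rfl⟩ := hmem z hz
        obtain ⟨i, l, a, hz⟩ := hz
        exact ⟨x, NonUnitalStarAlgebra.subset_adjoin ℂ _
          ⟨i, l, a, isCoeff_iff.2 (hc i l a x (isCoeff_iff.1 hz))⟩, rfl⟩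
      obtain ⟨x', hx', hxx'⟩ := h1 (show φ x ∈ T from (e x).2)
      rwa [← hφi hxx']
  exact ⟨{ Z := X, f := h, generated := hgen }, φ, hh, hrange⟩

end NuTensor

/-! ### The universal property of the inverse limit -/

section Limit

open NuTensor

variable {ν : Ordinal.{w}} {A : Type u} [LMCStarAlgebra A]

/-- The projection of the inverse limit. -/
def limitProj (d : GenPair ν A) : LHom (limitZ ν A) d.Z :=
  ⟨(LMCStarAlgebra.proj (fun d : GenPair ν A => d.Z) d).comp
    (NonUnitalStarSubalgebraClass.subtype (limitZ ν A)),
    (continuous_apply d).comp continuous_subtype_val⟩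

lemma limitZ_nhds_zero :
    𝓝 (0 : limitZ ν A) = ⨅ d : GenPair ν A, Filter.comap (limitProj d) (𝓝 0) := by
  rw [nhds_subtype, nhds_pi, Filter.pi, Filter.comap_iInf]
  simp only [Filter.comap_comap]
  rfl

/-- Coefficients commute with transition maps and are unique, so those of the `d.f a` form
compatible families, that is, elements of the limit; the maps `d.f` then lift. -/
lemma exists_limitHom (hν : ν.cof = Cardinal.aleph0) :
    ∃ h : LHom A (NuTensor ν (limitZ ν A) KOp),
      (∀ d : GenPair ν A, (map ν KOp (limitProj d)).comp h = d.f) ∧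
      ∀ i j a, ∃ z, IsCoeff ν (h a) i j z := by
  have key : ∀ i j a, ∃ z : limitZ ν A, ∀ d : GenPair ν A,
      coeff ν i j (d.f a) = NuCompletion.ofHom ν d.Z (limitProj d z) := by
    intro i j a
    choose z hz using fun d : GenPair ν A => d.generated.1 i j a
    refine ⟨⟨z, fun d e φ hφ => ?_⟩, fun d => isCoeff_iff.1 (hz d)⟩
    have h1 := coeff_map_of_eq (φ := φ) (isCoeff_iff.1 (hz d))
    have h2 : e.f a = map ν KOp φ (d.f a) := congrArg (fun f : LHom A _ => f a) hφ
    rw [← h2, isCoeff_iff.1 (hz e)] at h1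
    exact (NuCompletion.ofHom_injective h1).symm
  obtain ⟨h, hh, hc⟩ := exists_lift hν limitZ_nhds_zero (fun d : GenPair ν A => d.f) key
  refine ⟨h, hh, fun i j a => ?_⟩
  obtain ⟨z, hz⟩ := key i j a
  exact ⟨z, isCoeff_iff.2 (hc i j a z hz)⟩

variable (A) in
/-- The universal *-homomorphism `A → lim Z_d ⊗ K`. -/
def limitHom (hν : ν.cof = Cardinal.aleph0) : LHom A (NuTensor ν (limitZ ν A) KOp) :=
  (exists_limitHom hν).choose

lemma map_limitProj_comp (hν : ν.cof = Cardinal.aleph0) (d : GenPair ν A) :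
    (map ν KOp (limitProj d)).comp (limitHom A hν) = d.f :=
  (exists_limitHom hν).choose_spec.1 d

lemma exists_isCoeff_limitHom (hν : ν.cof = Cardinal.aleph0) (i j : ℕ) (a : A) :
    ∃ z, IsCoeff ν (limitHom A hν a) i j z :=
  (exists_limitHom hν).choose_spec.2 i j a

/-- The universal map is itself represented by some `d` with a map `ι` from `Z_d` to the limit. For
every `e` the projection to `Z_e` after `ι` is a transition from `d`, so compatibility forces `z = ι
(z_d)`. Thus every element lies in the range of `ι`, which is the algebra generated by the
coefficients. -/
lemma adjoin_limitHom (hν : ν.cof = Cardinal.aleph0) :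
    NonUnitalStarAlgebra.adjoin ℂ
      {z : limitZ ν A | ∃ i j a, IsCoeff ν (limitHom A hν a) i j z} = ⊤ := by
  obtain ⟨d, ι, h1, h2⟩ := exists_genPair hν (limitHom A hν) (exists_isCoeff_limitHom hν)
  refine NonUnitalStarAlgebra.eq_top_iff.2 fun z => ?_
  have hz : ι (z.1 d) = z := by
    refine Subtype.ext (funext fun e => ?_)
    refine z.2 d e ((limitProj e).comp ι) ?_
    rw [GenPair.IsTransition, NuTensor.map_comp, ← map_limitProj_comp hν e]
    change _ = (map ν KOp (limitProj e)).comp ((map ν KOp ι).comp d.f)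
    rw [h1]
  have h3 : ι (z.1 d) ∈ Set.range ι := ⟨_, rfl⟩
  rw [h2, hz] at h3
  exact h3

lemma limitHom_ext (hν : ν.cof = Cardinal.aleph0) {B : Type u} [LMCStarAlgebra B]
    {φ ψ : LHom (limitZ ν A) B}
    (h : (map ν KOp φ).comp (limitHom A hν) = (map ν KOp ψ).comp (limitHom A hν)) : φ = ψ := by
  have key : NonUnitalStarAlgebra.adjoin ℂ
      {z : limitZ ν A | ∃ i j a, IsCoeff ν (limitHom A hν a) i j z} ≤
        NonUnitalStarAlgHom.equalizer φ.1 ψ.1 := NonUnitalStarAlgebra.adjoin_le ?_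
  · rw [adjoin_limitHom] at key
    exact LHom.ext fun z => key (NonUnitalStarAlgebra.mem_top (x := z))
  rintro z ⟨i, j, a, hz⟩
  have h1 := coeff_map_of_eq (φ := φ) (isCoeff_iff.1 hz)
  have h2 := coeff_map_of_eq (φ := ψ) (isCoeff_iff.1 hz)
  have h3 : map ν KOp φ (limitHom A hν a) = map ν KOp ψ (limitHom A hν a) :=
    congrArg (fun f : LHom A _ => f a) h
  rw [← h3, h1] at h2
  exact NuCompletion.ofHom_injective h2

end Limit

/-! ### The adjunction -/

section Adjunction

open NuTensor

variable {ν : Ordinal.{w}} (hν : ν.cof = Cardinal.aleph0)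

section
variable (A : Type u) {B : Type u} [LMCStarAlgebra A] [LMCStarAlgebra B]

/-- The unit of the adjunction. -/
def hatUnit : LHom A (NuTensor ν (NuCompletion ν (contSeminorms (limitZ ν A))) KOp) :=
  (map ν KOp (NuCompletion.ofHom ν (limitZ ν A))).comp (limitHom A hν)

variable {A}

lemma map_comp_hatUnit (φ : LHom (NuCompletion ν (contSeminorms (limitZ ν A))) B) :
    (map ν KOp φ).comp (hatUnit hν A) =
      (map ν KOp (φ.comp (NuCompletion.ofHom ν (limitZ ν A)))).comp (limitHom A hν) := by
  rw [NuTensor.map_comp]; rfl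

lemma map_comp_hatUnit_of_comp_ofHom_eq
    {φ : LHom (NuCompletion ν (contSeminorms (limitZ ν A))) B} {d : GenPair ν A} {g : LHom d.Z B}
    (h : φ.comp (NuCompletion.ofHom ν (limitZ ν A)) = g.comp (limitProj d)) :
    (map ν KOp φ).comp (hatUnit hν A) = (map ν KOp g).comp d.f := by
  rw [map_comp_hatUnit, h, NuTensor.map_comp, ← map_limitProj_comp hν d]; rfl

lemma map_comp_hatUnit_injective : Function.Injective
    fun φ : LHom (NuCompletion ν (contSeminorms (limitZ ν A))) B =>
      (map ν KOp φ).comp (hatUnit hν A) := by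
  intro φ ψ h
  simp only [map_comp_hatUnit] at h
  exact NuCompletion.LHom_ext (limitHom_ext hν h)

/-- A `ν`-complete `B` agrees with its `ν`-completion and hence contains all coefficients of `f`. So
`f` factors through some `Z_d`, and the map `Z_d → B`, composed with the projection of the limit,
extends to the completion. -/
lemma map_comp_hatUnit_surjective (hB : IsNuComplete ν B) : Function.Surjective
    fun φ : LHom (NuCompletion ν (contSeminorms (limitZ ν A))) B =>
      (map ν KOp φ).comp (hatUnit hν A) := by
  intro f
  obtain ⟨d, g, hg, -⟩ := exists_genPair hν f fun i j a =>
    ⟨NuCompletion.retract hν hB (coeff ν i j (f a)),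
      isCoeff_iff.2 (NuCompletion.ofHom_retract hν hB _).symm⟩
  refine ⟨NuCompletion.lift hν hB (g.comp (limitProj d)), ?_⟩
  exact (map_comp_hatUnit_of_comp_ofHom_eq hν (NuCompletion.lift_comp_ofHom hν hB _)).trans hg

end

/-- The bijection `Hom(A ⊗̂ K, B) → Hom(A, B ⊗ K)`. -/
def hatEquiv (A B : NuAlg.{u, w} ν) : (hatK ν A ⟶ B) ≃ (A ⟶ (tensorK ν).obj B) :=
  Equiv.ofBijective (fun φ => (map ν KOp φ).comp (hatUnit hν A.carrier))
    ⟨map_comp_hatUnit_injective hν, map_comp_hatUnit_surjective hν B.complete⟩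

lemma hatEquiv_apply (A B : NuAlg.{u, w} ν) (φ : hatK ν A ⟶ B) :
    hatEquiv hν A B φ = (map ν KOp φ).comp (hatUnit hν A.carrier) := rfl

lemma hatEquiv_naturality (A B B' : NuAlg.{u, w} ν) (β : B ⟶ B') (φ : hatK ν A ⟶ B) :
    hatEquiv hν A B' (φ ≫ β) = hatEquiv hν A B φ ≫ (tensorK ν).map β := by
  rw [hatEquiv_apply, hatEquiv_apply]
  exact congrArg (fun g : LHom _ _ => g.comp (hatUnit hν A.carrier)) (NuTensor.map_comp ν KOp β φ)

end Adjunction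

/-! ### The compact-open topology -/

/-- A filter that does not cluster at `0` contains a set avoiding some neighbourhood of `0`, so it
lives on a finite union of the `C n`, which is compact. -/
lemma LMCStarAlgebra.isCompact_insert_zero_iUnion {Z : Type u} [LMCStarAlgebra Z] {C : ℕ → Set Z}
    (hC : ∀ n, IsCompact (C n)) (h : ∀ U ∈ 𝓝 (0 : Z), ∃ N, ∀ n, N ≤ n → C n ⊆ U) :
    IsCompact (insert 0 (⋃ n, C n)) := by
  intro f hf hle
  by_cases h0 : ClusterPt 0 f
  · exact ⟨0, Set.mem_insert _ _, h0⟩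
  · obtain ⟨U, hU, V, hV, hUV⟩ : ∃ U ∈ 𝓝 (0 : Z), ∃ V ∈ f, Disjoint U V := by
      rw [ClusterPt, Filter.neBot_iff, not_not, ← disjoint_iff, Filter.disjoint_iff] at h0
      exact h0
    obtain ⟨N, hN⟩ := h U hU
    have hK : IsCompact (⋃ n ∈ Finset.range N, C n) :=
      (Finset.range N).isCompact_biUnion fun n _ => hC n
    obtain ⟨x, hx, hxf⟩ := hK (f := f) <| by
      refine Filter.le_principal_iff.2 ?_
      filter_upwards [hV, Filter.le_principal_iff.1 hle] with x hxV hx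
      have hxU : x ∉ U := fun hxU => Set.disjoint_left.1 hUV hxU hxV
      rcases hx with rfl | hx
      · exact absurd (mem_of_mem_nhds hU) hxU
      · obtain ⟨n, hn⟩ := Set.mem_iUnion.1 hx
        refine Set.mem_iUnion₂.2 ⟨n, Finset.mem_range.2 ?_, hn⟩
        by_contra! hNn
        exact hxU (hN n hNn hn)
    obtain ⟨n, -, hn⟩ := Set.mem_iUnion₂.1 hx
    exact ⟨x, Set.mem_insert_of_mem _ (Set.mem_iUnion.2 ⟨n, hn⟩), hxf⟩

lemma LMCStarAlgebra.tendsto_continuousMap_iff {X : Type*} [TopologicalSpace X] {B : Type v}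
    [LMCStarAlgebra B] {T : Type*} {l : Filter T} {F : T → C(X, B)} {f : C(X, B)} :
    Filter.Tendsto F l (𝓝 f) ↔ ∀ K, IsCompact K → ∀ q ∈ contSeminorms B, ∀ ε > 0,
      ∀ᶠ t in l, ∀ x ∈ K, q.toSeminorm (F t x - f x) < ε := by
  let _ : UniformSpace B := IsTopologicalAddGroup.rightUniformSpace B
  rw [ContinuousMap.tendsto_iff_forall_isCompact_tendstoUniformlyOn]
  refine forall₂_congr fun K hK => ⟨fun h q hq ε hε => ?_, fun h U hU => ?_⟩
  · refine h {y | q.toSeminorm (y.2 - y.1) < ε} ?_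
    simp only [sub_eq_add_neg]
    rw [uniformity_eq_comap_nhds_zero']
    exact ⟨{z | q.toSeminorm z < ε}, mem_nhds_zero_iff.2 ⟨q, hq, ε, hε, fun _ => _root_.id⟩,
      subset_rfl⟩
  · rw [uniformity_eq_comap_nhds_zero'] at hU
    obtain ⟨V, hV, hVU⟩ := hU
    obtain ⟨q, hq, ε, hε, hqV⟩ := mem_nhds_zero_iff.1 hV
    filter_upwards [h q hq ε hε] with t ht x hx
    have h1 := ht x hx
    rw [sub_eq_add_neg] at h1
    exact hVU (hqV _ h1)

lemma LHom.tendsto_nhds_iff {A : Type u} {B : Type v} [LMCStarAlgebra A] [LMCStarAlgebra B]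
    {T : Type*} {l : Filter T} {F : T → LHom A B} {f : LHom A B} :
    Filter.Tendsto F l (𝓝 f) ↔ ∀ K, IsCompact K → ∀ q ∈ contSeminorms B, ∀ ε > 0,
      ∀ᶠ t in l, ∀ x ∈ K, q.toSeminorm (F t x - f x) < ε := by
  rw [nhds_induced, Filter.tendsto_comap_iff, LMCStarAlgebra.tendsto_continuousMap_iff]
  rfl

lemma LHom.continuous_comp_right {A : Type u} {B : Type v} {C : Type*} [LMCStarAlgebra A]
    [LMCStarAlgebra B] [LMCStarAlgebra C] (f : LHom A B) :
    Continuous fun g : LHom B C => g.comp f :=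
  continuous_induced_rng.2 <|
    (ContinuousMap.continuous_precomp (Z := C) (⟨f, f.2⟩ : C(A, B))).comp
      (continuous_induced_dom (f := fun g : LHom B C => (⟨g, g.2⟩ : C(B, C))))

/-! ### Powers of positive elements -/

namespace CStarSeminorm

section
variable {E : Type u} [NonUnitalRing E] [StarRing E] [Module ℂ E]

lemma star_starSq_star_mul_self (v : E) (n : ℕ) :
    star (starSq (star v * v) n) = starSq (star v * v) n := by
  cases n <;> simp [starSq]

lemma commute_starSq (v : E) (n : ℕ) : Commute (star v * v) (starSq (star v * v) n) := by
  induction n with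
  | zero => exact Commute.refl _
  | succ n ih =>
    rw [starSq, star_starSq_star_mul_self]
    exact ih.mul_right ih

/-- The element `u = (v* v)^(2^n)` commutes with `v* v`, so `‖v u‖² = ‖v* v u²‖ ≤ ‖v‖ ‖v u²‖`.
Dividing by `‖v‖` carries the bound from `n` to `n + 1`. -/
lemma pow_le_mul_starSq (p : CStarSeminorm E) (v : E) (n : ℕ) :
    p.toSeminorm v ^ (2 ^ (n + 1) + 1) ≤ p.toSeminorm (v * starSq (star v * v) n) := by
  have h0 : 0 ≤ p.toSeminorm v := apply_nonneg _ _
  rcases h0.eq_or_lt with h | hpos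
  · rw [← h, zero_pow (by positivity)]
    exact apply_nonneg _ _
  have hs := p.map_star_mul_self v
  have hb : ∀ x : E, p.toSeminorm (star v * x) ≤ p.toSeminorm v * p.toSeminorm x := fun x => by
    rw [← p.map_star v]; exact p.map_mul_le _ _
  induction n with
  | zero =>
    have h1 := hb (v * (star v * v))
    have h2 := p.map_star_mul_self (star v * v)
    rw [star_mul, star_star, mul_assoc, hs] at h2
    rw [h2] at h1
    simp only [starSq]
    refine le_of_mul_le_mul_left (h1.trans_eq' ?_) hpos
    ring
  | succ n ih =>
    set u := starSq (star v * v) n with hu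
    have hu' : star u = u := star_starSq_star_mul_self v n
    have h1 := p.map_star_mul_self (v * u)
    have e : star (v * u) * (v * u) = star v * (v * (u * u)) := by
      rw [star_mul, hu', mul_assoc, ← mul_assoc (star v), ← mul_assoc u,
        ← (commute_starSq v n).eq, ← hu]
      simp only [mul_assoc]
    rw [e] at h1
    have h2 := hb (v * (u * u))
    rw [h1] at h2
    rw [starSq, ← hu, hu']
    refine le_of_mul_le_mul_left (le_trans ?_ h2) hpos
    calc p.toSeminorm v * p.toSeminorm v ^ (2 ^ (n + 1 + 1) + 1)
        = p.toSeminorm v ^ (2 ^ (n + 1) + 1) * p.toSeminorm v ^ (2 ^ (n + 1) + 1) := by ring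
      _ ≤ _ := mul_le_mul ih ih (by positivity) (apply_nonneg _ _)

end

end CStarSeminorm

/-! ### Estimating tails by diagonal entries of powers. -/

namespace NuTensor

open KOp CStarSeminorm

variable {ν : Ordinal.{w}} {Z B : Type u} [LMCStarAlgebra Z] [LMCStarAlgebra B]

lemma star_leftMul (k : KOp) (w : NuTensor ν Z KOp) :
    star (leftMul ν k w) = rightMul ν (star k) (star w) := by
  rw [← star_star (rightMul ν (star k) (star w)), star_rightMul, star_star, star_star]

lemma map_rightMul (φ : LHom Z B) (k : KOp) (w : NuTensor ν Z KOp) :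
    map ν KOp φ (rightMul ν k w) = rightMul ν k (map ν KOp φ w) :=
  induction_on w (isClosed_eq ((map ν KOp φ).2.comp' (rightMul ν k).continuous)
    ((rightMul ν k).continuous.comp' (map ν KOp φ).2)) fun x => by
      rw [map_of, rightMul_of, rightMul_of, map_of, rightMulK_rTensorHom]

variable (ν) in
/-- The columns of index at least `n`. -/
def tail (n : ℕ) : NuTensor ν Z KOp →L[ℂ] NuTensor ν Z KOp :=
  ContinuousLinearMap.id ℂ _ - rightMul ν (projN n)

lemma tail_apply (n : ℕ) (w : NuTensor ν Z KOp) : tail ν n w = w - rightMul ν (projN n) w := rfl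

lemma map_tail (φ : LHom Z B) (n : ℕ) (w : NuTensor ν Z KOp) :
    map ν KOp φ (tail ν n w) = tail ν n (map ν KOp φ w) := by
  rw [tail_apply, tail_apply, _root_.map_sub, map_rightMul]

lemma tail_succ (n : ℕ) (w : NuTensor ν Z KOp) :
    tail ν n w = tail ν (n + 1) w + rightMul ν (unit n n) w := by
  rw [tail_apply, tail_apply, projN_succ, rightMul_add]; abel

lemma rightMul_unit_tail (n : ℕ) (w : NuTensor ν Z KOp) :
    rightMul ν (unit n n) (tail ν n w) = rightMul ν (unit n n) w := by
  rw [tail_apply, _root_.map_sub, rightMul_rightMul, projN_mul_unit_of_le le_rfl]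
  have h0 : rightMul ν (0 : KOp) w = 0 := by
    have := rightMul_add (ν := ν) 0 0 w
    rw [add_zero] at this
    exact left_eq_add.1 this
  rw [h0, sub_zero]

/-- Taking tails has norm at most two and annihilates truncations. -/
lemma seminorm_tail_le_two_mul (p : contSeminorms Z) (n : ℕ) (w : NuTensor ν Z KOp) :
    (seminorm ν p).toSeminorm (tail ν n w) ≤
      2 * (seminorm ν p).toSeminorm (trunc ν n w - w) := by
  have h0 : tail ν n (trunc ν n w) = 0 := by
    rw [tail_apply, trunc_apply, ← leftMul_rightMul, rightMul_rightMul, projN_mul_self, sub_self]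
  have e : tail ν n w = rightMul ν (projN n) (trunc ν n w - w) - (trunc ν n w - w) := by
    rw [← neg_sub (trunc ν n w - w), ← tail_apply, _root_.map_sub, h0, zero_sub, neg_neg]
  rw [e, two_mul]
  refine (map_sub_le_add (seminorm ν p).toSeminorm _ _).trans (add_le_add ?_ le_rfl)
  exact (seminorm_rightMul_le _ _ _).trans
    (mul_le_of_le_one_left (apply_nonneg _ _) (normK_projN_le n))

lemma exists_forall_seminorm_tail_lt (p : contSeminorms Z) {K : Set (NuTensor ν Z KOp)}
    (hK : IsCompact K) {ε : ℝ} (hε : 0 < ε) :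
    ∃ N, ∀ n, N ≤ n → ∀ w ∈ K, (seminorm ν p).toSeminorm (tail ν n w) < ε := by
  obtain ⟨N, hN⟩ := exists_forall_seminorm_trunc_sub_lt p hK (half_pos hε)
  refine ⟨N, fun n hn w hw => (seminorm_tail_le_two_mul p n w).trans_lt ?_⟩
  linarith [hN n hn w hw]

lemma seminorm_sub_trunc_le (p : contSeminorms Z) (n : ℕ) (w : NuTensor ν Z KOp) :
    (seminorm ν p).toSeminorm (w - trunc ν n w) ≤
      (seminorm ν p).toSeminorm (tail ν n w) + (seminorm ν p).toSeminorm (tail ν n (star w)) := by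
  have e : w - trunc ν n w = tail ν n w + rightMul ν (projN n) (star (tail ν n (star w))) := by
    rw [trunc_apply, leftMul_rightMul, tail_apply, tail_apply, star_sub, star_star, star_rightMul,
      star_star, star_projN, _root_.map_sub]
    abel
  rw [e]
  refine (map_add_le_add (seminorm ν p).toSeminorm _ _).trans (add_le_add le_rfl ?_)
  refine (seminorm_rightMul_le _ _ _).trans
    ((mul_le_of_le_one_left (apply_nonneg _ _) (normK_projN_le n)).trans ?_)
  rw [CStarSeminorm.map_star]

/-- By the C*-identity, the square of the norm of the row `e_nn u` is the norm of `e_nn u² e_nn`,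
and this is a single matrix entry. -/
lemma seminorm_leftMul_unit_sq (p : contSeminorms Z) (n : ℕ) {u : NuTensor ν Z KOp}
    (hu : star u = u) : (seminorm ν p).toSeminorm (leftMul ν (unit n n) u) ^ 2 =
      (NuCompletion.seminorm ν p).toSeminorm (coeff ν n n (u * u)) := by
  rw [← seminorm_tmulUnit p n n, ← leftMul_unit_rightMul_unit, leftMul_rightMul, leftMul_mul, sq,
    ← CStarSeminorm.map_star (seminorm ν p) (leftMul ν (unit n n) u), ← map_star_mul_self,
    star_star, star_leftMul, hu, star_unit, rightMul_mul]

/-- The entry of index `(n, n)` of a high power of `(1 - pₙ) w* w (1 - pₙ)`. -/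
def diagPow (ν : Ordinal.{w}) (n : ℕ) (w : NuTensor ν Z KOp) :
    NuCompletion ν (contSeminorms Z) :=
  coeff ν n n (starSq (star (tail ν n w) * tail ν n w) (n + 1))

lemma mapHom_diagPow (φ : LHom Z B) (n : ℕ) (w : NuTensor ν Z KOp) :
    NuCompletion.mapHom ν φ (diagPow ν n w) = diagPow ν n (map ν KOp φ w) := by
  rw [diagPow, ← coeff_map, map_starSq, map_mul, StarHomClass.map_star, map_tail, diagPow]

lemma continuous_diagPow (n : ℕ) : Continuous (diagPow (Z := Z) ν n) := by
  have h : ∀ k, Continuous fun w : NuTensor ν Z KOp =>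
      starSq (star (tail ν n w) * tail ν n w) k := fun k => by
    induction k with
    | zero => exact (continuous_star.comp' (tail ν n).continuous).mul (tail ν n).continuous
    | succ k ih => exact (continuous_star.comp' ih).mul ih
  exact (coeff ν n n).continuous.comp' (h (n + 1))

lemma seminorm_diagPow_le (p : contSeminorms Z) (n : ℕ) (w : NuTensor ν Z KOp) :
    (NuCompletion.seminorm ν p).toSeminorm (diagPow ν n w) ≤
      (seminorm ν p).toSeminorm (tail ν n w) ^ (2 * 2 ^ (n + 1)) := by
  refine (seminorm_coeff_le p n n _).trans_eq ?_
  rw [starSq_apply, map_star_mul_self, ← sq, pow_mul]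

/-- With `v` the tail and `u = (v* v)^(2^n)`, splitting off column `n` of `v` gives `v u = v' u + v
(e_nn u)`. The norm of `v u` is at least `‖v‖^(2^(n+1)+1)`, that of `u` is `‖v‖^(2^(n+1))`, and that
of `e_nn u` is the square root of the norm of the diagonal entry. Dividing by `‖v‖^(2^(n+1))` gives
the claim; `δ ≤ ‖v‖` is needed to absorb the power of `δ`. -/
lemma seminorm_tail_le_add (p : contSeminorms Z) (n : ℕ) (w : NuTensor ν Z KOp) {δ : ℝ}
    (hδ : 0 < δ) (hw : δ ≤ (seminorm ν p).toSeminorm (tail ν n w))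
    (h : (NuCompletion.seminorm ν p).toSeminorm (diagPow ν n w) ≤
      δ ^ (2 * 2 ^ (n + 1)) / 4 ^ (n + 1)) :
    (seminorm ν p).toSeminorm (tail ν n w) ≤
      (seminorm ν p).toSeminorm (tail ν (n + 1) w) + δ / 2 ^ (n + 1) := by
  set v := tail ν n w with hv
  set v' := tail ν (n + 1) w
  set u := starSq (star v * v) n with hu
  set s := (seminorm ν p).toSeminorm v
  set s' := (seminorm ν p).toSeminorm v'
  have hus : star u = u := star_starSq_star_mul_self v n
  have h1 : s ^ (2 ^ (n + 1) + 1) ≤ (seminorm ν p).toSeminorm (v * u) :=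
    pow_le_mul_starSq (seminorm ν p) v n
  have h2 : (seminorm ν p).toSeminorm (leftMul ν (unit n n) u) ≤ δ ^ 2 ^ (n + 1) / 2 ^ (n + 1) := by
    refine le_of_sq_le_sq ?_ (by positivity)
    rw [seminorm_leftMul_unit_sq p n hus]
    refine (le_trans (le_of_eq ?_) h).trans_eq ?_
    · rw [diagPow, ← hv, starSq, ← hu, hus]
    · rw [div_pow, ← pow_mul, ← pow_mul, mul_comm 2, mul_comm (n + 1), pow_mul 2]
      norm_num
  have e : v * u = v' * u + v * leftMul ν (unit n n) u := by
    rw [← rightMul_mul_eq, hv, rightMul_unit_tail, ← add_mul, ← tail_succ]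
  have h3 : (seminorm ν p).toSeminorm (v * u) ≤
      s' * s ^ 2 ^ (n + 1) + s * (δ ^ 2 ^ (n + 1) / 2 ^ (n + 1)) := by
    rw [e]
    refine (map_add_le_add (seminorm ν p).toSeminorm _ _).trans (add_le_add ?_ ?_)
    · refine ((seminorm ν p).map_mul_le _ _).trans_eq ?_
      rw [hu, starSq_apply, map_star_mul_self, ← sq, ← pow_mul, ← pow_succ']
    · exact ((seminorm ν p).map_mul_le _ _).trans
        (mul_le_mul_of_nonneg_left h2 (apply_nonneg _ _))
  have hs : 0 < s := hδ.trans_le hw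
  -- One of the `2^(n+1)` factors `δ` is kept for the error `δ / 2^(n+1)`; the other `k` are
  -- compared with powers of the norm.
  obtain ⟨k, hk⟩ : ∃ k, 2 ^ (n + 1) = k + 1 := ⟨2 ^ (n + 1) - 1, by
    have := Nat.one_le_two_pow (n := n + 1); omega⟩
  have h4 := h1.trans h3
  rw [hk] at h4
  have h5 : δ ^ k ≤ s ^ k := pow_le_pow_left₀ hδ.le hw k
  have h6 : s * (δ ^ (k + 1) / 2 ^ (n + 1)) ≤ s ^ (k + 1) * (δ / 2 ^ (n + 1)) := by
    have e2 : s * (δ ^ (k + 1) / 2 ^ (n + 1)) = (s * (δ / 2 ^ (n + 1))) * δ ^ k := by ring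
    have e3 : s ^ (k + 1) * (δ / 2 ^ (n + 1)) = (s * (δ / 2 ^ (n + 1))) * s ^ k := by ring
    rw [e2, e3]
    exact mul_le_mul_of_nonneg_left h5 (by positivity)
  refine le_of_mul_le_mul_left ?_ (pow_pos hs (k + 1))
  calc s ^ (k + 1) * s = s ^ (k + 1 + 1) := by ring
    _ ≤ s' * s ^ (k + 1) + s ^ (k + 1) * (δ / 2 ^ (n + 1)) := h4.trans (add_le_add le_rfl h6)
    _ = _ := by ring

/-- If the tail at `m` exceeded `2δ`, then later tails, each losing at most `δ / 2^(n+1)`, would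
stay above `δ`. But the tails of a single element tend to zero. -/
lemma seminorm_tail_le_of_diagPow_le (p : contSeminorms Z) (w : NuTensor ν Z KOp) {δ : ℝ}
    (hδ : 0 < δ) {m : ℕ} (h : ∀ n, m ≤ n → (NuCompletion.seminorm ν p).toSeminorm (diagPow ν n w) ≤
      δ ^ (2 * 2 ^ (n + 1)) / 4 ^ (n + 1)) :
    (seminorm ν p).toSeminorm (tail ν m w) ≤ 2 * δ := by
  by_contra! hlt
  -- The excess over `δ` is allowed to halve at each step, which is exactly the loss permitted by
  -- `seminorm_tail_le_add`; staying above `δ` keeps that lemma applicable.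
  have key : ∀ n, m ≤ n → δ + δ / 2 ^ n ≤ (seminorm ν p).toSeminorm (tail ν n w) := by
    intro n hn
    induction n, hn using Nat.le_induction with
    | base =>
      have : δ / 2 ^ m ≤ δ := div_le_self hδ.le (one_le_pow₀ one_le_two)
      linarith
    | succ n hn ih =>
      have h1 : 0 < δ / 2 ^ n := by positivity
      have h2 := seminorm_tail_le_add p n w hδ (by linarith) (h n hn)
      have h3 : δ / 2 ^ n = δ / 2 ^ (n + 1) + δ / 2 ^ (n + 1) := by rw [pow_succ]; ring
      linarith
  obtain ⟨N, hN⟩ := exists_forall_seminorm_tail_lt p (isCompact_singleton (x := w)) hδ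
  have h1 := hN (max N m) (le_max_left _ _) w rfl
  have h2 := key (max N m) (le_max_right _ _)
  have h3 : 0 < δ / 2 ^ max N m := by positivity
  linarith

end NuTensor

/-! ### Continuity of `φ ↦ φ ⊗ id` in the compact-open topologies. -/

namespace NuTensor

open KOp CStarSeminorm

variable {ν : Ordinal.{w}} {Z B : Type u} [LMCStarAlgebra Z] [LMCStarAlgebra B]

lemma seminorm_trunc_le_sum (p : contSeminorms Z) (n : ℕ) (w : NuTensor ν Z KOp) :
    (seminorm ν p).toSeminorm (trunc ν n w) ≤
      ∑ i ∈ Finset.range n, ∑ j ∈ Finset.range n,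
        (NuCompletion.seminorm ν p).toSeminorm (coeff ν i j w) := by
  rw [trunc_eq_sum]
  refine (Finset.le_sum_of_subadditive _ (map_zero _).le (map_add_le_add _) _ _).trans
    (Finset.sum_le_sum fun i _ => ?_)
  refine (Finset.le_sum_of_subadditive _ (map_zero _).le (map_add_le_add _) _ _).trans
    (Finset.sum_le_sum fun j _ => ?_)
  rw [seminorm_tmulUnit]

/-- The scaling makes the threshold of `seminorm_tail_le_add` equal to `1`. Once the tails on `K`
are below `δ / 4`, the power `2 * 2^(n+1)` gains a factor that beats `4^(n+1)`, so the scaled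
entries still tend to zero uniformly. -/
lemma exists_forall_scaled_diagPow_le (p : contSeminorms Z) {K : Set (NuTensor ν Z KOp)}
    (hK : IsCompact K) {δ ε : ℝ} (hδ : 0 < δ) (hε : 0 < ε) :
    ∃ N, ∀ n, N ≤ n → ∀ w ∈ K, 4 ^ (n + 1) / δ ^ (2 * 2 ^ (n + 1)) *
      (NuCompletion.seminorm ν p).toSeminorm (diagPow ν n w) < ε := by
  obtain ⟨N₁, hN₁⟩ := exists_forall_seminorm_tail_lt p hK (show 0 < δ / 4 by positivity)
  obtain ⟨N₂, hN₂⟩ := exists_pow_lt_of_lt_one hε (show (1 / 4 : ℝ) < 1 by norm_num)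
  refine ⟨max N₁ N₂, fun n hn w hw => ?_⟩
  have h1 := (hN₁ n (le_of_max_le_left hn) w hw).le
  have h2 : (NuCompletion.seminorm ν p).toSeminorm (diagPow ν n w) ≤
      (δ / 4) ^ (2 * 2 ^ (n + 1)) :=
    (seminorm_diagPow_le p n w).trans (pow_le_pow_left₀ (apply_nonneg _ _) h1 _)
  have h3 : 2 * (n + 1) ≤ 2 * 2 ^ (n + 1) := by
    have := (Nat.lt_two_pow_self (n := n + 1)).le
    omega
  calc 4 ^ (n + 1) / δ ^ (2 * 2 ^ (n + 1)) *
      (NuCompletion.seminorm ν p).toSeminorm (diagPow ν n w)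
      ≤ 4 ^ (n + 1) / δ ^ (2 * 2 ^ (n + 1)) * (δ / 4) ^ (2 * 2 ^ (n + 1)) :=
        mul_le_mul_of_nonneg_left h2 (by positivity)
    _ = 4 ^ (n + 1) * (1 / 4) ^ (2 * 2 ^ (n + 1)) := by
        rw [div_eq_mul_one_div δ 4, mul_pow]; field_simp
    _ ≤ 4 ^ (n + 1) * (1 / 4) ^ (2 * (n + 1)) :=
        mul_le_mul_of_nonneg_left (pow_le_pow_of_le_one (by norm_num) (by norm_num) h3)
          (by positivity)
    _ = (1 / 4) ^ (n + 1) := by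
        rw [two_mul, pow_add (1 / 4 : ℝ) (n + 1) (n + 1), ← mul_assoc, ← mul_pow]; norm_num
    _ ≤ (1 / 4) ^ N₂ := pow_le_pow_of_le_one (by norm_num) (by norm_num)
        ((le_of_max_le_right hn).trans n.le_succ)
    _ < ε := hN₂

lemma seminorm_retract (hν : ν.cof = Cardinal.aleph0) (hZ : IsNuComplete ν Z) (φ : LHom Z B)
    (q : contSeminorms B) (x : NuCompletion ν (contSeminorms Z)) :
    q.1.toSeminorm (φ (NuCompletion.retract hν hZ x)) =
      (NuCompletion.seminorm ν q).toSeminorm (NuCompletion.mapHom ν φ x) := by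
  conv_rhs => rw [← NuCompletion.ofHom_retract hν hZ x, NuCompletion.mapHom_ofHom,
    NuCompletion.ofHom_apply, NuCompletion.seminorm_of]

/-- The rescaled diagonal entries of elements of `K`, together with `0`, form a compact subset of
`Z`. A map `ψ` close to `φ` on this one set satisfies the diagonal bounds for all large indices
simultaneously, which controls its tails. -/
lemma exists_eventually_seminorm_tail_le (hν : ν.cof = Cardinal.aleph0) (hZ : IsNuComplete ν Z)
    (φ : LHom Z B) (q : contSeminorms B) {K : Set (NuTensor ν Z KOp)} (hK : IsCompact K) {δ : ℝ}
    (hδ : 0 < δ) : ∃ m, ∀ n, m ≤ n → ∀ᶠ ψ in 𝓝 φ, ∀ w ∈ K,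
      (seminorm ν q).toSeminorm (tail ν n (map ν KOp ψ w)) ≤ 2 * δ := by
  set c : ℕ → ℝ := fun n => 4 ^ (n + 1) / δ ^ (2 * 2 ^ (n + 1)) with hc
  have hc0 : ∀ n, 0 < c n := fun n => by positivity
  set z : ℕ → NuTensor ν Z KOp → Z := fun n w =>
    (c n : ℂ) • NuCompletion.retract hν hZ (diagPow ν n w) with hz
  have hzc : ∀ n, Continuous (z n) := fun n =>
    ((NuCompletion.retract hν hZ).2.comp (continuous_diagPow n)).const_smul (c n : ℂ)
  have hzψ : ∀ (ψ : LHom Z B) n w, q.1.toSeminorm (ψ (z n w)) =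
      c n * (NuCompletion.seminorm ν q).toSeminorm (diagPow ν n (map ν KOp ψ w)) := by
    intro ψ n w
    rw [hz, map_smul, map_smul_eq_mul, seminorm_retract, mapHom_diagPow, Complex.norm_real,
      Real.norm_of_nonneg (hc0 n).le]
  have hK' : IsCompact (insert 0 (⋃ n, z n '' K)) := by
    refine LMCStarAlgebra.isCompact_insert_zero_iUnion (fun n => hK.image (hzc n)) fun U hU => ?_
    obtain ⟨p, hp, ε, hε, hpU⟩ := LMCStarAlgebra.mem_nhds_zero_iff.1 hU
    obtain ⟨N, hN⟩ := exists_forall_scaled_diagPow_le ⟨p, hp⟩ hK hδ hε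
    refine ⟨N, fun n hn => ?_⟩
    rintro _ ⟨w, hw, rfl⟩
    refine hpU _ ((le_of_eq ?_).trans_lt (hN n hn w hw))
    rw [map_smul_eq_mul, Complex.norm_real, Real.norm_of_nonneg (hc0 n).le]
    congr 1
    exact (NuCompletion.seminorm_of (ν := ν) (⟨p, hp⟩ : contSeminorms Z) _).symm.trans
      (congrArg _ (NuCompletion.ofHom_retract hν hZ _))
  -- From `m` on the values of `φ` are below `1/2`; if `ψ` differs from `φ` by less than `1/2`, its
  -- values stay below the threshold `1`.
  obtain ⟨m, hm⟩ := exists_forall_scaled_diagPow_le (φ.comapSeminorm q) hK hδ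
    (show (0 : ℝ) < 1 / 2 by norm_num)
  have hm' : ∀ n, m ≤ n → ∀ w ∈ K, q.1.toSeminorm (φ (z n w)) < 1 / 2 := by
    intro n hn w hw
    refine (le_of_eq ?_).trans_lt (hm n hn w hw)
    rw [hz, map_smul, map_smul_eq_mul, Complex.norm_real, Real.norm_of_nonneg (hc0 n).le]
    congr 1
    exact (NuCompletion.seminorm_of (ν := ν) (φ.comapSeminorm q) _).symm.trans
      (congrArg _ (NuCompletion.ofHom_retract hν hZ _))
  have hev := LHom.tendsto_nhds_iff.1 (Filter.tendsto_id (x := 𝓝 φ)) _ hK' q.1 q.2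
    (1 / 2) (by norm_num)
  refine ⟨m, fun n hn => hev.mono fun ψ hψ w hw => ?_⟩
  refine seminorm_tail_le_of_diagPow_le q _ hδ fun k hk => ?_
  have h1 := hψ (z k w) (Set.mem_insert_of_mem _ (Set.mem_iUnion.2 ⟨k, w, hw, rfl⟩))
  have h2 := hm' k (hn.trans hk) w hw
  have h3 := map_add_le_add q.1.toSeminorm (ψ (z k w) - φ (z k w)) (φ (z k w))
  rw [sub_add_cancel, hzψ] at h3
  have h4 : c k * (NuCompletion.seminorm ν q).toSeminorm (diagPow ν k (map ν KOp ψ w)) ≤ 1 := by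
    have h1' : q.1.toSeminorm (ψ (z k w) - φ (z k w)) < 1 / 2 := h1
    linarith
  rw [hc, div_mul_eq_mul_div, div_le_one (by positivity)] at h4
  rw [le_div_iff₀ (by positivity), mul_comm]
  exact h4

lemma continuous_map (hν : ν.cof = Cardinal.aleph0) (hZ : IsNuComplete ν Z) :
    Continuous fun φ : LHom Z B => map ν KOp φ := by
  refine continuous_iff_continuousAt.2 fun φ => LHom.tendsto_nhds_iff.2 fun K hK Q hQ ε hε => ?_
  obtain ⟨q, hq⟩ := exists_le_seminorm hQ
  obtain ⟨m₁, hm₁⟩ := exists_eventually_seminorm_tail_le hν hZ φ q hK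
    (show 0 < ε / 16 by positivity)
  -- Tails only see columns. Rows are treated as columns of adjoints, hence the second application
  -- to the set of adjoints.
  obtain ⟨m₂, hm₂⟩ := exists_eventually_seminorm_tail_le hν hZ φ q (hK.image continuous_star)
    (show 0 < ε / 16 by positivity)
  set n := max m₁ m₂
  have h1 := hm₁ n (le_max_left _ _)
  have h2 := hm₂ n (le_max_right _ _)
  have hsub : ∀ ψ : LHom Z B, (∀ w ∈ K, (seminorm ν q).toSeminorm (tail ν n (map ν KOp ψ w)) ≤
        2 * (ε / 16)) → (∀ w ∈ star '' K, (seminorm ν q).toSeminorm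
          (tail ν n (map ν KOp ψ w)) ≤ 2 * (ε / 16)) → ∀ w ∈ K,
        (seminorm ν q).toSeminorm (map ν KOp ψ w - trunc ν n (map ν KOp ψ w)) ≤ ε / 4 := by
    intro ψ h1 h2 w hw
    refine (seminorm_sub_trunc_le q n _).trans ?_
    have h3 := h1 w hw
    have h4 := h2 (star w) ⟨w, hw, rfl⟩
    rw [StarHomClass.map_star] at h4
    linarith
  set z : ℕ → ℕ → NuTensor ν Z KOp → Z := fun i j w =>
    NuCompletion.retract hν hZ (coeff ν i j w)
  have hzc : ∀ i j, Continuous (z i j) := fun i j =>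
    (NuCompletion.retract hν hZ).2.comp (coeff ν i j).continuous
  -- The corner has `n²` entries, which together contribute at most `ε / 4`; the added `1` keeps the
  -- denominator positive for `n = 0`. With the two tail errors the total is at most `3ε / 4`.
  have h3 : ∀ᶠ ψ : LHom Z B in 𝓝 φ, ∀ i ∈ Finset.range n, ∀ j ∈ Finset.range n, ∀ w ∈ K,
      q.1.toSeminorm (ψ (z i j w) - φ (z i j w)) < ε / (4 * (n * n + 1)) := by
    refine (Filter.eventually_all_finset _).2 fun i _ => (Filter.eventually_all_finset _).2
      fun j _ => ?_
    refine (LHom.tendsto_nhds_iff.1 (Filter.tendsto_id (x := 𝓝 φ)) _ (hK.image (hzc i j)) q.1 q.2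
      (ε / (4 * (n * n + 1))) (by positivity)).mono fun ψ h w hw => h _ ⟨w, hw, rfl⟩
  filter_upwards [h1, h2, h3] with ψ h1ψ h2ψ h3ψ w hw
  refine (hq _).trans_lt ?_
  have h4 := hsub ψ h1ψ h2ψ w hw
  -- A property that holds eventually near `φ` holds at `φ`, so the same tail bound is available for
  -- `φ`.
  have h5 := hsub φ h1.self_of_nhds h2.self_of_nhds w hw
  have h6 : (seminorm ν q).toSeminorm (trunc ν n (map ν KOp ψ w - map ν KOp φ w)) ≤ ε / 4 := by
    refine (seminorm_trunc_le_sum q n _).trans ?_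
    have h7 : ∀ i ∈ Finset.range n, ∀ j ∈ Finset.range n, (NuCompletion.seminorm ν q).toSeminorm
        (coeff ν i j (map ν KOp ψ w - map ν KOp φ w)) ≤ ε / (4 * (n * n + 1)) := by
      intro i hi j hj
      refine (le_of_eq ?_).trans (h3ψ i hi j hj w hw).le
      have e : ∀ χ : LHom Z B,
          coeff ν i j (map ν KOp χ w) = NuCompletion.ofHom ν B (χ (z i j w)) := fun χ =>
        coeff_map_of_eq (NuCompletion.ofHom_retract hν hZ _).symm
      rw [_root_.map_sub, e, e, ← _root_.map_sub, NuCompletion.ofHom_apply,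
        NuCompletion.seminorm_of]
    refine (Finset.sum_le_sum fun i hi => Finset.sum_le_sum fun j hj => h7 i hi j hj).trans ?_
    rw [Finset.sum_const, Finset.sum_const, Finset.card_range, nsmul_eq_mul, nsmul_eq_mul,
      ← mul_assoc, mul_div_assoc', div_le_div_iff₀ (by positivity) (by norm_num)]
    nlinarith
  have e : map ν KOp ψ w - map ν KOp φ w = ((map ν KOp ψ w - trunc ν n (map ν KOp ψ w)) -
      (map ν KOp φ w - trunc ν n (map ν KOp φ w))) +
        trunc ν n (map ν KOp ψ w - map ν KOp φ w) := by
    rw [_root_.map_sub]; abel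
  rw [e]
  refine (map_add_le_add (seminorm ν q).toSeminorm _ _).trans_lt ?_
  have h8 := map_sub_le_add (seminorm ν q).toSeminorm
    (map ν KOp ψ w - trunc ν n (map ν KOp ψ w)) (map ν KOp φ w - trunc ν n (map ν KOp φ w))
  linarith

end NuTensor

/-! ### The algebra of continuous paths -/

section Path

variable {B : Type u} [LMCStarAlgebra B]

/-- The evaluation of paths. -/
def pathEval (B : Type u) [LMCStarAlgebra B] (t : unitInterval) : C(unitInterval, B) →⋆ₙₐ[ℂ] B where
  toFun f := f t
  map_smul' _ _ := rfl
  map_zero' := rfl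
  map_add' _ _ := rfl
  map_mul' _ _ := rfl
  map_star' _ := rfl

lemma bddAbove_range_pathEval {q : CStarSeminorm B} (hq : q ∈ contSeminorms B)
    (f : C(unitInterval, B)) :
    BddAbove (Set.range fun t => (q.comap (pathEval B t)).toSeminorm f) :=
  (isCompact_range (Continuous.comp hq f.continuous)).bddAbove

/-- The C*-seminorm `f ↦ sup_t q (f t)`. -/
def pathSeminorm (q : contSeminorms B) : CStarSeminorm C(unitInterval, B) :=
  CStarSeminorm.iSup (fun t => q.1.comap (pathEval B t)) (bddAbove_range_pathEval q.2)

lemma le_pathSeminorm (q : contSeminorms B) (f : C(unitInterval, B)) (t : unitInterval) :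
    q.1.toSeminorm (f t) ≤ (pathSeminorm q).toSeminorm f :=
  CStarSeminorm.le_iSup (fun t => q.1.comap (pathEval B t)) (bddAbove_range_pathEval q.2) t f

lemma pathSeminorm_le {q : contSeminorms B} {f : C(unitInterval, B)} {C : ℝ} (hC : 0 ≤ C)
    (h : ∀ t, q.1.toSeminorm (f t) ≤ C) : (pathSeminorm q).toSeminorm f ≤ C :=
  CStarSeminorm.iSup_le hC h

lemma path_mem_nhds_zero_iff {U : Set C(unitInterval, B)} : U ∈ 𝓝 (0 : C(unitInterval, B)) ↔
    ∃ q : contSeminorms B, ∃ ε > 0, ∀ f, (pathSeminorm q).toSeminorm f < ε → f ∈ U := by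
  constructor
  · intro hU
    let _ : UniformSpace B := IsTopologicalAddGroup.rightUniformSpace B
    obtain ⟨V, hV, hVU⟩ := (nhds_basis_uniformity'
      (ContinuousMap.hasBasis_compactConvergenceUniformity_of_compact
        (α := unitInterval) (β := B))).mem_iff.1 hU
    rw [uniformity_eq_comap_nhds_zero'] at hV
    obtain ⟨W, hW, hWV⟩ := hV
    obtain ⟨q, hq, ε, hε, hqW⟩ := LMCStarAlgebra.mem_nhds_zero_iff.1 hW
    refine ⟨⟨q, hq⟩, ε, hε, fun f hf => hVU fun t => hWV ?_⟩
    refine hqW _ ?_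
    change q.toSeminorm (f t + -0) < ε
    rw [neg_zero, add_zero]
    exact (le_pathSeminorm ⟨q, hq⟩ f t).trans_lt hf
  · rintro ⟨q, ε, hε, h⟩
    have h1 := LMCStarAlgebra.tendsto_continuousMap_iff.1
      (Filter.tendsto_id (x := 𝓝 (0 : C(unitInterval, B)))) Set.univ isCompact_univ q.1 q.2
      (ε / 2) (by positivity)
    refine Filter.mem_of_superset h1 fun f hf => h f ?_
    refine (pathSeminorm_le (by positivity : 0 ≤ ε / 2) fun t => ?_).trans_lt (half_lt_self hε)
    have h2 := hf t trivial
    change q.1.toSeminorm (f t - 0) < _ at h2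
    rw [sub_zero] at h2
    exact h2.le

instance : LMCStarAlgebra C(unitInterval, B) where
  exists_seminorms := by
    refine ⟨contSeminorms B, pathSeminorm,
      (SeminormFamily.withSeminorms_iff_nhds_eq_iInf _).2 (le_antisymm ?_ ?_)⟩
    · refine le_iInf fun q => Filter.tendsto_iff_comap.1 ?_
      rw [Metric.tendsto_nhds]
      intro ε hε
      refine path_mem_nhds_zero_iff.2 ⟨q, ε, hε, fun f hf => ?_⟩
      rw [Set.mem_ofPred_eq, Real.dist_0_eq_abs, abs_of_nonneg (apply_nonneg _ _)]
      exact hf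
    · intro U hU
      obtain ⟨q, ε, hε, h⟩ := path_mem_nhds_zero_iff.1 hU
      refine Filter.mem_iInf_of_mem q ⟨Set.Iio ε, Iio_mem_nhds hε, fun f hf => h f hf⟩

lemma pathSeminorm_mem (q : contSeminorms B) :
    pathSeminorm q ∈ contSeminorms C(unitInterval, B) := by
  refine Seminorm.continuous' (r := 1) ?_
  refine path_mem_nhds_zero_iff.2 ⟨q, 1, one_pos, fun f hf => ?_⟩
  rw [Seminorm.mem_closedBall_zero]
  exact hf.le

lemma exists_le_pathSeminorm {P : CStarSeminorm C(unitInterval, B)}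
    (hP : P ∈ contSeminorms C(unitInterval, B)) :
    ∃ q : contSeminorms B, ∀ f, P.toSeminorm f ≤ (pathSeminorm q).toSeminorm f := by
  have hU : {f | P.toSeminorm f < 1} ∈ 𝓝 (0 : C(unitInterval, B)) :=
    (isOpen_lt (hP : Continuous P.toSeminorm) continuous_const).mem_nhds (by simp)
  obtain ⟨q, ε, hε, h⟩ := path_mem_nhds_zero_iff.1 hU
  exact ⟨q, CStarSeminorm.le_of_lt_imp_lt hε h⟩

variable (B) in
/-- The evaluation of paths, as a continuous *-homomorphism. -/
def pathEvalHom (t : unitInterval) : LHom C(unitInterval, B) B :=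
  ⟨pathEval B t, continuous_eval_const t⟩

lemma continuous_pathEvalHom : Continuous (pathEvalHom B) :=
  continuous_induced_rng.2 (ContinuousMap.curry
    ⟨fun x : unitInterval × C(unitInterval, B) => x.2 x.1,
      continuous_eval.comp continuous_swap⟩).continuous

/-- A Cauchy `ν`-sequence of paths is uniformly Cauchy. Its pointwise limits exist in `B`, the
convergence is uniform, and so the limit is continuous. -/
lemma isNuComplete_path {ν : Ordinal.{w}} (hν : ν.cof = Cardinal.aleph0)
    (hB : IsNuComplete ν B) : IsNuComplete ν C(unitInterval, B) := by
  intro x hx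
  have hne := (Ordinal.exists_tendsto_nat_of_cof_eq_aleph0 hν).1
  rw [isNuCauchy_iff] at hx
  have hx' : ∀ q : contSeminorms B, ∀ ε > 0, ∃ γ : Set.Iio ν, ∀ α β : Set.Iio ν,
      γ ≤ α → γ ≤ β → ∀ t, q.1.toSeminorm (x α t - x β t) < ε := fun q ε hε => by
    obtain ⟨γ, hγ⟩ := hx _ (pathSeminorm_mem q) ε hε
    exact ⟨γ, fun α β hα hβ t =>
      (le_pathSeminorm q (x α - x β) t).trans_lt (hγ α β hα hβ)⟩
  choose g hg using fun t => hB (fun α => x α t) (isNuCauchy_iff.2 fun q hq ε hε => by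
    obtain ⟨γ, hγ⟩ := hx' ⟨q, hq⟩ ε hε
    exact ⟨γ, fun α β hα hβ => hγ α β hα hβ t⟩)
  have hu : ∀ q : contSeminorms B, ∀ ε > 0, ∃ γ : Set.Iio ν, ∀ α, γ ≤ α →
      ∀ t, q.1.toSeminorm (x α t - g t) ≤ ε := fun q ε hε => by
    obtain ⟨γ, hγ⟩ := hx' q ε hε
    refine ⟨γ, fun α hα t => ?_⟩
    have hq : Continuous fun b => q.1.toSeminorm (x α t - b) :=
      Continuous.comp q.2 (continuous_const.sub continuous_id)
    refine le_of_tendsto ((hq.tendsto _).comp (hg t)) ?_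
    filter_upwards [Filter.eventually_ge_atTop γ] with β hβ using (hγ α β hα hβ t).le
  have hgc : Continuous g := by
    refine continuous_iff_continuousAt.2 fun t => LMCStarAlgebra.tendsto_nhds_iff.2 fun q hq => ?_
    refine Metric.tendsto_nhds.2 fun ε hε => ?_
    obtain ⟨γ, hγ⟩ := hu ⟨q, hq⟩ (ε / 4) (by positivity)
    have h1 := (LMCStarAlgebra.tendsto_nhds_iff.1 ((x γ).continuous.tendsto t) q hq).eventually
      (gt_mem_nhds (show 0 < ε / 4 by positivity))
    filter_upwards [h1] with s hs
    rw [Real.dist_0_eq_abs, abs_of_nonneg (apply_nonneg _ _)]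
    have e : g s - g t = (x γ s - x γ t) - (x γ s - g s) + (x γ t - g t) := by abel
    rw [e]
    have h2 := map_add_le_add q.toSeminorm ((x γ s - x γ t) - (x γ s - g s)) (x γ t - g t)
    have h3 := map_sub_le_add q.toSeminorm (x γ s - x γ t) (x γ s - g s)
    have h4 : q.toSeminorm (x γ s - g s) ≤ ε / 4 := hγ γ le_rfl s
    have h5 : q.toSeminorm (x γ t - g t) ≤ ε / 4 := hγ γ le_rfl t
    linarith
  refine ⟨⟨g, hgc⟩, LMCStarAlgebra.tendsto_continuousMap_iff.2 fun K _ q hq ε hε => ?_⟩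
  obtain ⟨γ, hγ⟩ := hu ⟨q, hq⟩ (ε / 2) (by positivity)
  filter_upwards [Filter.eventually_ge_atTop γ] with α hα t _
  exact (hγ α hα t).trans_lt (half_lt_self hε)

/-- Homotopies become morphisms to an algebra, so the bijection of the adjunction can be applied
with `C([0,1], B)` in place of `B`. -/
lemma LHom.homotopic_iff {A : Type v} [LMCStarAlgebra A] {f g : LHom A B} :
    f.Homotopic g ↔ ∃ H : LHom A C(unitInterval, B),
      (pathEvalHom B 0).comp H = f ∧ (pathEvalHom B 1).comp H = g := by
  constructor
  · rintro ⟨H, hc, hH, h0, h1⟩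
    choose h hh using hH
    refine ⟨⟨{ toFun := H
               map_smul' := fun c a => ContinuousMap.ext fun t => ?_
               map_zero' := ContinuousMap.ext fun t => ?_
               map_add' := fun a b => ContinuousMap.ext fun t => ?_
               map_mul' := fun a b => ContinuousMap.ext fun t => ?_
               map_star' := fun a => ContinuousMap.ext fun t => ?_ }, hc⟩,
      LHom.ext h0, LHom.ext h1⟩
    · exact (hh t _).trans ((map_smul (h t).1 c a).trans (congrArg (c • ·) (hh t a).symm))
    · exact (hh t _).trans (map_zero (h t).1)
    · exact (hh t _).trans ((map_add (h t).1 a b).trans (by rw [← hh, ← hh]; rfl))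
    · exact (hh t _).trans ((map_mul (h t).1 a b).trans (by rw [← hh, ← hh]; rfl))
    · exact (hh t _).trans ((StarHomClass.map_star (h t).1 a).trans (by rw [← hh]; rfl))
  · rintro ⟨H, rfl, rfl⟩
    exact ⟨H, H.2, fun t => ⟨(pathEvalHom B t).comp H, fun _ => rfl⟩, fun _ => rfl, fun _ => rfl⟩

end Path

/-! ### Comparison of `C([0,1], B) ⊗ K` with `C([0,1], B ⊗ K)`. -/

namespace NuTensor

open KOp CStarSeminorm

variable {ν : Ordinal.{w}} {A : Type v} {B : Type u} [LMCStarAlgebra A] [LMCStarAlgebra B]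

lemma isSupOn_pathEvalHom (q : contSeminorms B) :
    IsSupOn (pathEvalHom B) (fun _ => q) Set.univ ⟨pathSeminorm q, pathSeminorm_mem q⟩ :=
  ⟨fun t _ f => le_pathSeminorm q f t, fun _ _ hC h => pathSeminorm_le hC fun t => h t trivial⟩

/-- An element of `C([0,1], B) ⊗ K` defines a path in `B ⊗ K`. -/
lemma exists_path_map (hν : ν.cof = Cardinal.aleph0) (hB : IsNuComplete ν B)
    (F : LHom A (NuTensor ν C(unitInterval, B) KOp)) :
    ∃ H : LHom A C(unitInterval, NuTensor ν B KOp),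
      ∀ t, (pathEvalHom _ t).comp H = (map ν KOp (pathEvalHom B t)).comp F := by
  -- Continuity of the resulting paths in `t` follows from continuity of `φ ↦ φ ⊗ id`, since
  -- evaluation depends continuously on `t`.
  have hmap : Continuous fun t => map ν KOp (pathEvalHom B t) :=
    (continuous_map hν (isNuComplete_path hν hB)).comp continuous_pathEvalHom
  have heval : ∀ w : NuTensor ν C(unitInterval, B) KOp,
      Continuous fun t => map ν KOp (pathEvalHom B t) w := fun w =>
    (continuous_eval_const (F := C(NuTensor ν C(unitInterval, B) KOp, NuTensor ν B KOp)) w).comp (continuous_induced_dom.comp hmap)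
  refine ⟨⟨{ toFun := fun a => ⟨fun t => map ν KOp (pathEvalHom B t) (F a), heval _⟩
             map_smul' := fun c a => ContinuousMap.ext fun t =>
              (congrArg _ (map_smul F.1 c a)).trans (map_smul (map ν KOp (pathEvalHom B t)).1 c _)
             map_zero' := ContinuousMap.ext fun t =>
              (congrArg _ (map_zero F.1)).trans (map_zero (map ν KOp (pathEvalHom B t)).1)
             map_add' := fun a b => ContinuousMap.ext fun t =>
              (congrArg _ (map_add F.1 a b)).trans (map_add (map ν KOp (pathEvalHom B t)).1 _ _)
             map_mul' := fun a b => ContinuousMap.ext fun t =>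
              (congrArg _ (map_mul F.1 a b)).trans (map_mul (map ν KOp (pathEvalHom B t)).1 _ _)
             map_star' := fun a => ContinuousMap.ext fun t =>
              (congrArg _ (StarHomClass.map_star F.1 a)).trans
                (StarHomClass.map_star (map ν KOp (pathEvalHom B t)).1 _) }, ?_⟩, fun t => rfl⟩
  refine LMCStarAlgebra.continuous_of_forall _ fun P hP => ?_
  obtain ⟨Q, hQ⟩ := exists_le_pathSeminorm hP
  obtain ⟨q, hq⟩ := exists_le_seminorm Q.2
  refine ⟨_, (F.comapSeminorm ⟨_, seminorm_mem ν ⟨_, pathSeminorm_mem q⟩⟩).2, fun a => ?_⟩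
  refine (hQ _).trans (pathSeminorm_le (apply_nonneg _ _) fun t => (hq _).trans ?_)
  exact (isSupOn_pathEvalHom q).seminorm_map_le (Set.mem_univ t) (F a)

/-- The evaluations at all `t` form an infinite family, so the general lifting principle is needed.
Truncations converge uniformly in `t` because the path `H a` has compact image, and the coefficients
of the path are continuous paths in the `ν`-complete `B`. -/
lemma exists_map_path (hν : ν.cof = Cardinal.aleph0) (hB : IsNuComplete ν B)
    (H : LHom A C(unitInterval, NuTensor ν B KOp)) :
    ∃ F : LHom A (NuTensor ν C(unitInterval, B) KOp),
      ∀ t, (map ν KOp (pathEvalHom B t)).comp F = (pathEvalHom _ t).comp H := by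
  refine (exists_lift_of_isSupOn hν (φ := pathEvalHom B)
    (fun t => (pathEvalHom _ t).comp H) (fun p₀ hp₀ => ?_) fun i l a => ?_).imp fun F hF => hF.1
  · obtain ⟨q, hq⟩ := exists_le_pathSeminorm hp₀
    refine ⟨_, _, _, hq, isSupOn_pathEvalHom q, fun a ε hε => ?_,
      _, (H.comapSeminorm ⟨_, pathSeminorm_mem ⟨_, seminorm_mem ν q⟩⟩).2, fun a t _ => ?_⟩
    · obtain ⟨N, hN⟩ := exists_forall_seminorm_trunc_sub_lt q (isCompact_range (H a).continuous) hε
      exact ⟨N, fun n hn t _ => hN n hn _ ⟨t, rfl⟩⟩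
    · exact le_pathSeminorm ⟨_, seminorm_mem ν q⟩ (H a) t
  · refine ⟨⟨fun t => NuCompletion.retract hν hB (coeff ν i l (H a t)),
      (NuCompletion.retract hν hB).2.comp ((coeff ν i l).continuous.comp (H a).continuous)⟩,
      fun t => (NuCompletion.ofHom_retract hν hB _).symm⟩

end NuTensor

section Homotopy

open NuTensor

variable {ν : Ordinal.{w}} (hν : ν.cof = Cardinal.aleph0) {A B : Type u} [LMCStarAlgebra A]
  [LMCStarAlgebra B]

/-- A homotopy on the right corresponds to a morphism to `C([0,1], B)`, one on the left to a
morphism to `C([0,1], B) ⊗ K`; surjectivity matches the two, and injectivity identifies the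
endpoints. -/
lemma homotopic_map_comp_hatUnit_iff (hB : IsNuComplete ν B)
    {φ ψ : LHom (NuCompletion ν (contSeminorms (limitZ ν A))) B} :
    ((map ν KOp φ).comp (hatUnit hν A)).Homotopic ((map ν KOp ψ).comp (hatUnit hν A)) ↔
      φ.Homotopic ψ := by
  rw [LHom.homotopic_iff, LHom.homotopic_iff]
  constructor
  · rintro ⟨H, h0, h1⟩
    obtain ⟨F, hF⟩ := exists_map_path hν hB H
    obtain ⟨G, rfl⟩ := map_comp_hatUnit_surjective hν (isNuComplete_path hν hB) F
    refine ⟨G, map_comp_hatUnit_injective hν ?_, map_comp_hatUnit_injective hν ?_⟩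
    · refine Eq.trans ?_ ((hF 0).trans h0)
      exact congrArg (fun g : LHom _ _ => g.comp (hatUnit hν A)) (NuTensor.map_comp ν KOp _ G)
    · refine Eq.trans ?_ ((hF 1).trans h1)
      exact congrArg (fun g : LHom _ _ => g.comp (hatUnit hν A)) (NuTensor.map_comp ν KOp _ G)
  · rintro ⟨G, rfl, rfl⟩
    obtain ⟨H, hH⟩ := exists_path_map hν hB ((map ν KOp G).comp (hatUnit hν A))
    refine ⟨H, (hH 0).trans ?_, (hH 1).trans ?_⟩ <;> rw [NuTensor.map_comp] <;> rfl

end Homotopy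

lemma continuous_hatEquiv {ν : Ordinal.{w}} (hν : ν.cof = Cardinal.aleph0)
    (A B : NuAlg.{u, w} ν) : Continuous (hatEquiv hν A B) := by
  have h1 : Continuous fun φ : LHom (hatK ν A).carrier B.carrier => NuTensor.map ν KOp φ :=
    NuTensor.continuous_map hν (hatK ν A).complete
  exact (LHom.continuous_comp_right (hatUnit hν A.carrier)).comp h1

lemma exists_comp_ofHom_eq {ν : Ordinal.{w}} (hν : ν.cof = Cardinal.aleph0)
    {A B : Type u} [LMCStarAlgebra A] [LMCStarAlgebra B] (hB : IsNuComplete ν B)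
    (d : GenPair ν A) (g : LHom d.Z B) :
    ∃ φ : LHom (NuCompletion ν (contSeminorms (limitZ ν A))) B,
      (∀ z, φ (NuCompletion.of ν _ z) = g (z.1 d)) ∧
      (NuTensor.map ν KOp φ).comp (hatUnit hν A) = (NuTensor.map ν KOp g).comp d.f :=
  ⟨NuCompletion.lift hν hB (g.comp (limitProj d)), NuCompletion.lift_ofHom hν hB _,
    map_comp_hatUnit_of_comp_ofHom_eq hν (NuCompletion.lift_comp_ofHom hν hB _)⟩

lemma exists_bijective_homotopyClasses {ν : Ordinal.{w}} (hν : ν.cof = Cardinal.aleph0)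
    {A B : Type u} [LMCStarAlgebra A] [LMCStarAlgebra B] (hB : IsNuComplete ν B) :
    ∃ Ψ : HomotopyClasses (NuCompletion ν (contSeminorms (limitZ ν A))) B →
        HomotopyClasses A (NuTensor ν B KOp), Function.Bijective Ψ ∧
      ∀ φ, Ψ (Quot.mk _ φ) = Quot.mk _ ((NuTensor.map ν KOp φ).comp (hatUnit hν A)) := by
  let e : LHom (NuCompletion ν (contSeminorms (limitZ ν A))) B ≃ LHom A (NuTensor ν B KOp) :=
    Equiv.ofBijective (fun φ => (NuTensor.map ν KOp φ).comp (hatUnit hν A))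
      ⟨map_comp_hatUnit_injective hν, map_comp_hatUnit_surjective hν hB⟩
  exact ⟨Quot.congr e fun φ ψ => (homotopic_map_comp_hatUnit_iff hν hB).symm,
    (Quot.congr e _).bijective, fun φ => rfl⟩

/-- The left adjoint of `– ⊗ K`. -/
def hatFunctor {ν : Ordinal.{w}} (hν : ν.cof = Cardinal.aleph0) :
    NuAlg.{u, w} ν ⥤ NuAlg.{u, w} ν :=
  Adjunction.leftAdjointOfEquiv (hatEquiv.{u, w} hν)
    fun A B B' β φ => hatEquiv_naturality hν A B B' β φ

/-- The functor is rebuilt with `hatK ν` as its object map, so that the bijections of the adjunction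
are literally the maps `hatEquiv`, to which the remaining properties refer. -/
lemma exists_adjunction {ν : Ordinal.{w}} (hν : ν.cof = Cardinal.aleph0) :
    ∃ adj : ({ obj := hatK ν
               map := (hatFunctor hν).map
               map_id := (hatFunctor hν).map_id
               map_comp := (hatFunctor hν).map_comp } :
          NuAlg.{u, w} ν ⥤ NuAlg.{u, w} ν) ⊣ tensorK ν,
      ∀ A B, adj.homEquiv A B = hatEquiv hν A B := by
  refine ⟨Adjunction.adjunctionOfEquivLeft (hatEquiv hν)
    fun A B B' β φ => hatEquiv_naturality hν A B B' β φ, fun A B => ?_⟩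
  exact congrFun (congrFun (Adjunction.mkOfHomEquiv_homEquiv _) A) B

end

theorem mainTheorem5 (ν : Ordinal.{w}) (hν : ν.cof = Cardinal.aleph0) :
    ∃ (m : ∀ A A' : NuAlg.{u, w} ν, (A ⟶ A') → (hatK ν A ⟶ hatK ν A'))
      (hid : ∀ A, m A A (𝟙 A) = 𝟙 (hatK ν A))
      (hcomp : ∀ (A A' A'' : NuAlg.{u, w} ν) (f : A ⟶ A') (g : A' ⟶ A''),
        m A A'' (f ≫ g) = m A A' f ≫ m A' A'' g)
      (adj : ({ obj := hatK ν
                map := fun {A A'} f => m A A' f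
                map_id := hid
                map_comp := fun {A A' A''} f g => hcomp A A' A'' f g } :
          NuAlg.{u, w} ν ⥤ NuAlg.{u, w} ν) ⊣ tensorK ν),
      (∀ A B : NuAlg.{u, w} ν, Continuous (adj.homEquiv A B)) ∧
      (∀ (A B : NuAlg.{u, w} ν) (d : GenPair ν A.carrier) (g : LHom d.Z B.carrier),
        ∃ φ : hatK ν A ⟶ B,
          (∀ z : limitZ ν A.carrier, φ.1 (NuCompletion.of ν _ z) = g (z.1 d)) ∧
          adj.homEquiv A B φ = (NuTensor.map ν KOp g).comp d.f) ∧
      (∀ A B : NuAlg.{u, w} ν,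
        ∃ Ψ : HomotopyClasses (hatK ν A).carrier B.carrier →
            HomotopyClasses A.carrier ((tensorK ν).obj B).carrier,
          Function.Bijective Ψ ∧
          ∀ φ : hatK ν A ⟶ B, Ψ (Quot.mk _ φ) = Quot.mk _ (adj.homEquiv A B φ)) := by
  obtain ⟨adj, hadj⟩ := exists_adjunction.{u, w} hν
  refine ⟨fun A A' f => (hatFunctor hν).map f, (hatFunctor hν).map_id,
    fun A A' A'' f g => (hatFunctor hν).map_comp f g, adj, fun A B => ?_, fun A B d g => ?_,
    fun A B => ?_⟩
  · rw [hadj]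
    exact continuous_hatEquiv hν A B
  · rw [hadj]
    exact exists_comp_ofHom_eq hν B.complete d g
  · rw [hadj]
    obtain ⟨Ψ, hΨ, h⟩ := exists_bijective_homotopyClasses hν (A := A.carrier) B.complete
    refine ⟨Ψ, hΨ, fun φ => (h φ).trans ?_⟩
    rfl
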